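/- Let $1\le p\le n$, let $A$ be a $p\times n$ matrix with entries in $\mathbb Z_{\ge0}$ and columns $\alpha^1,\dots,\alpha^n\in\mathbb Z_{\ge0}^p$, write $|\alpha^k|$ for the sum of the entries of $\alpha^k$ and $\langle\alpha^k,s\rangle=\sum_l\alpha^k_l s_l$. Fix $I=(i_1<\dots<i_p)$ in $\{1,\dots,n\}$ with minor $\Delta_I=\det(\alpha^j)_{j\in I}\neq0$, and a smooth test form with compact support $\varphi=\sum_I\varphi_I\,d\zeta\wedge d\bar\zeta[I]$ of bidegree $(n,n-p)$ on $\mathbb C^n$. Let $\Gamma^I(s,\varphi)$ be the meromorphic continuation to $\mathbb C^p$ of $$\frac{c_I\Delta_I}{(2\pi i)^p}\int_{\mathbb C^n}\varphi_I(\zeta)\bigwedge_{j\in I}\Big(\frac{|\zeta_j|^{2(\langle\alpha^j,s\rangle-1)}}{\zeta_j^{|\alpha^j|-1}}\,d\bar\zeta_j\wedge d\zeta_j\Big)\bigwedge_{k\notin I}\Big(\frac{|\zeta_k|^{2\langle\alpha^k,s\rangle}}{\zeta_k^{|\alpha^k|}}\,d\bar\zeta_k\wedge d\zeta_k\Big),$$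 where $c_I=(-1)^{i_1+\dots+i_p-p(p+1)/2+(n-p+1)(n-p)/2}$; the integral converges absolutely for $\Re s_1,\dots,\Re s_p>1$, and the poles lie on the hyperplanes $\langle\alpha^k,s\rangle=-\nu$ with $\nu=0,1,2,\dots$ for $k\in I$ and $\nu=1,2,\dots$ for $k\notin I$. Put $$K^I=\{x\in\mathbb R^p:\langle\alpha^k,x\rangle\ge0,\ k\in I\},\qquad K^I_0=K^I\cap\{x_1+\dots+x_p\le0\},\qquad M=\operatorname{int}K^I\cap\{x_1<1,\dots,x_p<1\},$$ let $q$ be the codimension of $K_0^I$ in $\mathbb R^p$, and assume $q\ge1$. Then there is a set $J=\{j_1,\dots,j_q\}\subset I$ of cardinality $q$ with $$K_0^I=\{x:\langle\alpha^j,x\rangle=0,\ j\in J;\ \langle\alpha^k,x\rangle\ge0,\ k\in I\setminus J\}.$$ Let $L^q=\{s\in\mathbb C^p:\langle\alpha^j,s\rangle=0,\ j\in J\}$. The composite Leray residue form $\operatorname{res}_{L^q}[\Gamma^I(s,\varphi)\,ds]$ along the hyperplanes $\langle\alpha^{j_1},s\rangle=0,\dots,\langle\alpha^{j_q},s\rangle=0$,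 taken in this order, exists at the points of $L^q$ that lie on no other of the above hyperplanes. Let $\gamma\in M$ and $\gamma^q\in M^q:=\operatorname{rel\,int}(K^I_0\cap\overline M)$ be such that $\langle\alpha^k,\gamma\rangle>-1$ and $\langle\alpha^k,\gamma^q\rangle>-1$ for all $k\notin I$ (for instance, $\gamma\in(0,1)^p$ and $\gamma^q\in M^q$ close to $0$). Then both integrals below converge absolutely, and $$\lim_{\tau\to0+}\frac1{(2\pi i)^p}\int_{\gamma+i\mathbb R^p}\tau^{-|s|}\,\Gamma(|s|+1)\prod_{k=1}^p\Gamma(1-s_k)\,\Gamma^I(s,\varphi)\,ds=\frac1{(2\pi i)^{p-q}}\int_{\gamma^q+i\,\Im L^q}\prod_{k=1}^p\Gamma(1-s_k)\,\operatorname{res}_{L^q}\big[\Gamma^I(s,\varphi)\,ds\big],$$ where $|s|=s_1+\dots+s_p$. Here $i\mathbb R^p$ has its standard orientation and $i\,\Im L^q$ is oriented so that a basis $iv_1,\dots,iv_{p-q}$ is positive if and only if $\det(\alpha^{j_1},\dots,\alpha^{j_q},v_1,\dots,v_{p-q})>0$; if $q=p$, then the integral on the right is the value at the point $\gamma^q=0$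 times the sign of $\det(\alpha^{j_1},\dots,\alpha^{j_q})$. -/

import Mathlib

open Filter Topology MeasureTheory
open scoped ContDiff

noncomputable section

namespace BochnerMartinelli

/-! ### Holomorphic forms on linear subspaces and Leray residues -/

section Residue

variable {V : Type} [NormedAddCommGroup V] [NormedSpace ℂ V]

/-- Differential forms of type `(k, 0)` on the complex linear subspace `W`; holomorphy is a
separate condition. -/
abbrev Form (W : Submodule ℂ V) (k : ℕ) : Type := W → W [⋀^Fin k]→ₗ[ℂ] ℂ

/-- The form has holomorphic coefficients near `a`. -/
def HolomorphicFormAt {W : Submodule ℂ V} {k : ℕ} (η : Form W k) (a : W) : Prop :=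
  ∀ v : Fin k → W, AnalyticAt ℂ (fun z => η z v) a

/-- The exterior product `l ∧ χ` of a linear form and a `k`-form:
`(l ∧ χ)(v₀, …, vₖ) = ∑ᵢ (-1)ⁱ l(vᵢ) χ(v₀, …, v̂ᵢ, …, vₖ)`. -/
def wedgeOne {E : Type} [AddCommGroup E] [Module ℂ E] {k : ℕ}
    (l : E →ₗ[ℂ] ℂ) (χ : E [⋀^Fin k]→ₗ[ℂ] ℂ) : E [⋀^Fin (k + 1)]→ₗ[ℂ] ℂ :=
  AlternatingMap.alternatizeUncurryFin (l.smulRight χ)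

/-- The inclusion of `W ∩ {l = 0}` in `W`. -/
abbrev sliceIncl (W : Submodule ℂ V) (l : V →ₗ[ℂ] ℂ) :
    (W ⊓ LinearMap.ker l : Submodule ℂ V) →ₗ[ℂ] W :=
  Submodule.inclusion inf_le_left

/-- `ρ` is, near the point `a` of the hyperplane `l = 0` of `W`, the Leray residue form of `ψ`:
`ψ = (dl / l) ∧ χ + θ` with `χ`, `θ` regular near `a`, and `ρ` is the restriction of `χ` to the
hyperplane. -/
def IsLerayResidueAt (W : Submodule ℂ V) (l : V →ₗ[ℂ] ℂ) {k : ℕ} (ψ : Form W (k + 1))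
    (ρ : Form (W ⊓ LinearMap.ker l) k) (a : (W ⊓ LinearMap.ker l : Submodule ℂ V)) : Prop :=
  ∃ (χ : Form W k) (θ : Form W (k + 1)),
    HolomorphicFormAt χ (sliceIncl W l a) ∧ HolomorphicFormAt θ (sliceIncl W l a) ∧
    (∀ᶠ z : W in 𝓝 (sliceIncl W l a), l (z : V) ≠ 0 →
      ψ z = (l (z : V))⁻¹ • wedgeOne (l ∘ₗ W.subtype) (χ z) + θ z) ∧
    ∀ᶠ z in 𝓝 a, ρ z = (χ (sliceIncl W l z)).compLinearMap (sliceIncl W l)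

/-- The intersection of `W` with the hyperplanes `f j = 0`, `j` in the list. -/
def interKer {ι : Type} (f : ι → V →ₗ[ℂ] ℂ) : List ι → Submodule ℂ V → Submodule ℂ V
  | [], W => W
  | j :: J, W => interKer f J (W ⊓ LinearMap.ker (f j))

theorem mem_interKer {ι : Type} (f : ι → V →ₗ[ℂ] ℂ) (J : List ι) (W : Submodule ℂ V) (x : V) :
    x ∈ interKer f J W ↔ x ∈ W ∧ ∀ j ∈ J, f j x = 0 := by
  induction J generalizing W with
  | nil => simp [interKer]
  | cons j J ih => simp [interKer, ih, and_assoc]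

/-- `ρ` is the composite residue form `(res_q ∘ ⋯ ∘ res_1)[ψ]` along the hyperplanes `f j = 0`,
with `j` running through the list, over the part of these hyperplanes that lies in `D`. Each
residue form is considered off the hyperplanes that are still to come, along which it may have
poles. -/
def IsCompositeResidue {ι : Type} (f : ι → V →ₗ[ℂ] ℂ) (D : Set V) :
    ∀ (J : List ι) (W : Submodule ℂ V) (m : ℕ),
      Form W (m + J.length) → Form (interKer f J W) m → Prop
  | [], W, _, ψ, ρ => ∀ a : W, (a : V) ∈ D → ρ a = ψ a
  | j :: J, W, m, ψ, ρ =>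
      ∃ σ : Form (W ⊓ LinearMap.ker (f j)) (m + J.length),
        (∀ a : (W ⊓ LinearMap.ker (f j) : Submodule ℂ V), (a : V) ∈ D →
          (∀ i ∈ J, f i (a : V) ≠ 0) → IsLerayResidueAt W (f j) ψ σ a) ∧
        IsCompositeResidue f D J (W ⊓ LinearMap.ker (f j)) m σ ρ

end Residue

/-! ### The Mellin transform of a monomial mapping -/

/-- A test form `φ = ∑_I φ_I dζ ∧ dζ̄[I]` of bidegree `(n, n - p)` on `ℂⁿ`, given by its
coefficients; `I` runs over the increasing sequences `i₁ < ⋯ < i_p`. -/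
structure TestForm (p n : ℕ) where
  coeff : (Fin p ↪o Fin n) → (Fin n → ℂ) → ℂ
  smooth : ∀ I, ContDiff ℝ ∞ (coeff I)
  compactSupport : ∀ I, HasCompactSupport (coeff I)

variable {p n : ℕ}

/-- The linear form `s ↦ ⟨αᵏ, s⟩`, where `αᵏ` is the `k`-th column of `A`. -/
def col (R : Type) [CommRing R] (A : Matrix (Fin p) (Fin n) ℕ) (k : Fin n) :
    (Fin p → R) →ₗ[R] R :=
  ∑ i, (A i k : R) • LinearMap.proj i

/-- The minor `Δ_I`. -/
def minor (A : Matrix (Fin p) (Fin n) ℕ) (I : Fin p ↪o Fin n) : ℤ :=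
  ((A.map (Nat.cast : ℕ → ℤ)).submatrix id I).det

/-- The sum `|αᵏ|` of the entries of the `k`-th column. -/
def colSum (A : Matrix (Fin p) (Fin n) ℕ) (k : Fin n) : ℕ := ∑ i, A i k

/-- The sign `c_I = (-1)^(|I| - (p+1)p/2 + (n-p+1)(n-p)/2)`, where `|I| = i₁ + ⋯ + i_p` for the
numbering of the coordinates from `1`. -/
def cSign (I : Fin p ↪o Fin n) : ℂ :=
  (-1 : ℂ) ^ ((∑ k, (((I k : ℕ) : ℤ) + 1)) - ((p : ℤ) + 1) * p / 2
    + ((n : ℤ) - p + 1) * ((n : ℤ) - p) / 2)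

/-- The coefficient of `⋀ⱼ (dζ̄ⱼ ∧ dζⱼ)` in the integral that defines `Γ^I(s, φ)`. -/
def mellinDensity (A : Matrix (Fin p) (Fin n) ℕ) (I : Fin p ↪o Fin n) (φ : TestForm p n)
    (s : Fin p → ℂ) (ζ : Fin n → ℂ) : ℂ :=
  φ.coeff I ζ
    * (∏ j : Fin p, ((‖ζ (I j)‖ : ℂ) ^ (2 * (col ℂ A (I j) s - 1))
        / ζ (I j) ^ ((colSum A (I j) : ℤ) - 1)))
    * ∏ k ∈ Finset.univ.filter (fun k => k ∉ Set.range I),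
        ((‖ζ k‖ : ℂ) ^ (2 * col ℂ A k s) / ζ k ^ colSum A k)

/-- The integral that defines `Γ^I(s, φ)` where it converges; `dζ̄ⱼ ∧ dζⱼ` is `2i` times the
Lebesgue measure of the plane. -/
def mellinIntegral (A : Matrix (Fin p) (Fin n) ℕ) (I : Fin p ↪o Fin n) (φ : TestForm p n)
    (s : Fin p → ℂ) : ℂ :=
  cSign I * (minor A I : ℂ) / (2 * Real.pi * Complex.I) ^ p
    * ((2 * Complex.I) ^ n * ∫ ζ : Fin n → ℂ, mellinDensity A I φ s ζ)

/-- The polar hyperplanes `⟨αᵏ, s⟩ = -ν` of `Γ^I`, with `ν ≥ 0` for `k ∈ I` and `ν ≥ 1` for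
`k ∉ I`, except the hyperplanes `⟨αʲ, s⟩ = 0` for the members `j` of `I` at the positions in the
list `J`. -/
def polarSet (A : Matrix (Fin p) (Fin n) ℕ) (I : Fin p ↪o Fin n) (J : List (Fin p)) :
    Set (Fin p → ℂ) :=
  {s | (∃ (j : Fin p) (ν : ℕ), (j ∈ J → 1 ≤ ν) ∧ col ℂ A (I j) s = -(ν : ℂ)) ∨
    ∃ (k : Fin n) (ν : ℕ), k ∉ Set.range I ∧ 1 ≤ ν ∧ col ℂ A k s = -(ν : ℂ)}

/-- `G` is the meromorphic continuation of the Mellin integral to all of `ℂᵖ`: it is holomorphic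
off the polar hyperplanes and equals the integral on `{Re s₁ > 1, …, Re s_p > 1}`, where the
integral converges absolutely. -/
def IsMellinContinuation (A : Matrix (Fin p) (Fin n) ℕ) (I : Fin p ↪o Fin n) (φ : TestForm p n)
    (G : (Fin p → ℂ) → ℂ) : Prop :=
  AnalyticOnNhd ℂ G (polarSet A I [])ᶜ ∧
    ∀ s : Fin p → ℂ, (∀ k, 1 < (s k).re) →
      Integrable (mellinDensity A I φ s) ∧ G s = mellinIntegral A I φ s

/-- The function `Γ^I(s, φ)`, continued meromorphically. -/
def mellinGamma (A : Matrix (Fin p) (Fin n) ℕ) (I : Fin p ↪o Fin n) (φ : TestForm p n) :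
    (Fin p → ℂ) → ℂ :=
  Classical.epsilon (IsMellinContinuation A I φ)

/-! ### The Mellin–Barnes integral -/

/-- The point `x + iy` of `ℂᵖ`. -/
def cpoint (x y : Fin p → ℝ) : Fin p → ℂ := fun k => (x k : ℂ) + Complex.I * (y k : ℂ)

/-- The coefficient of `ds₁ ∧ ⋯ ∧ ds_p` in the `p`-fold Mellin–Barnes integral. -/
def barnesIntegrand (A : Matrix (Fin p) (Fin n) ℕ) (I : Fin p ↪o Fin n) (φ : TestForm p n)
    (τ : ℝ) (s : Fin p → ℂ) : ℂ :=
  (τ : ℂ) ^ (-∑ k, s k) * Complex.Gamma ((∑ k, s k) + 1) * (∏ k, Complex.Gamma (1 - s k))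
    * mellinGamma A I φ s

/-- `(2πi)⁻ᵖ ∫_{γ + iℝᵖ} τ^{-|s|} Γ(|s|+1) ∏ Γ(1-s_k) Γ^I(s, φ) ds`, with `ds = iᵖ dy` on
`s = γ + iy`. -/
def barnesIntegral (A : Matrix (Fin p) (Fin n) ℕ) (I : Fin p ↪o Fin n) (φ : TestForm p n)
    (γ : Fin p → ℝ) (τ : ℝ) : ℂ :=
  1 / (2 * Real.pi * Complex.I) ^ p
    * (Complex.I ^ p * ∫ y : Fin p → ℝ, barnesIntegrand A I φ τ (cpoint γ y))

/-! ### The cone and its distinguished face -/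

/-- The cone `K^I`. -/
def cone (A : Matrix (Fin p) (Fin n) ℕ) (I : Fin p ↪o Fin n) : Set (Fin p → ℝ) :=
  {x | ∀ j, 0 ≤ col ℝ A (I j) x}

/-- The intersection `K₀^I` of the cone with the half-space `x₁ + ⋯ + x_p ≤ 0`. -/
def coneZero (A : Matrix (Fin p) (Fin n) ℕ) (I : Fin p ↪o Fin n) : Set (Fin p → ℝ) :=
  cone A I ∩ {x | ∑ k, x k ≤ 0}

/-- The codimension `q` of `K₀^I`. -/
def codimZero (A : Matrix (Fin p) (Fin n) ℕ) (I : Fin p ↪o Fin n) : ℕ :=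
  p - Module.finrank ℝ (Submodule.span ℝ (coneZero A I))

/-- The list `J` enumerates the positions in `I` of a subset of `I` of cardinality `q` such that
`K₀^I = {⟨αʲ, x⟩ = 0 for j ∈ J, ⟨αᵏ, x⟩ ≥ 0 for k ∈ I \ J}`. -/
def IsFaceIndexing (A : Matrix (Fin p) (Fin n) ℕ) (I : Fin p ↪o Fin n) (J : List (Fin p)) :
    Prop :=
  J.Nodup ∧ J.length = codimZero A I ∧
    coneZero A I = {x | (∀ j ∈ J, col ℝ A (I j) x = 0) ∧ ∀ k, k ∉ J → 0 ≤ col ℝ A (I k) x}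

/-- The set `M = int K^I ∩ {x₁ < 1, …, x_p < 1}`. -/
def admissible (A : Matrix (Fin p) (Fin n) ℕ) (I : Fin p ↪o Fin n) : Set (Fin p → ℝ) :=
  interior (cone A I) ∩ {x | ∀ k, x k < 1}

/-- The set `M^q`, the relative interior of `K₀^I ∩ closure M`. -/
def admissibleFace (A : Matrix (Fin p) (Fin n) ℕ) (I : Fin p ↪o Fin n) : Set (Fin p → ℝ) :=
  intrinsicInterior ℝ (coneZero A I ∩ closure (admissible A I))

/-- No polar hyperplane `⟨αᵏ, s⟩ = -ν`, `k ∉ I`, separates `x` from the origin. -/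
def PoleFree (A : Matrix (Fin p) (Fin n) ℕ) (I : Fin p ↪o Fin n) (x : Fin p → ℝ) : Prop :=
  ∀ k : Fin n, k ∉ Set.range I → -1 < col ℝ A k x

/-! ### The residue form and the integral over `γ^q + i Im L^q` -/

/-- The subspace `L^q` of `ℂᵖ` on which `⟨αʲ, s⟩ = 0` for `j` in `J`. -/
abbrev leaf (A : Matrix (Fin p) (Fin n) ℕ) (I : Fin p ↪o Fin n) (J : List (Fin p)) :
    Submodule ℂ (Fin p → ℂ) :=
  interKer (fun j => col ℂ A (I j)) J ⊤

/-- The real subspace `Re L^q = Im L^q` of `ℝᵖ`. -/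
def realLeaf (A : Matrix (Fin p) (Fin n) ℕ) (I : Fin p ↪o Fin n) (J : List (Fin p)) :
    Submodule ℝ (Fin p → ℝ) where
  carrier := {x | ∀ j ∈ J, col ℝ A (I j) x = 0}
  add_mem' hx hy j hj := by rw [map_add, hx j hj, hy j hj, add_zero]
  zero_mem' j _ := map_zero _
  smul_mem' c x hx j hj := by rw [map_smul, hx j hj, smul_zero]

theorem col_cpoint (A : Matrix (Fin p) (Fin n) ℕ) (k : Fin n) (x y : Fin p → ℝ) :
    col ℂ A k (cpoint x y) = (col ℝ A k x : ℂ) + Complex.I * (col ℝ A k y : ℂ) := by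
  simp only [col, cpoint, LinearMap.sum_apply, LinearMap.smul_apply, LinearMap.proj_apply,
    smul_eq_mul, Complex.ofReal_sum, Complex.ofReal_mul, Complex.ofReal_natCast, Finset.mul_sum,
    ← Finset.sum_add_distrib]
  exact Finset.sum_congr rfl fun i _ => by ring

/-- The point `x + iy` of `L^q`. -/
def leafPoint (A : Matrix (Fin p) (Fin n) ℕ) (I : Fin p ↪o Fin n) (J : List (Fin p))
    (x y : realLeaf A I J) : leaf A I J :=
  ⟨cpoint x.1 y.1, by
    rw [mem_interKer]
    refine ⟨Submodule.mem_top, fun j hj => ?_⟩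
    rw [col_cpoint, x.2 j hj, y.2 j hj]
    simp⟩

/-- The form `Γ^I(s, φ) ds₁ ∧ ⋯ ∧ ds_p` on `ℂᵖ`. -/
def mellinForm (A : Matrix (Fin p) (Fin n) ℕ) (I : Fin p ↪o Fin n) (φ : TestForm p n)
    {k : ℕ} (hk : k = p) : Form (⊤ : Submodule ℂ (Fin p → ℂ)) k :=
  fun s => mellinGamma A I φ (s : Fin p → ℂ) •
    ((Matrix.detRowAlternating (n := Fin p) (R := ℂ)).compLinearMap
      (Submodule.subtype ⊤)).domDomCongr (finCongr hk.symm)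

/-- `ρ` is the residue form `res_{L^q}[Γ^I(s, φ) ds]`, a form of degree `m = p - q` on `L^q`,
determined at the points of `L^q` that lie on no other polar hyperplane. -/
def IsMellinResidue (A : Matrix (Fin p) (Fin n) ℕ) (I : Fin p ↪o Fin n) (φ : TestForm p n)
    (J : List (Fin p)) {m : ℕ} (hm : m + J.length = p) (ρ : Form (leaf A I J) m) : Prop :=
  IsCompositeResidue (fun j => col ℂ A (I j)) (polarSet A I J)ᶜ J ⊤ m
    (mellinForm A I φ hm) ρ

/-- The orientation sign of the basis `v` of `i Im L^q`, namely the sign of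
`det(α^{j₁}, …, α^{j_q}, v₁, …, v_m)`. This is the orientation of `i Im L^q` for which
`dλ_{j₁}, …, dλ_{j_q}`, with `λⱼ = ⟨αʲ, s⟩`, followed by a positive frame on `i Im L^q` give the
orientation of `iℝᵖ`. If `m = 0` it is the sign of the point `L^q`. -/
def orientSign (A : Matrix (Fin p) (Fin n) ℕ) (I : Fin p ↪o Fin n) (J : List (Fin p))
    {m : ℕ} (hm : m + J.length = p) (v : Fin m → Fin p → ℝ) : ℝ :=
  Real.sign (Matrix.det (Matrix.of fun i : Fin p =>
    Fin.append (fun a : Fin J.length => fun l : Fin p => (A l (I (J.get a)) : ℝ)) v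
      (Fin.cast ((Nat.add_comm J.length m).trans hm).symm i)))

/-- The pull-back of `∏ Γ(1-s_k) ρ` under `t ↦ γ + i ∑ tₖ vₖ`, as a multiple of
`dt₁ ∧ ⋯ ∧ dt_m`. -/
def leafIntegrand (A : Matrix (Fin p) (Fin n) ℕ) (I : Fin p ↪o Fin n) (J : List (Fin p))
    {m : ℕ} (ρ : Form (leaf A I J) m) (γ : realLeaf A I J) (v : Fin m → realLeaf A I J)
    (t : Fin m → ℝ) : ℂ :=
  (∏ k, Complex.Gamma (1 - (leafPoint A I J γ (∑ a, t a • v a) : Fin p → ℂ) k))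
    * ρ (leafPoint A I J γ (∑ a, t a • v a)) (fun a => leafPoint A I J 0 (v a))

/-- The integral of `∏ Γ(1-s_k) ρ` over the oriented affine space `γ + i Im L^q`, computed in the
linear coordinates given by the basis `v` of `Im L^q`. -/
def leafIntegral (A : Matrix (Fin p) (Fin n) ℕ) (I : Fin p ↪o Fin n) (J : List (Fin p))
    {m : ℕ} (hm : m + J.length = p) (ρ : Form (leaf A I J) m) (γ : realLeaf A I J)
    (v : Fin m → realLeaf A I J) : ℂ :=
  (orientSign A I J hm (fun a => (v a : Fin p → ℝ)) : ℂ)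
    * ∫ t : Fin m → ℝ, leafIntegrand A I J ρ γ v t

end BochnerMartinelli

end

/-! Polar coordinates and integration by parts in the conjugate variables turn the Mellin integral
`Γ^I(s, φ)` into a product of Gamma functions of the exponents `μ_k` times an entire function that
is bounded on vertical strips. Hence `Γ^I` has simple poles only, and the residue form along `L^q`
is obtained by cancelling the polar factors `λ_a = ⟨α^{j_a}, s⟩`, `j_a ∈ J`, and contracting `ds`
with the vectors dual to the `αʲ`.

If `x₁ + ⋯ + x_p` is written as `∑ c_j ⟨αʲ, x⟩` over `j ∈ I`, then `q ≥ 1` forces `c_j ≥ 0`, and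
`J = {j : c_j > 0}`. So with `T = -log τ` the Barnes integrand is `e^{T ∑ c_a λ_a} Φ(s) / ∏ λ_a`,
where `Φ` is holomorphic and rapidly decreasing on a tube whose base is a convex set containing
both `γ` and `γ^q`. Writing `e^{T c_a λ_a} / λ_a` as the integral of `e^{u_a λ_a}` over
`u_a ≤ T c_a` expresses the Barnes integral as an integral over an orthant of the Laplace transform
`u ↦ ∫ e^{⟨u, λ⟩} Φ`. By Cauchy's theorem this transform may be computed over `γ^q + iℝᵖ`, or over
nearby translates of it, which makes it integrable over `ℝ^q`. As `T → ∞` the orthant exhausts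
`ℝ^q`, and Fourier inversion turns the limit into the integral of `Φ` over `γ^q + i Im L^q`. -/

noncomputable section

namespace BochnerMartinelli

/-! ### Integrals over tubes -/

section Tube

variable {p : ℕ}

theorem continuous_cpoint : Continuous fun z : (Fin p → ℝ) × (Fin p → ℝ) => cpoint z.1 z.2 := by
  unfold cpoint
  fun_prop

theorem cpoint_add_smul (x y d : Fin p → ℝ) (z : ℂ) :
    cpoint x y + z • (fun k => (d k : ℂ)) = cpoint (x + z.re • d) (y + z.im • d) := by
  ext k
  nth_rw 1 [← Complex.re_add_im z]
  simp only [cpoint, Pi.add_apply, Pi.smul_apply, smul_eq_mul, Complex.ofReal_add,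
    Complex.ofReal_mul]
  ring

/-- The function `F` is holomorphic at the points of the tube `K + iℝᵖ`, where `W` is a majorant
of `F` that depends only on the imaginary part. -/
structure IsTubeDominated (F : (Fin p → ℂ) → ℂ) (K : Set (Fin p → ℝ)) (W : (Fin p → ℝ) → ℝ) :
    Prop where
  differentiableAt : ∀ x ∈ K, ∀ y, DifferentiableAt ℂ F (cpoint x y)
  norm_le : ∀ x ∈ K, ∀ y, ‖F (cpoint x y)‖ ≤ W y

namespace IsTubeDominated

variable {F : (Fin p → ℂ) → ℂ} {K : Set (Fin p → ℝ)} {W : (Fin p → ℝ) → ℝ}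
  {x x' : Fin p → ℝ} {X Y : ℝ → Fin p → ℝ}

protected theorem continuous (hF : IsTubeDominated F K W) (hx : x ∈ K) :
    Continuous fun y => F (cpoint x y) :=
  continuous_iff_continuousAt.2 fun y =>
    (hF.differentiableAt x hx y).continuousAt.comp (f := fun y => cpoint x y)
      (continuous_cpoint.comp (Continuous.prodMk_right x)).continuousAt

protected theorem integrable (hF : IsTubeDominated F K W) (hW : Integrable W) (hx : x ∈ K) :
    Integrable fun y => F (cpoint x y) :=
  hW.mono' (hF.continuous hx).aestronglyMeasurable (.of_forall (hF.norm_le x hx))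

theorem continuousOn_path (hF : IsTubeDominated F K W) (hX : Continuous X) (hY : Continuous Y)
    (hXK : ∀ t ∈ Set.Icc (0 : ℝ) 1, X t ∈ K) :
    ContinuousOn (fun z : (Fin p → ℝ) × ℝ => F (cpoint (X z.2) (z.1 + Y z.2)))
      (Set.univ ×ˢ Set.Icc 0 1) := by
  intro z hz
  have hpath : Continuous fun z : (Fin p → ℝ) × ℝ => cpoint (X z.2) (z.1 + Y z.2) :=
    continuous_cpoint.comp (f := fun z : (Fin p → ℝ) × ℝ => (X z.2, z.1 + Y z.2)) (by fun_prop)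
  exact ((hF.differentiableAt _ (hXK _ hz.2) _).continuousAt.comp
    (f := fun z : (Fin p → ℝ) × ℝ => cpoint (X z.2) (z.1 + Y z.2))
      hpath.continuousAt).continuousWithinAt

theorem integrable_path (hF : IsTubeDominated F K W) (hW : Integrable W) (hX : Continuous X)
    (hY : Continuous Y) (hXK : ∀ t ∈ Set.Icc (0 : ℝ) 1, X t ∈ K) :
    Integrable (Function.uncurry fun (y : Fin p → ℝ) (t : ℝ) => F (cpoint (X t) (y + Y t)))
      (volume.prod (volume.restrict (Set.Ioc 0 1))) := by
  have hmeas : AEStronglyMeasurable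
      (Function.uncurry fun (y : Fin p → ℝ) (t : ℝ) => F (cpoint (X t) (y + Y t)))
      (volume.prod (volume.restrict (Set.Ioc 0 1))) := by
    rw [← Measure.restrict_univ (μ := (volume : Measure (Fin p → ℝ))), Measure.prod_restrict]
    exact ((hF.continuousOn_path hX hY hXK).mono
      (Set.prod_mono_right Set.Ioc_subset_Icc_self)).aestronglyMeasurable
        (MeasurableSet.univ.prod measurableSet_Ioc)
  have hK : ∀ᵐ t ∂volume.restrict (Set.Ioc (0 : ℝ) 1), X t ∈ K := by
    filter_upwards [ae_restrict_mem measurableSet_Ioc] with t ht using hXK t ⟨ht.1.le, ht.2⟩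
  rw [integrable_prod_iff' hmeas]
  constructor
  · filter_upwards [hK] with t ht using (hF.integrable hW ht).comp_add_right (Y t)
  · refine (integrable_const (∫ y, W y)).mono' hmeas.norm.prod_swap.integral_prod_right' ?_
    filter_upwards [hK] with t ht
    simp only [Function.uncurry_apply_pair]
    rw [Real.norm_of_nonneg (integral_nonneg fun _ => norm_nonneg _),
      integral_add_right_eq_self (fun y => ‖F (cpoint (X t) y)‖) (Y t)]
    exact integral_mono (hF.integrable hW ht).norm hW (hF.norm_le _ ht)

theorem integrable_intervalIntegral (hF : IsTubeDominated F K W) (hW : Integrable W)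
    (hX : Continuous X) (hY : Continuous Y) (hXK : ∀ t ∈ Set.Icc (0 : ℝ) 1, X t ∈ K) :
    Integrable fun y => ∫ t in (0 : ℝ)..1, F (cpoint (X t) (y + Y t)) := by
  simp only [intervalIntegral.integral_of_le zero_le_one]
  exact (hF.integrable_path hW hX hY hXK).integral_prod_left

-- Translation invariance in `y` removes the imaginary part `Y` of the path.
theorem integral_intervalIntegral (hF : IsTubeDominated F K W) (hW : Integrable W)
    (hX : Continuous X) (hY : Continuous Y) (hXK : ∀ t ∈ Set.Icc (0 : ℝ) 1, X t ∈ K) :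
    ∫ y, ∫ t in (0 : ℝ)..1, F (cpoint (X t) (y + Y t))
      = ∫ t in (0 : ℝ)..1, ∫ y, F (cpoint (X t) y) := by
  simp only [intervalIntegral.integral_of_le zero_le_one]
  rw [integral_integral_swap (hF.integrable_path hW hX hY hXK)]
  exact integral_congr_ae (.of_forall fun t =>
    integral_add_right_eq_self (fun y => F (cpoint (X t) y)) (Y t))

theorem intervalIntegral_sub_horizontal (hF : IsTubeDominated F K W) (hK : Convex ℝ K)
    (hx : x ∈ K) (hx' : x' ∈ K) (y : Fin p → ℝ) :
    (∫ t in (0 : ℝ)..1, F (cpoint (x + t • (x' - x)) (y + 0)))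
      - ∫ t in (0 : ℝ)..1, F (cpoint (x + t • (x' - x)) (y + (x' - x)))
      = Complex.I • ((∫ t in (0 : ℝ)..1, F (cpoint x (y + t • (x' - x))))
        - ∫ t in (0 : ℝ)..1, F (cpoint x' (y + t • (x' - x)))) := by
  have hrect := Complex.integral_boundary_rect_eq_zero_of_differentiableOn
    (fun z => F (cpoint x y + z • fun k => (((x' - x) k : ℝ) : ℂ))) 0 (1 + Complex.I)
    fun z hz => ?_
  · simp only [cpoint_add_smul] at hrect
    simp only [Complex.zero_re, Complex.zero_im, Complex.add_re, Complex.add_im, Complex.one_re,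
      Complex.one_im, Complex.I_re, Complex.I_im, Complex.ofReal_re, Complex.ofReal_im,
      Complex.mul_re, Complex.mul_im, Complex.ofReal_zero, Complex.ofReal_one, add_zero, zero_add,
      mul_zero, zero_mul, mul_one, sub_self, one_smul, zero_smul, add_sub_cancel] at hrect
    rw [add_zero, smul_sub]
    linear_combination hrect
  · have hre : z.re ∈ Set.Icc (0 : ℝ) 1 := by simpa [Set.uIcc_of_le] using hz.1
    have hd := hF.differentiableAt _ (hK.add_smul_sub_mem hx hx' hre) (y + z.im • (x' - x))
    rw [← cpoint_add_smul] at hd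
    exact (hd.comp z (by fun_prop)).differentiableWithinAt

-- Cauchy's theorem on the squares with the diagonal `(1 + i) (x' - x)`, integrated over `y`: the
-- two horizontal sides cancel.
theorem integral_eq (hF : IsTubeDominated F K W) (hW : Integrable W) (hK : Convex ℝ K)
    (hx : x ∈ K) (hx' : x' ∈ K) : ∫ y, F (cpoint x y) = ∫ y, F (cpoint x' y) := by
  have hX : Continuous fun t : ℝ => x + t • (x' - x) := by fun_prop
  have hY : Continuous fun t : ℝ => t • (x' - x) := by fun_prop
  have hXK : ∀ t ∈ Set.Icc (0 : ℝ) 1, x + t • (x' - x) ∈ K := fun t ht =>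
    hK.add_smul_sub_mem hx hx' ht
  have hsquare := integral_congr_ae (μ := volume)
    (.of_forall (hF.intervalIntegral_sub_horizontal hK hx hx'))
  rw [integral_sub (hF.integrable_intervalIntegral hW hX continuous_const hXK)
      (hF.integrable_intervalIntegral hW hX continuous_const hXK), integral_smul,
    integral_sub (hF.integrable_intervalIntegral hW continuous_const hY fun _ _ => hx)
      (hF.integrable_intervalIntegral hW continuous_const hY fun _ _ => hx'),
    hF.integral_intervalIntegral hW hX continuous_const hXK,
    hF.integral_intervalIntegral hW hX continuous_const hXK,
    hF.integral_intervalIntegral hW continuous_const hY fun _ _ => hx',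
    hF.integral_intervalIntegral hW continuous_const hY fun _ _ => hx] at hsquare
  simpa [sub_eq_zero] using hsquare.symm

end IsTubeDominated

end Tube

/-! ### Fourier inversion on a slice -/

section Fourier

variable {ι : Type*} [Fintype ι]

/-- The Fourier transform on `ℝ^ι`, normalised with the kernel `exp (i ⟨u, r⟩)`. -/
def piFourier (h : (ι → ℝ) → ℂ) (u : ι → ℝ) : ℂ :=
  ∫ r : ι → ℝ, Complex.exp (Complex.I * ((∑ a, u a * r a : ℝ) : ℂ)) * h r

theorem fourier_comp_ofLp (h : (ι → ℝ) → ℂ) (ξ : EuclideanSpace ℝ ι) :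
    FourierTransform.fourier (fun z : EuclideanSpace ℝ ι => h z.ofLp) ξ
      = piFourier h ((-(2 * Real.pi)) • ξ.ofLp) := by
  rw [Real.fourier_eq', piFourier, ← (PiLp.volume_preserving_ofLp ι).integral_comp
    (MeasurableEquiv.toLp 2 (ι → ℝ)).symm.measurableEmbedding]
  refine integral_congr_ae (.of_forall fun z => ?_)
  simp only [PiLp.inner_apply, Pi.smul_apply, smul_eq_mul, Finset.mul_sum, RCLike.inner_apply,
    conj_trivial, mul_comm Complex.I, neg_mul, mul_assoc]

theorem integral_piFourier {h : (ι → ℝ) → ℂ} (hh : Integrable h) (hc : ContinuousAt h 0)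
    (hg : Integrable (piFourier h)) :
    ∫ u, piFourier h u = (2 * Real.pi) ^ Fintype.card ι * h 0 := by
  have hmp := PiLp.volume_preserving_ofLp ι
  have hme : MeasurableEmbedding (@WithLp.ofLp 2 (ι → ℝ)) :=
    (MeasurableEquiv.toLp 2 (ι → ℝ)).symm.measurableEmbedding
  have hpi : 0 < 2 * Real.pi := by positivity
  have hF : Integrable (FourierTransform.fourier fun z : EuclideanSpace ℝ ι => h z.ofLp) := by
    rw [funext (fourier_comp_ofLp h)]
    exact (hmp.integrable_comp_emb hme).2 (hg.comp_smul (neg_ne_zero.2 hpi.ne'))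
  have hinv := ((hmp.integrable_comp_emb hme).2 hh).fourierInv_fourier_eq hF (v := 0)
    (hc.comp (f := fun z : EuclideanSpace ℝ ι => z.ofLp) (PiLp.continuous_ofLp 2 _).continuousAt)
  rw [Real.fourierInv_eq'] at hinv
  simp only [Function.comp_def, inner_zero_right, mul_zero, Complex.ofReal_zero, zero_mul,
    Complex.exp_zero, one_smul, fourier_comp_ofLp, WithLp.ofLp_zero] at hinv
  rw [hmp.integral_comp hme fun u => piFourier h ((-(2 * Real.pi)) • u),
    Measure.integral_comp_smul, Module.finrank_fintype_fun_eq_card, abs_inv, abs_pow, abs_neg,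
    abs_of_pos hpi, Complex.real_smul] at hinv
  rw [← hinv, ← mul_assoc, ← Complex.ofReal_ofNat, ← Complex.ofReal_mul, ← Complex.ofReal_pow,
    ← Complex.ofReal_mul, mul_inv_cancel₀ (pow_ne_zero _ hpi.ne'), Complex.ofReal_one, one_mul]

end Fourier

section Frame

variable {p q m : ℕ}

theorem measurePreserving_append (q m : ℕ) :
    MeasurePreserving (fun z : (Fin q → ℝ) × (Fin m → ℝ) => Fin.append z.1 z.2)
      volume volume := by
  have hsum := volume_measurePreserving_sumPiEquivProdPi_symm (fun _ : Fin q ⊕ Fin m => ℝ)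
  have hcongr := volume_measurePreserving_piCongrLeft (fun _ : Fin (q + m) => ℝ) finSumFinEquiv
  convert hcongr.comp hsum using 1
  ext z i
  refine Fin.addCases (fun i => ?_) (fun i => ?_) i
  · rw [Fin.append_left]
    exact (Equiv.piCongrLeft_sumInl (fun _ => ℝ) finSumFinEquiv z.1 z.2 i).symm
  · rw [Fin.append_right]
    exact (Equiv.piCongrLeft_sumInr (fun _ => ℝ) finSumFinEquiv z.1 z.2 i).symm

/-- The linear coordinates `(r, t) ↦ ∑ r_a w_a + ∑ t_b v_b` on `ℝᵖ`. -/
def frameMap (w : Fin q → Fin p → ℝ) (v : Fin m → Fin p → ℝ) :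
    ((Fin q → ℝ) × (Fin m → ℝ)) →ₗ[ℝ] Fin p → ℝ :=
  (Fintype.linearCombination ℝ w).coprod (Fintype.linearCombination ℝ v)

/-- The matrix with the rows `w₁, …, w_q, v₁, …, v_m`. -/
def frameMatrix {R : Type*} (hp : q + m = p) (w : Fin q → Fin p → R) (v : Fin m → Fin p → R) :
    Matrix (Fin p) (Fin p) R :=
  Matrix.of fun i => Fin.append w v (Fin.cast hp.symm i)

theorem frameMap_apply (w : Fin q → Fin p → ℝ) (v : Fin m → Fin p → ℝ)
    (z : (Fin q → ℝ) × (Fin m → ℝ)) :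
    frameMap w v z = ∑ a, z.1 a • w a + ∑ b, z.2 b • v b := by
  simp [frameMap, Fintype.linearCombination_apply]

theorem continuous_frameMap (w : Fin q → Fin p → ℝ) (v : Fin m → Fin p → ℝ) :
    Continuous (frameMap w v) :=
  LinearMap.continuous_of_finiteDimensional _

theorem frameMap_eq_toLin' (w : Fin q → Fin (q + m) → ℝ) (v : Fin m → Fin (q + m) → ℝ)
    (z : (Fin q → ℝ) × (Fin m → ℝ)) :
    frameMap w v z = Matrix.toLin' (frameMatrix rfl w v).transpose (Fin.append z.1 z.2) := by
  ext k
  simp only [frameMap_apply, frameMatrix, Matrix.toLin'_apply, Matrix.mulVec, dotProduct,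
    Matrix.transpose_apply, Matrix.of_apply, Fin.sum_univ_add, Fin.append_left, Fin.append_right,
    Pi.add_apply, Finset.sum_apply, Pi.smul_apply, smul_eq_mul, Fin.cast_eq_self, mul_comm]

variable {hp : q + m = p} {w : Fin q → Fin p → ℝ} {v : Fin m → Fin p → ℝ}

theorem frameMap_injective (hdet : (frameMatrix hp w v).det ≠ 0) :
    Function.Injective (frameMap w v) := by
  subst hp
  have hunit : IsUnit (frameMatrix rfl w v).transpose :=
    (Matrix.isUnit_iff_isUnit_det _).2 (by simpa using hdet)
  have happend : Function.Injective fun z : (Fin q → ℝ) × (Fin m → ℝ) => Fin.append z.1 z.2 :=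
    (Fin.appendEquiv q m).injective
  rw [funext (frameMap_eq_toLin' w v)]
  exact (Matrix.mulVec_injective_iff_isUnit.2 hunit).comp happend

theorem measurableEmbedding_frameMap (hdet : (frameMatrix hp w v).det ≠ 0) :
    MeasurableEmbedding (frameMap w v) :=
  (continuous_frameMap w v).measurableEmbedding (frameMap_injective hdet)

theorem map_frameMap (hdet : (frameMatrix hp w v).det ≠ 0) :
    Measure.map (frameMap w v) volume
      = ENNReal.ofReal |(frameMatrix hp w v).det|⁻¹ • volume := by
  subst hp
  have hmap := Real.map_matrix_volume_pi_eq_smul_volume_pi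
    (M := (frameMatrix rfl w v).transpose) (by rwa [Matrix.det_transpose])
  rw [Matrix.det_transpose, abs_inv] at hmap
  rw [← hmap, ← (measurePreserving_append q m).map_eq, Measure.map_map
    (LinearMap.continuous_of_finiteDimensional _).measurable
    (measurePreserving_append q m).measurable]
  exact congrArg (Measure.map · volume) (funext (frameMap_eq_toLin' w v))

theorem integral_eq_det_mul_integral_frameMap (hdet : (frameMatrix hp w v).det ≠ 0)
    (f : (Fin p → ℝ) → ℂ) :
    ∫ y, f y = |(frameMatrix hp w v).det| * ∫ z, f (frameMap w v z) := by
  rw [← (measurableEmbedding_frameMap hdet).integral_map, map_frameMap hdet,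
    integral_smul_measure, ENNReal.toReal_ofReal (by positivity), Complex.real_smul, ← mul_assoc,
    ← Complex.ofReal_mul, mul_inv_cancel₀ (abs_ne_zero.2 hdet), Complex.ofReal_one, one_mul]

theorem integrable_comp_frameMap (hdet : (frameMatrix hp w v).det ≠ 0) {f : (Fin p → ℝ) → ℂ}
    (hf : Integrable f) : Integrable fun z => f (frameMap w v z) := by
  refine (measurableEmbedding_frameMap hdet).integrable_map_iff.1 ?_
  rw [map_frameMap hdet]
  exact hf.smul_measure ENNReal.ofReal_ne_top

end Frame

section Decay

variable {p q m : ℕ}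

/-- The integrable majorant `(1 + ‖y‖)^(-p-1)` on `ℝᵖ`. -/
def decay (y : Fin p → ℝ) : ℝ := (1 + ‖y‖) ^ (-((p : ℝ) + 1))

theorem decay_nonneg (y : Fin p → ℝ) : 0 ≤ decay y := by
  unfold decay
  positivity

theorem integrable_decay : Integrable (decay (p := p)) :=
  integrable_one_add_norm (by simp)

theorem exists_integrable_decay_frameMap_le {hp : q + m = p} {w : Fin q → Fin p → ℝ}
    {v : Fin m → Fin p → ℝ} (hdet : (frameMatrix hp w v).det ≠ 0) :
    ∃ B : (Fin m → ℝ) → ℝ, Integrable B ∧ ∀ z, decay (frameMap w v z) ≤ B z.2 := by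
  obtain ⟨K, -, hK⟩ := (frameMap w v).exists_antilipschitzWith
    (LinearMap.ker_eq_bot.2 (frameMap_injective hdet))
  have hle : ∀ z, ‖z.2‖ ≤ K * ‖frameMap w v z‖ := fun z => (norm_snd_le z).trans <| by
    simpa using hK.le_mul_dist z 0
  have hK1 : (0 : ℝ) < 1 + K := by positivity
  refine ⟨fun t => ((1 + K : ℝ)⁻¹) ^ (-((p : ℝ) + 1)) * (1 + ‖t‖) ^ (-((p : ℝ) + 1)),
    (integrable_one_add_norm ?_).const_mul _, fun z => ?_⟩
  · rw [Module.finrank_fin_fun, ← hp]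
    push_cast
    linarith [(Nat.cast_nonneg q : (0 : ℝ) ≤ q)]
  · simp only [decay]
    rw [← Real.mul_rpow (by positivity) (by positivity)]
    refine Real.rpow_le_rpow_of_nonpos (by positivity) ?_
      (by linarith [(Nat.cast_nonneg p : (0 : ℝ) ≤ p)])
    rw [inv_mul_le_iff₀ hK1]
    nlinarith [hle z, norm_nonneg (frameMap w v z), K.coe_nonneg]

end Decay

section Slice

variable {p q m : ℕ}

/-- The vectors `w₁, …, w_q, v₁, …, v_m` are a basis of `ℝᵖ` in which the linear forms `l₁, …, l_q`
are the first `q` coordinates. -/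
structure IsAdaptedFrame (hp : q + m = p) (l : Fin q → (Fin p → ℝ) →ₗ[ℝ] ℝ)
    (w : Fin q → Fin p → ℝ) (v : Fin m → Fin p → ℝ) : Prop where
  det_ne_zero : (frameMatrix hp w v).det ≠ 0
  apply_left : ∀ a b, l a (w b) = if a = b then 1 else 0
  apply_right : ∀ a b, l a (v b) = 0

variable {hp : q + m = p} {l : Fin q → (Fin p → ℝ) →ₗ[ℝ] ℝ} {w : Fin q → Fin p → ℝ}
  {v : Fin m → Fin p → ℝ} {H : (Fin p → ℝ) → ℂ} {B : (Fin m → ℝ) → ℝ}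

theorem IsAdaptedFrame.apply_frameMap (h : IsAdaptedFrame hp l w v) (a : Fin q)
    (z : (Fin q → ℝ) × (Fin m → ℝ)) : l a (frameMap w v z) = z.1 a := by
  simp [frameMap_apply, map_sum, h.apply_left, h.apply_right]

theorem integrable_slice (hH : Continuous H) (hB : Integrable B)
    (hb : ∀ z, ‖H (frameMap w v z)‖ ≤ B z.2) (r : Fin q → ℝ) :
    Integrable fun t => H (frameMap w v (r, t)) :=
  hB.mono' (hH.comp ((continuous_frameMap w v).comp (by fun_prop))).aestronglyMeasurable
    (.of_forall fun t => hb (r, t))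

theorem continuous_integral_slice (hH : Continuous H) (hB : Integrable B)
    (hb : ∀ z, ‖H (frameMap w v z)‖ ≤ B z.2) :
    Continuous fun r => ∫ t, H (frameMap w v (r, t)) :=
  continuous_of_dominated (fun r => (integrable_slice hH hB hb r).aestronglyMeasurable)
    (fun r => .of_forall fun t => hb (r, t)) hB
    (.of_forall fun _ => hH.comp ((continuous_frameMap w v).comp (by fun_prop)))

theorem IsAdaptedFrame.integral_exp_mul_eq (h : IsAdaptedFrame hp l w v) (hHi : Integrable H)
    (u : Fin q → ℝ) :
    ∫ y, Complex.exp (Complex.I * ((∑ a, u a * l a y : ℝ) : ℂ)) * H y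
      = |(frameMatrix hp w v).det| * piFourier (fun r => ∫ t, H (frameMap w v (r, t))) u := by
  have hint : Integrable (fun z : (Fin q → ℝ) × (Fin m → ℝ) =>
      Complex.exp (Complex.I * ((∑ a, u a * z.1 a : ℝ) : ℂ)) * H (frameMap w v z))
      (volume.prod volume) := by
    refine (integrable_comp_frameMap h.det_ne_zero hHi).bdd_mul (c := 1)
      (Continuous.aestronglyMeasurable (by fun_prop)) (.of_forall fun z => ?_)
    rw [mul_comm, Complex.norm_exp_ofReal_mul_I]
  rw [integral_eq_det_mul_integral_frameMap h.det_ne_zero]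
  simp only [h.apply_frameMap]
  rw [Measure.volume_eq_prod, integral_prod _ hint]
  simp only [integral_const_mul, piFourier]

theorem IsAdaptedFrame.integral_integral_exp_mul (h : IsAdaptedFrame hp l w v) (hH : Continuous H)
    (hHi : Integrable H) (hB : Integrable B) (hb : ∀ z, ‖H (frameMap w v z)‖ ≤ B z.2)
    (hg : Integrable fun u : Fin q → ℝ =>
      ∫ y, Complex.exp (Complex.I * ((∑ a, u a * l a y : ℝ) : ℂ)) * H y) :
    ∫ u : Fin q → ℝ, ∫ y, Complex.exp (Complex.I * ((∑ a, u a * l a y : ℝ) : ℂ)) * H y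
      = (2 * Real.pi) ^ q * (|(frameMatrix hp w v).det| * ∫ t, H (frameMap w v (0, t))) := by
  have hdet : ((|(frameMatrix hp w v).det| : ℝ) : ℂ) ≠ 0 := by simpa using h.det_ne_zero
  simp only [h.integral_exp_mul_eq hHi] at hg ⊢
  have hg' : Integrable (piFourier fun r => ∫ t, H (frameMap w v (r, t))) := by
    simpa only [inv_mul_cancel_left₀ hdet]
      using hg.const_mul ((|(frameMatrix hp w v).det| : ℝ) : ℂ)⁻¹
  rw [integral_const_mul, integral_piFourier
    (integrable_comp_frameMap h.det_ne_zero hHi).integral_prod_left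
    (continuous_integral_slice hH hB hb).continuousAt hg', Fintype.card_fin]
  ring

end Slice

/-! ### Asymptotics of a Barnes integral -/

section Barnes

variable {p q m : ℕ}

/-- The `ℂ`-linear extension to `ℂᵖ` of a linear form on `ℝᵖ`. -/
def complexify (l : (Fin p → ℝ) →ₗ[ℝ] ℝ) : (Fin p → ℂ) →ₗ[ℂ] ℂ :=
  ∑ i, (l (Pi.single i 1) : ℂ) • LinearMap.proj i

theorem complexify_cpoint (l : (Fin p → ℝ) →ₗ[ℝ] ℝ) (x y : Fin p → ℝ) :
    complexify l (cpoint x y) = l x + Complex.I * l y := by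
  have hx := congrArg ((↑) : ℝ → ℂ) (LinearMap.pi_apply_eq_sum_univ l x)
  have hy := congrArg ((↑) : ℝ → ℂ) (LinearMap.pi_apply_eq_sum_univ l y)
  have hsingle : ∀ i : Fin p, (Pi.single i 1 : Fin p → ℝ) = fun j => if i = j then 1 else 0 :=
    fun i => funext fun j => by simp [Pi.single_apply, eq_comm]
  simp only [smul_eq_mul, Complex.ofReal_sum, Complex.ofReal_mul] at hx hy
  simp only [complexify, cpoint, hsingle, LinearMap.sum_apply, LinearMap.smul_apply,
    LinearMap.proj_apply, smul_eq_mul, hx, hy, Finset.mul_sum, ← Finset.sum_add_distrib]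
  exact Finset.sum_congr rfl fun i _ => by ring

theorem re_complexify_cpoint (l : (Fin p → ℝ) →ₗ[ℝ] ℝ) (x y : Fin p → ℝ) :
    (complexify l (cpoint x y)).re = l x := by
  simp [complexify_cpoint]

theorem continuous_complexify_cpoint (l : (Fin p → ℝ) →ₗ[ℝ] ℝ) (x : Fin p → ℝ) :
    Continuous fun y => complexify l (cpoint x y) :=
  (LinearMap.continuous_of_finiteDimensional _).comp
    (continuous_cpoint.comp (Continuous.prodMk_right x))

variable {l : Fin q → (Fin p → ℝ) →ₗ[ℝ] ℝ} {Φ : (Fin p → ℂ) → ℂ} {K : Set (Fin p → ℝ)}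
  {W : (Fin p → ℝ) → ℝ} {x x' : Fin p → ℝ}

theorem norm_exp_sum_complexify (l : Fin q → (Fin p → ℝ) →ₗ[ℝ] ℝ) (u : Fin q → ℝ)
    (x y : Fin p → ℝ) :
    ‖Complex.exp (∑ a, u a * complexify (l a) (cpoint x y))‖ = Real.exp (∑ a, u a * l a x) := by
  simp only [Complex.norm_exp, Complex.re_sum, Complex.re_ofReal_mul, re_complexify_cpoint]

/-- The integral of `e^{⟨u, λ⟩} Φ` over the real directions of the tube, where `λ_a` is the
extension of `l_a`. -/
def tubeLaplace (l : Fin q → (Fin p → ℝ) →ₗ[ℝ] ℝ) (Φ : (Fin p → ℂ) → ℂ) (x : Fin p → ℝ)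
    (u : Fin q → ℝ) : ℂ :=
  ∫ y, Complex.exp (∑ a, u a * complexify (l a) (cpoint x y)) * Φ (cpoint x y)

namespace IsTubeDominated

theorem exp_mul (hΦ : IsTubeDominated Φ K W) (l : Fin q → (Fin p → ℝ) →ₗ[ℝ] ℝ) (u : Fin q → ℝ)
    (R : ℝ) :
    IsTubeDominated (fun s => Complex.exp (∑ a, u a * complexify (l a) s) * Φ s)
      {x ∈ K | ∑ a, u a * l a x ≤ R} (fun y => Real.exp R * W y) where
  differentiableAt x hx y := by
    refine DifferentiableAt.mul (DifferentiableAt.cexp (DifferentiableAt.fun_sum fun a _ => ?_))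
      (hΦ.differentiableAt x hx.1 y)
    exact (LinearMap.toContinuousLinearMap (complexify (l a))).differentiableAt.const_mul _
  norm_le x hx y := by
    rw [norm_mul, norm_exp_sum_complexify]
    exact mul_le_mul (Real.exp_le_exp.2 hx.2) (hΦ.norm_le x hx.1 y) (norm_nonneg _)
      (Real.exp_nonneg _)

theorem tubeLaplace_eq (hΦ : IsTubeDominated Φ K W) (hW : Integrable W) (hK : Convex ℝ K)
    (hx : x ∈ K) (hx' : x' ∈ K) (u : Fin q → ℝ) : tubeLaplace l Φ x u = tubeLaplace l Φ x' u := by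
  set R := max (∑ a, u a * l a x) (∑ a, u a * l a x')
  have hconv : Convex ℝ {x ∈ K | ∑ a, u a * l a x ≤ R} := by
    have hlin : (fun x => ∑ a, u a * l a x) = ∑ a, u a • l a := by
      ext x
      simp
    refine hK.inter (convex_halfSpace_le (f := fun x => ∑ a, u a * l a x) ?_ R)
    rw [hlin]
    exact LinearMap.isLinear _
  exact (hΦ.exp_mul l u R).integral_eq (hW.const_mul _) hconv ⟨hx, le_max_left _ _⟩
    ⟨hx', le_max_right _ _⟩

theorem norm_tubeLaplace_le (hΦ : IsTubeDominated Φ K W) (hW : Integrable W) (hx : x ∈ K)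
    (u : Fin q → ℝ) :
    ‖tubeLaplace l Φ x u‖ ≤ Real.exp (∑ a, u a * l a x) * ∫ y, W y := by
  rw [← integral_const_mul]
  exact norm_integral_le_of_norm_le (hW.const_mul _)
    (.of_forall ((hΦ.exp_mul l u (∑ a, u a * l a x)).norm_le x ⟨hx, le_rfl⟩))

theorem continuous_exp_mul (hΦ : IsTubeDominated Φ K W) (hx : x ∈ K) :
    Continuous fun z : (Fin q → ℝ) × (Fin p → ℝ) =>
      Complex.exp (∑ a, z.1 a * complexify (l a) (cpoint x z.2)) * Φ (cpoint x z.2) := by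
  refine Continuous.mul ?_ ((hΦ.continuous hx).comp continuous_snd)
  refine Complex.continuous_exp.comp (continuous_finsetSum _ fun a _ => Continuous.mul ?_ ?_)
  · exact Complex.continuous_ofReal.comp ((continuous_apply a).comp continuous_fst)
  · exact (continuous_complexify_cpoint (l a) x).comp continuous_snd

theorem aestronglyMeasurable_tubeLaplace (hΦ : IsTubeDominated Φ K W) (hx : x ∈ K) :
    AEStronglyMeasurable (tubeLaplace l Φ x) volume :=
  ((hΦ.continuous_exp_mul hx).aestronglyMeasurable
    (μ := (volume : Measure (Fin q → ℝ)).prod volume)).integral_prod_right'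

end IsTubeDominated

theorem integrable_exp_neg_mul_abs {η : ℝ} (hη : 0 < η) :
    Integrable fun t : ℝ => Real.exp (-(η * |t|)) := by
  rw [← integrableOn_univ, ← Set.Iic_union_Ioi (a := (0 : ℝ)), integrableOn_union]
  constructor
  · refine (integrableOn_exp_mul_Iic hη 0).congr_fun (fun t ht => ?_) measurableSet_Iic
    simp only [abs_of_nonpos (Set.mem_Iic.1 ht), mul_neg, neg_neg]
  · refine (integrableOn_exp_mul_Ioi (neg_lt_zero.2 hη) 0).congr_fun (fun t ht => ?_)
      measurableSet_Ioi
    simp only [abs_of_pos (Set.mem_Ioi.1 ht), neg_mul]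

section Box

variable {w : Fin q → Fin p → ℝ} {γ x₀ : Fin p → ℝ} {η : ℝ}

-- The exponential is small at the vertex `x₀ - η ∑ sign (u_a) w_a` of the box.
theorem IsTubeDominated.norm_tubeLaplace_le_prod (hΦ : IsTubeDominated Φ K W) (hW : Integrable W)
    (hK : Convex ℝ K) (hlw : ∀ a b, l a (w b) = if a = b then 1 else 0) (hγ : γ ∈ K)
    (hx₀ : ∀ a, l a x₀ = 0) (hη : 0 ≤ η)
    (hbox : ∀ ε : Fin q → ℝ, (∀ a, |ε a| ≤ η) → x₀ + ∑ a, ε a • w a ∈ K) (u : Fin q → ℝ) :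
    ‖tubeLaplace l Φ γ u‖ ≤ (∏ a, Real.exp (-(η * |u a|))) * ∫ y, W y := by
  have hvertex : x₀ + ∑ a, (-(η * SignType.sign (u a))) • w a ∈ K := hbox _ fun a => by
    rw [abs_neg, abs_mul, abs_of_nonneg hη]
    refine mul_le_of_le_one_right hη ?_
    rcases lt_trichotomy (u a) 0 with h | h | h <;> simp [h]
  rw [hΦ.tubeLaplace_eq hW hK hγ hvertex, ← Real.exp_sum]
  refine (hΦ.norm_tubeLaplace_le hW hvertex u).trans_eq ?_
  congr 2
  refine Finset.sum_congr rfl fun a _ => ?_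
  have hl : l a (x₀ + ∑ b, (-(η * SignType.sign (u b))) • w b) = -(η * SignType.sign (u a)) := by
    simp [map_sum, hx₀, hlw]
  rw [hl, ← self_mul_sign]
  ring

theorem IsTubeDominated.integrable_tubeLaplace (hΦ : IsTubeDominated Φ K W) (hW : Integrable W)
    (hK : Convex ℝ K) (hlw : ∀ a b, l a (w b) = if a = b then 1 else 0) (hγ : γ ∈ K)
    (hx₀ : ∀ a, l a x₀ = 0) (hη : 0 < η)
    (hbox : ∀ ε : Fin q → ℝ, (∀ a, |ε a| ≤ η) → x₀ + ∑ a, ε a • w a ∈ K) :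
    Integrable (tubeLaplace l Φ γ) :=
  ((Integrable.fintype_prod fun _ => integrable_exp_neg_mul_abs hη).mul_const _).mono'
    (hΦ.aestronglyMeasurable_tubeLaplace hγ)
    (.of_forall (hΦ.norm_tubeLaplace_le_prod hW hK hlw hγ hx₀ hη.le hbox))

theorem tubeLaplace_of_apply_eq_zero (hx₀ : ∀ a, l a x₀ = 0) (u : Fin q → ℝ) :
    tubeLaplace l Φ x₀ u
      = ∫ y, Complex.exp (Complex.I * ((∑ a, u a * l a y : ℝ) : ℂ)) * Φ (cpoint x₀ y) := by
  refine integral_congr_ae (.of_forall fun y => ?_)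
  simp only [complexify_cpoint, hx₀, Complex.ofReal_zero, zero_add, Complex.ofReal_sum,
    Complex.ofReal_mul, Finset.mul_sum, mul_left_comm Complex.I]

theorem IsTubeDominated.integral_tubeLaplace {hp : q + m = p} {v : Fin m → Fin p → ℝ}
    (hΦ : IsTubeDominated Φ K W) (hW : Integrable W) (hK : Convex ℝ K)
    (h : IsAdaptedFrame hp l w v) {B : (Fin m → ℝ) → ℝ} (hB : Integrable B)
    (hWB : ∀ z, W (frameMap w v z) ≤ B z.2) (hγ : γ ∈ K) (hx₀ : ∀ a, l a x₀ = 0) (hη : 0 < η)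
    (hbox : ∀ ε : Fin q → ℝ, (∀ a, |ε a| ≤ η) → x₀ + ∑ a, ε a • w a ∈ K) :
    ∫ u, tubeLaplace l Φ γ u = (2 * Real.pi) ^ q * (|(frameMatrix hp w v).det|
      * ∫ t : Fin m → ℝ, Φ (cpoint x₀ (∑ b, t b • v b))) := by
  have hx₀K : x₀ ∈ K := by simpa using hbox 0 (by simp [hη.le])
  have hint := hΦ.integrable_tubeLaplace hW hK h.apply_left hγ hx₀ hη hbox
  have heq : tubeLaplace l Φ γ = fun u =>
      ∫ y, Complex.exp (Complex.I * ((∑ a, u a * l a y : ℝ) : ℂ)) * Φ (cpoint x₀ y) :=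
    funext fun u => (hΦ.tubeLaplace_eq hW hK hγ hx₀K u).trans (tubeLaplace_of_apply_eq_zero hx₀ u)
  rw [heq] at hint ⊢
  rw [h.integral_integral_exp_mul (hΦ.continuous hx₀K) (hΦ.integrable hW hx₀K) hB
    (fun z => (hΦ.norm_le x₀ hx₀K _).trans (hWB z)) hint]
  simp only [frameMap_apply, Pi.zero_apply, zero_smul, Finset.sum_const_zero, zero_add]

end Box

theorem exp_sum_eq_prod (z : Fin q → ℂ) (u : Fin q → ℝ) :
    Complex.exp (∑ a, u a * z a) = ∏ a, Complex.exp (z a * u a) := by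
  simp only [Complex.exp_sum, mul_comm]

theorem integrableOn_exp_sum_pi_Iic {z : Fin q → ℂ} (hz : ∀ a, 0 < (z a).re) (c : Fin q → ℝ) :
    IntegrableOn (fun u : Fin q → ℝ => Complex.exp (∑ a, u a * z a))
      (Set.univ.pi fun a => Set.Iic (c a)) := by
  simp only [exp_sum_eq_prod]
  rw [IntegrableOn, volume_pi, Measure.restrict_pi_pi]
  exact Integrable.fintype_prod fun a => integrableOn_exp_mul_complex_Iic (hz a) (c a)

theorem setIntegral_exp_sum_pi_Iic {z : Fin q → ℂ} (hz : ∀ a, 0 < (z a).re) (c : Fin q → ℝ) :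
    ∫ u in Set.univ.pi fun a => Set.Iic (c a), Complex.exp (∑ a, u a * z a)
      = Complex.exp (∑ a, c a * z a) * ∏ a, (z a)⁻¹ := by
  simp only [exp_sum_eq_prod]
  rw [volume_pi, Measure.restrict_pi_pi,
    integral_fintype_prod_eq_prod (fun a (t : ℝ) => Complex.exp (z a * t)),
    ← Finset.prod_mul_distrib]
  exact Finset.prod_congr rfl fun a _ => integral_exp_mul_complex_Iic (hz a) (c a)

/-- The integrand `e^{T ⟨c, λ⟩} Φ ∏ λ_a⁻¹` of a Barnes integral with simple poles along the zeros of
the extensions `λ_a` of the linear forms `l_a`. -/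
def barnesKernel (l : Fin q → (Fin p → ℝ) →ₗ[ℝ] ℝ) (c : Fin q → ℝ) (Φ : (Fin p → ℂ) → ℂ) (T : ℝ)
    (s : Fin p → ℂ) : ℂ :=
  Complex.exp (T * ∑ a, c a * complexify (l a) s) * Φ s * ∏ a, (complexify (l a) s)⁻¹

variable {c : Fin q → ℝ} {γ : Fin p → ℝ}

theorem barnesKernel_eq_setIntegral (hγ : ∀ a, 0 < l a γ) (T : ℝ) (y : Fin p → ℝ) :
    barnesKernel l c Φ T (cpoint γ y) = ∫ u in Set.univ.pi fun a => Set.Iic (T * c a),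
      Complex.exp (∑ a, u a * complexify (l a) (cpoint γ y)) * Φ (cpoint γ y) := by
  rw [integral_mul_const, setIntegral_exp_sum_pi_Iic (fun a => by
    rw [re_complexify_cpoint]; exact hγ a), barnesKernel, Finset.mul_sum]
  simp only [Complex.ofReal_mul, mul_assoc, mul_comm (Φ _)]

theorem integrable_exp_mul_prod_pi_Iic (hΦ : IsTubeDominated Φ K W) (hW : Integrable W)
    (hγK : γ ∈ K) (hγ : ∀ a, 0 < l a γ) (T : ℝ) :
    Integrable (Function.uncurry fun (y : Fin p → ℝ) (u : Fin q → ℝ) =>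
        Complex.exp (∑ a, u a * complexify (l a) (cpoint γ y)) * Φ (cpoint γ y))
      (volume.prod (volume.restrict (Set.univ.pi fun a => Set.Iic (T * c a)))) := by
  have hexp := integrableOn_exp_sum_pi_Iic (z := fun a => (l a γ : ℂ)) (by simpa using hγ)
    fun a => T * c a
  refine ((hΦ.integrable hW hγK).norm.mul_prod hexp.norm).mono'
    ((hΦ.continuous_exp_mul hγK).comp continuous_swap).aestronglyMeasurable
    (.of_forall fun z => le_of_eq ?_)
  rw [Function.uncurry, norm_mul, norm_exp_sum_complexify, mul_comm, Complex.norm_exp]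
  simp only [Complex.re_sum, Complex.re_ofReal_mul, Complex.ofReal_re]

theorem integrable_barnesKernel (hΦ : IsTubeDominated Φ K W) (hW : Integrable W) (hγK : γ ∈ K)
    (hγ : ∀ a, 0 < l a γ) (T : ℝ) : Integrable fun y => barnesKernel l c Φ T (cpoint γ y) := by
  simp only [barnesKernel_eq_setIntegral hγ]
  exact (integrable_exp_mul_prod_pi_Iic hΦ hW hγK hγ T).integral_prod_left

theorem integral_barnesKernel (hΦ : IsTubeDominated Φ K W) (hW : Integrable W) (hγK : γ ∈ K)
    (hγ : ∀ a, 0 < l a γ) (T : ℝ) :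
    ∫ y, barnesKernel l c Φ T (cpoint γ y)
      = ∫ u in Set.univ.pi fun a => Set.Iic (T * c a), tubeLaplace l Φ γ u := by
  simp only [barnesKernel_eq_setIntegral hγ]
  exact integral_integral_swap (integrable_exp_mul_prod_pi_Iic hΦ hW hγK hγ T)

theorem aecover_pi_Iic_mul (hc : ∀ a, 0 < c a) :
    AECover volume atTop fun T : ℝ => Set.univ.pi fun a => Set.Iic (T * c a) where
  ae_eventually_mem := .of_forall fun u => by
    simp only [Set.mem_univ_pi, Set.mem_Iic]
    refine eventually_all.2 fun a => ?_
    filter_upwards [eventually_ge_atTop (u a / c a)] with T hT using (div_le_iff₀ (hc a)).1 hT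
  measurableSet _ := MeasurableSet.univ_pi fun _ => measurableSet_Iic

theorem exists_forall_abs_le_add_sum_smul_mem {x₀ : Fin p → ℝ} (hx₀ : K ∈ 𝓝 x₀)
    (w : Fin q → Fin p → ℝ) :
    ∃ η : ℝ, 0 < η ∧ ∀ ε : Fin q → ℝ, (∀ a, |ε a| ≤ η) → x₀ + ∑ a, ε a • w a ∈ K := by
  have hcont : Continuous fun ε : Fin q → ℝ => x₀ + ∑ a, ε a • w a := by fun_prop
  obtain ⟨η, hη, hball⟩ := Metric.nhds_basis_closedBall.mem_iff.1
    ((hcont.tendsto' 0 x₀ (by simp)).eventually hx₀)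
  refine ⟨η, hη, fun ε hε => hball (mem_closedBall_zero_iff.2 ?_)⟩
  exact (pi_norm_le_iff_of_nonneg hη.le).2 hε

theorem tendsto_integral_barnesKernel {hp : q + m = p} {w : Fin q → Fin p → ℝ}
    {v : Fin m → Fin p → ℝ} (hΦ : IsTubeDominated Φ K W) (hW : Integrable W) (hK : Convex ℝ K)
    (h : IsAdaptedFrame hp l w v) {B : (Fin m → ℝ) → ℝ} (hB : Integrable B)
    (hWB : ∀ z, W (frameMap w v z) ≤ B z.2) (hc : ∀ a, 0 < c a) (hγK : γ ∈ K)
    (hγ : ∀ a, 0 < l a γ) {x₀ : Fin p → ℝ} (hx₀ : ∀ a, l a x₀ = 0) (hx₀K : K ∈ 𝓝 x₀) :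
    Tendsto (fun T : ℝ => ∫ y, barnesKernel l c Φ T (cpoint γ y)) atTop
      (𝓝 ((2 * Real.pi) ^ q * (|(frameMatrix hp w v).det|
        * ∫ t : Fin m → ℝ, Φ (cpoint x₀ (∑ b, t b • v b))))) := by
  obtain ⟨η, hη, hbox⟩ := exists_forall_abs_le_add_sum_smul_mem hx₀K w
  rw [← hΦ.integral_tubeLaplace hW hK h hB hWB hγK hx₀ hη hbox,
    funext (integral_barnesKernel hΦ hW hγK hγ)]
  exact (aecover_pi_Iic_mul hc).integral_tendsto_of_countably_generated
    (hΦ.integrable_tubeLaplace hW hK h.apply_left hγK hx₀ hη hbox)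

theorem IsTubeDominated.integrable_slice {w : Fin q → Fin p → ℝ} {v : Fin m → Fin p → ℝ}
    (hΦ : IsTubeDominated Φ K W) {B : (Fin m → ℝ) → ℝ} (hB : Integrable B)
    (hWB : ∀ z, W (frameMap w v z) ≤ B z.2) {x₀ : Fin p → ℝ} (hx₀ : x₀ ∈ K) :
    Integrable fun t : Fin m → ℝ => Φ (cpoint x₀ (∑ b, t b • v b)) := by
  simpa [frameMap_apply] using BochnerMartinelli.integrable_slice (hΦ.continuous hx₀) hB
    (fun z => (hΦ.norm_le _ hx₀ _).trans (hWB z)) (0 : Fin q → ℝ)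

end Barnes

/-! ### Analyticity of the Mellin transform in its domain of convergence -/

section ExponentialIntegral

variable {X E : Type*} [NormedAddCommGroup E] [NormedSpace ℂ E] {f : X → ℂ} {L : X → E →L[ℂ] ℂ}
  {r : ℝ}

/-- The term `h ↦ f x * (L x h) ^ k / k!` of the expansion of `f x * exp (L x h)` in powers of `h`,
as a multilinear form. -/
def expTerm (f : X → ℂ) (L : X → E →L[ℂ] ℂ) (k : ℕ) (x : X) :
    ContinuousMultilinearMap ℂ (fun _ : Fin k => E) ℂ :=
  (f x / (k.factorial : ℂ)) •
    (ContinuousMultilinearMap.mkPiAlgebraFin ℂ k ℂ).compContinuousLinearMap fun _ => L x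

theorem expTerm_apply_const (k : ℕ) (x : X) (h : E) :
    expTerm f L k x (fun _ => h) = f x * (L x h ^ k / k.factorial) := by
  simp only [expTerm, smul_apply,
    ContinuousMultilinearMap.compContinuousLinearMap_apply,
    ContinuousMultilinearMap.mkPiAlgebraFin_apply, List.ofFn_const, List.prod_replicate,
    smul_eq_mul]
  ring

theorem norm_expTerm_mul_pow_le (hr : 0 ≤ r) (k : ℕ) (x : X) :
    ‖expTerm f L k x‖ * r ^ k ≤ ‖f x‖ * Real.exp (r * ‖L x‖) := by
  have hL : ‖(ContinuousMultilinearMap.mkPiAlgebraFin ℂ k ℂ).compContinuousLinearMap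
      (fun _ => L x)‖ ≤ ‖L x‖ ^ k :=
    (ContinuousMultilinearMap.norm_compContinuousLinearMap_le _ _).trans (by simp)
  rw [expTerm, norm_smul, norm_div, Complex.norm_natCast]
  calc ‖f x‖ / k.factorial * _ * r ^ k ≤ ‖f x‖ / k.factorial * ‖L x‖ ^ k * r ^ k := by gcongr
    _ = ‖f x‖ * ((r * ‖L x‖) ^ k / k.factorial) := by rw [mul_pow]; ring
    _ ≤ ‖f x‖ * Real.exp (r * ‖L x‖) := by
      gcongr
      exact Real.pow_div_factorial_le_exp _ (by positivity) k

variable [MeasurableSpace X] {ν : Measure X}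

theorem aestronglyMeasurable_expTerm (hf : AEStronglyMeasurable f ν)
    (hL : AEStronglyMeasurable L ν) (k : ℕ) : AEStronglyMeasurable (expTerm f L k) ν := by
  have hcont : Continuous fun l : E →L[ℂ] ℂ =>
      (ContinuousMultilinearMap.mkPiAlgebraFin ℂ k ℂ).compContinuousLinearMap
        (fun _ : Fin k => l) :=
    ((ContinuousLinearMap.apply ℂ _
      (ContinuousMultilinearMap.mkPiAlgebraFin ℂ k ℂ)).continuous.comp
        (ContinuousMultilinearMap.compContinuousLinearMapContinuousMultilinear ℂ
          (fun _ : Fin k => E) (fun _ : Fin k => ℂ) ℂ).cont).comp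
      (continuous_pi fun _ => continuous_id)
  exact (hf.mul aestronglyMeasurable_const).smul (hcont.comp_aestronglyMeasurable hL)

theorem integrable_expTerm (hf : AEStronglyMeasurable f ν) (hL : AEStronglyMeasurable L ν)
    (hr : 0 < r) (hint : Integrable (fun x => ‖f x‖ * Real.exp (r * ‖L x‖)) ν) (k : ℕ) :
    Integrable (expTerm f L k) ν := by
  refine (hint.const_mul (r ^ k)⁻¹).mono' (aestronglyMeasurable_expTerm hf hL k)
    (.of_forall fun x => ?_)
  rw [← div_eq_inv_mul, le_div_iff₀ (by positivity)]
  exact norm_expTerm_mul_pow_le hr.le k x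

theorem hasSum_integral_mul_pow_div_factorial (hf : AEStronglyMeasurable f ν)
    (hL : AEStronglyMeasurable L ν)
    (hint : Integrable (fun x => ‖f x‖ * Real.exp (r * ‖L x‖)) ν) {h : E} (hh : ‖h‖ ≤ r) :
    HasSum (fun k : ℕ => ∫ x, f x * (L x h ^ k / k.factorial) ∂ν)
      (∫ x, f x * Complex.exp (L x h) ∂ν) := by
  have hLh : ∀ x, ‖L x h‖ ≤ r * ‖L x‖ := fun x =>
    ((L x).le_opNorm h).trans (by rw [mul_comm]; gcongr)
  refine hasSum_integral_of_dominated_convergence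
    (fun k x => ‖f x‖ * ((r * ‖L x‖) ^ k / k.factorial)) (fun k => ?_)
    (fun k => .of_forall fun x => ?_)
    (.of_forall fun x => (Real.summable_pow_div_factorial _).mul_left _) ?_
    (.of_forall fun x => ?_)
  · exact hf.mul ((((ContinuousLinearMap.apply ℂ ℂ h).continuous.comp_aestronglyMeasurable
      hL).pow k).mul aestronglyMeasurable_const)
  · rw [norm_mul, norm_div, norm_pow, Complex.norm_natCast]
    gcongr
    exact hLh x
  · convert hint using 2 with x
    rw [tsum_mul_left, Real.exp_eq_exp_ℝ, NormedSpace.exp_eq_tsum_div]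
  · rw [Complex.exp_eq_exp_ℂ]
    exact (NormedSpace.expSeries_div_hasSum_exp (𝔸 := ℂ) (L x h)).mul_left _

theorem analyticAt_integral_exp (hf : AEStronglyMeasurable f ν)
    (hL : AEStronglyMeasurable L ν) (hr : 0 < r)
    (hint : Integrable (fun x => ‖f x‖ * Real.exp (r * ‖L x‖)) ν) :
    AnalyticAt ℂ (fun h => ∫ x, f x * Complex.exp (L x h) ∂ν) 0 := by
  have hterm := integrable_expTerm hf hL hr hint
  refine ⟨fun k => ∫ x, expTerm f L k x ∂ν, ENNReal.ofReal r, ?_, by simpa using hr, ?_⟩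
  · refine FormalMultilinearSeries.le_radius_of_bound _
      (C := ∫ x, ‖f x‖ * Real.exp (r * ‖L x‖) ∂ν) fun k => ?_
    rw [Real.coe_toNNReal _ hr.le]
    calc ‖∫ x, expTerm f L k x ∂ν‖ * r ^ k ≤ (∫ x, ‖expTerm f L k x‖ ∂ν) * r ^ k := by
          gcongr
          exact norm_integral_le_integral_norm _
      _ = ∫ x, ‖expTerm f L k x‖ * r ^ k ∂ν := (integral_mul_const _ _).symm
      _ ≤ _ := integral_mono ((hterm k).norm.mul_const _) hint
          fun x => norm_expTerm_mul_pow_le hr.le k x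
  · intro h hh
    have hh' : ‖h‖ < r := by simpa using hh
    simpa only [ContinuousMultilinearMap.integral_apply (hterm _), expTerm_apply_const, zero_add]
      using hasSum_integral_mul_pow_div_factorial hf hL hint hh'.le

end ExponentialIntegral

section PolyMellin

/-- The kernel `|ζ|^{2(μ-1)} ζ^{-b}`. -/
def monoKernel (b : ℤ) (μ ζ : ℂ) : ℂ := (‖ζ‖ : ℂ) ^ (2 * (μ - 1)) / ζ ^ b

theorem norm_monoKernel (b : ℤ) (μ : ℂ) {ζ : ℂ} (hζ : ζ ≠ 0) :
    ‖monoKernel b μ ζ‖ = ‖ζ‖ ^ (2 * μ.re - 2 - b) := by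
  have h : 0 < ‖ζ‖ := norm_pos_iff.2 hζ
  rw [monoKernel, norm_div, norm_zpow, Complex.norm_cpow_eq_rpow_re_of_pos h,
    Real.rpow_sub h, Real.rpow_intCast]
  congr 2
  simp
  ring

theorem measurable_monoKernel (b : ℤ) (μ : ℂ) : Measurable (monoKernel b μ) :=
  ((Complex.measurable_ofReal.comp measurable_norm).pow_const _).div (measurable_id.pow_const b)

theorem monoKernel_add (b : ℤ) (μ h : ℂ) {ζ : ℂ} (hζ : ζ ≠ 0) :
    monoKernel b (μ + h) ζ
      = monoKernel b μ ζ * Complex.exp (((2 * Real.log ‖ζ‖ : ℝ) : ℂ) * h) := by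
  have h0 : (‖ζ‖ : ℂ) ≠ 0 := by simpa using hζ
  rw [monoKernel, monoKernel, div_mul_eq_mul_div, Complex.cpow_def_of_ne_zero h0,
    Complex.cpow_def_of_ne_zero h0, ← Complex.exp_add, ← Complex.ofReal_log (norm_nonneg _)]
  congr 2
  push_cast
  ring

/-- The sum `|ζ|^e₁ + |ζ|^e₂`, cut off outside the disc of radius `R`. If `e₁, e₂ > -2`, it is an
integrable majorant on this disc of all `|ζ|^e` with `e₁ ≤ e ≤ e₂`. -/
def powEnvelope (R e₁ e₂ : ℝ) : ℂ → ℝ :=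
  (Metric.ball (0 : ℂ) R).indicator fun ζ => ‖ζ‖ ^ e₁ + ‖ζ‖ ^ e₂

theorem powEnvelope_nonneg (R e₁ e₂ : ℝ) (ζ : ℂ) : 0 ≤ powEnvelope R e₁ e₂ ζ :=
  Set.indicator_nonneg (fun _ _ => by positivity) _

theorem integrableOn_ball_norm_rpow (R : ℝ) {e : ℝ} (he : -2 < e) :
    IntegrableOn (fun ζ : ℂ => ‖ζ‖ ^ e) (Metric.ball 0 R) := by
  rw [integrableOn_fun_norm_addHaar volume (f := fun r : ℝ => r ^ e), Complex.finrank_real_complex]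
  rcases le_or_gt R 0 with hR | hR
  · simp [Set.Ioo_eq_empty (not_lt.2 hR)]
  refine ((intervalIntegral.integrableOn_Ioo_rpow_iff (s := e + 1) hR).2 (by linarith)).congr_fun
    (fun y hy => ?_) measurableSet_Ioo
  simp only [Nat.add_one_sub_one, pow_one, smul_eq_mul]
  rw [Real.rpow_add hy.1, Real.rpow_one, mul_comm]

theorem integrable_powEnvelope (R : ℝ) {e₁ e₂ : ℝ} (h₁ : -2 < e₁) (h₂ : -2 < e₂) :
    Integrable (powEnvelope R e₁ e₂) := by
  rw [powEnvelope, integrable_indicator_iff Metric.isOpen_ball.measurableSet]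
  exact (integrableOn_ball_norm_rpow R h₁).add (integrableOn_ball_norm_rpow R h₂)

theorem rpow_le_rpow_add_rpow {r e e₁ e₂ : ℝ} (hr : 0 < r) (h₁ : e₁ ≤ e) (h₂ : e ≤ e₂) :
    r ^ e ≤ r ^ e₁ + r ^ e₂ := by
  rcases le_total 1 r with h | h
  · exact (Real.rpow_le_rpow_of_exponent_le h h₂).trans
      (le_add_of_nonneg_left (Real.rpow_nonneg hr.le _))
  · exact (Real.rpow_le_rpow_of_exponent_ge hr h h₁).trans
      (le_add_of_nonneg_right (Real.rpow_nonneg hr.le _))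

theorem exp_mul_abs_log_le {r : ℝ} (hr : 0 < r) (t : ℝ) :
    Real.exp (t * |Real.log r|) ≤ r ^ (-t) + r ^ t := by
  rw [Real.rpow_def_of_pos hr, Real.rpow_def_of_pos hr]
  rcases abs_cases (Real.log r) with ⟨h, _⟩ | ⟨h, _⟩ <;> rw [h]
  · rw [mul_comm]
    exact le_add_of_nonneg_left (Real.exp_nonneg _)
  · rw [mul_neg, ← neg_mul, mul_comm]
    exact le_add_of_nonneg_right (Real.exp_nonneg _)

variable {n : ℕ} {φ : (Fin n → ℂ) → ℂ} {b : Fin n → ℤ} {μ : Fin n → ℂ}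

/-- The kernel `∏ |ζ_k|^{2(μ_k-1)} ζ_k^{-b_k}`. -/
def polyKernel (b : Fin n → ℤ) (μ ζ : Fin n → ℂ) : ℂ := ∏ k, monoKernel (b k) (μ k) (ζ k)

/-- The integral of `φ(ζ) ∏ |ζ_k|^{2(μ_k-1)} ζ_k^{-b_k}` over `ℂⁿ`. -/
def polyMellin (φ : (Fin n → ℂ) → ℂ) (b : Fin n → ℤ) (μ : Fin n → ℂ) : ℂ :=
  ∫ ζ : Fin n → ℂ, φ ζ * polyKernel b μ ζ

/-- The set of the exponents `μ` for which `polyKernel b μ` is locally integrable. -/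
def mellinDomain (b : Fin n → ℤ) : Set (Fin n → ℂ) := {μ | ∀ k, b k < 2 * (μ k).re}

theorem mellinDomain_eq_pi (b : Fin n → ℤ) :
    mellinDomain b = Set.univ.pi fun k => {z : ℂ | (b k : ℝ) / 2 < z.re} := by
  ext μ
  simp only [mellinDomain, Set.mem_ofPred_eq, Set.mem_univ_pi]
  exact forall_congr' fun k => (div_lt_iff₀' two_pos).symm

theorem isOpen_mellinDomain (b : Fin n → ℤ) : IsOpen (mellinDomain b) := by
  rw [mellinDomain_eq_pi]
  exact isOpen_set_pi Set.finite_univ fun k _ => isOpen_lt continuous_const Complex.continuous_re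

theorem convex_mellinDomain (b : Fin n → ℤ) : Convex ℝ (mellinDomain b) := by
  rw [mellinDomain_eq_pi]
  exact convex_pi fun k _ => convex_halfSpace_re_gt _

theorem norm_polyKernel (b : Fin n → ℤ) (μ : Fin n → ℂ) {ζ : Fin n → ℂ} (hζ : ∀ k, ζ k ≠ 0) :
    ‖polyKernel b μ ζ‖ = ∏ k, ‖ζ k‖ ^ (2 * (μ k).re - 2 - b k) := by
  rw [polyKernel, norm_prod]
  exact Finset.prod_congr rfl fun k _ => norm_monoKernel _ _ (hζ k)

theorem measurable_polyKernel (b : Fin n → ℤ) (μ : Fin n → ℂ) : Measurable (polyKernel b μ) :=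
  Finset.measurable_prod _ fun k _ =>
    (measurable_monoKernel (b k) (μ k)).comp (measurable_pi_apply k)

theorem exists_norm_le_support_subset (hφ : Continuous φ) (hs : HasCompactSupport φ) :
    ∃ C R : ℝ, 0 ≤ C ∧ ∀ ζ, ‖φ ζ‖ ≤ C ∧ (φ ζ ≠ 0 → ∀ k, ‖ζ k‖ < R) := by
  obtain ⟨C, hC⟩ := hs.exists_bound_of_continuous hφ
  obtain ⟨R, hR⟩ := hs.isBounded.exists_norm_le
  refine ⟨C, R + 1, (norm_nonneg _).trans (hC 0), fun ζ => ⟨hC ζ, fun h k => ?_⟩⟩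
  exact ((norm_le_pi_norm ζ k).trans (hR ζ (subset_tsupport _ h))).trans_lt (by linarith)

theorem ae_forall_ne_zero : ∀ᵐ ζ : Fin n → ℂ, ∀ k, ζ k ≠ 0 :=
  ae_all_iff.2 fun k => Measure.ae_eval_ne _ k 0

theorem norm_mul_prod_le_prod_powEnvelope {C R : ℝ} {ζ : Fin n → ℂ}
    (hφ : ‖φ ζ‖ ≤ C ∧ (φ ζ ≠ 0 → ∀ k, ‖ζ k‖ < R)) {e₁ e₂ : Fin n → ℝ} {a : Fin n → ℝ}
    (h0 : ∀ k, 0 ≤ a k) (ha : ∀ k, a k ≤ ‖ζ k‖ ^ e₁ k + ‖ζ k‖ ^ e₂ k) :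
    ‖φ ζ‖ * ∏ k, a k ≤ C * ∏ k, powEnvelope R (e₁ k) (e₂ k) (ζ k) := by
  by_cases hζ : φ ζ = 0
  · rw [hζ, norm_zero, zero_mul]
    exact mul_nonneg ((norm_nonneg _).trans hφ.1)
      (Finset.prod_nonneg fun k _ => powEnvelope_nonneg _ _ _ _)
  · refine mul_le_mul hφ.1 (Finset.prod_le_prod (fun k _ => h0 k) fun k _ => ?_)
      (Finset.prod_nonneg fun k _ => h0 k) ((norm_nonneg _).trans hφ.1)
    rw [powEnvelope, Set.indicator_of_mem (by simpa using hφ.2 hζ k)]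
    exact ha k

theorem integrable_prod_powEnvelope (R : ℝ) {e₁ e₂ : Fin n → ℝ} (h₁ : ∀ k, -2 < e₁ k)
    (h₂ : ∀ k, -2 < e₂ k) :
    Integrable fun ζ : Fin n → ℂ => ∏ k, powEnvelope R (e₁ k) (e₂ k) (ζ k) :=
  Integrable.fintype_prod (f := fun k => powEnvelope R (e₁ k) (e₂ k))
    fun k => integrable_powEnvelope R (h₁ k) (h₂ k)

theorem aestronglyMeasurable_mul_polyKernel (hφ : Continuous φ) (b : Fin n → ℤ)
    (μ : Fin n → ℂ) : AEStronglyMeasurable (fun ζ => φ ζ * polyKernel b μ ζ) volume :=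
  hφ.aestronglyMeasurable.mul (measurable_polyKernel b μ).aestronglyMeasurable

theorem integrable_mul_polyKernel (hφ : Continuous φ) (hs : HasCompactSupport φ)
    (hμ : μ ∈ mellinDomain b) : Integrable fun ζ => φ ζ * polyKernel b μ ζ := by
  obtain ⟨C, R, -, hCR⟩ := exists_norm_le_support_subset hφ hs
  have he : ∀ k, -2 < 2 * (μ k).re - 2 - b k := fun k => by linarith [hμ k]
  refine ((integrable_prod_powEnvelope R he he).const_mul C).mono'
    (aestronglyMeasurable_mul_polyKernel hφ b μ) ?_
  filter_upwards [ae_forall_ne_zero] with ζ hζ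
  rw [norm_mul, norm_polyKernel b μ hζ]
  exact norm_mul_prod_le_prod_powEnvelope (hCR ζ) (fun k => by positivity)
    fun k => le_add_of_nonneg_left (by positivity)

theorem exists_norm_polyMellin_le (hφ : Continuous φ) (hs : HasCompactSupport φ)
    {x₁ x₂ : Fin n → ℝ} (h₁ : ∀ k, b k < 2 * x₁ k) (h₂ : ∀ k, b k < 2 * x₂ k) :
    ∃ B : ℝ, 0 ≤ B ∧ ∀ μ : Fin n → ℂ, (∀ k, x₁ k ≤ (μ k).re ∧ (μ k).re ≤ x₂ k) →
      ‖polyMellin φ b μ‖ ≤ B := by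
  obtain ⟨C, R, hC, hCR⟩ := exists_norm_le_support_subset hφ hs
  have he₁ : ∀ k, -2 < 2 * x₁ k - 2 - b k := fun k => by linarith [h₁ k]
  have he₂ : ∀ k, -2 < 2 * x₂ k - 2 - b k := fun k => by linarith [h₂ k]
  refine ⟨∫ ζ : Fin n → ℂ, C * ∏ k, powEnvelope R (2 * x₁ k - 2 - b k) (2 * x₂ k - 2 - b k) (ζ k),
    integral_nonneg fun ζ => mul_nonneg hC
      (Finset.prod_nonneg fun k _ => powEnvelope_nonneg _ _ _ _), fun μ hμ => ?_⟩
  refine norm_integral_le_of_norm_le ((integrable_prod_powEnvelope R he₁ he₂).const_mul C) ?_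
  filter_upwards [ae_forall_ne_zero] with ζ hζ
  rw [norm_mul, norm_polyKernel b μ hζ]
  exact norm_mul_prod_le_prod_powEnvelope (hCR ζ) (fun k => by positivity) fun k =>
    rpow_le_rpow_add_rpow (norm_pos_iff.2 (hζ k)) (by linarith [(hμ k).1])
      (by linarith [(hμ k).2])

/-- The linear form `h ↦ ∑ h_k log |ζ_k|²`, which governs the dependence of the integrand of
`polyMellin` on `μ`: changing `μ` to `μ + h` multiplies it by `exp (logForm ζ h)`. -/
def logForm (ζ : Fin n → ℂ) : (Fin n → ℂ) →L[ℂ] ℂ :=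
  ∑ k, ((2 * Real.log ‖ζ k‖ : ℝ) : ℂ) • ContinuousLinearMap.proj k

theorem logForm_apply (ζ h : Fin n → ℂ) :
    logForm ζ h = ∑ k, ((2 * Real.log ‖ζ k‖ : ℝ) : ℂ) * h k := by
  simp [logForm]

theorem aestronglyMeasurable_logForm : AEStronglyMeasurable (logForm (n := n)) volume :=
  Finset.aestronglyMeasurable_fun_sum _ fun k _ =>
    (Complex.measurable_ofReal.comp ((Real.measurable_log.comp
      (measurable_norm.comp (measurable_pi_apply k))).const_mul
        2)).aestronglyMeasurable.smul_const _

theorem norm_logForm_le (ζ : Fin n → ℂ) : ‖logForm ζ‖ ≤ ∑ k, 2 * |Real.log ‖ζ k‖| := by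
  refine (norm_sum_le _ _).trans (Finset.sum_le_sum fun k _ => ?_)
  rw [norm_smul, Complex.norm_real, Real.norm_eq_abs, abs_mul, abs_two]
  refine mul_le_of_le_one_right (by positivity)
    (ContinuousLinearMap.opNorm_le_bound _ zero_le_one fun x => ?_)
  rw [one_mul]
  exact norm_le_pi_norm x k

theorem exp_mul_norm_logForm_le {r : ℝ} (hr : 0 ≤ r) (ζ : Fin n → ℂ) :
    Real.exp (r / 2 * ‖logForm ζ‖) ≤ ∏ k, Real.exp (r * |Real.log ‖ζ k‖|) := by
  rw [← Real.exp_sum, Real.exp_le_exp]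
  calc r / 2 * ‖logForm ζ‖ ≤ r / 2 * ∑ k, 2 * |Real.log ‖ζ k‖| := by
        gcongr
        exact norm_logForm_le ζ
    _ = ∑ k, r * |Real.log ‖ζ k‖| := by
        rw [Finset.mul_sum]
        exact Finset.sum_congr rfl fun k _ => by ring

theorem polyKernel_add (b : Fin n → ℤ) (μ h : Fin n → ℂ) {ζ : Fin n → ℂ} (hζ : ∀ k, ζ k ≠ 0) :
    polyKernel b (μ + h) ζ = polyKernel b μ ζ * Complex.exp (logForm ζ h) := by
  simp only [polyKernel, Pi.add_apply, monoKernel_add _ _ _ (hζ _), Finset.prod_mul_distrib,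
    ← Complex.exp_sum, logForm_apply]

theorem polyMellin_add (φ : (Fin n → ℂ) → ℂ) (b : Fin n → ℤ) (μ h : Fin n → ℂ) :
    polyMellin φ b (μ + h) = ∫ ζ, φ ζ * polyKernel b μ ζ * Complex.exp (logForm ζ h) := by
  refine integral_congr_ae ?_
  filter_upwards [ae_forall_ne_zero] with ζ hζ
  rw [polyKernel_add _ _ _ hζ, mul_assoc]

theorem integrable_norm_mul_polyKernel_mul_exp (hφ : Continuous φ) (hs : HasCompactSupport φ)
    {r : ℝ} (hr : 0 ≤ r) (hμ : ∀ k, b k + r < 2 * (μ k).re) :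
    Integrable fun ζ => ‖φ ζ * polyKernel b μ ζ‖ * Real.exp (r / 2 * ‖logForm ζ‖) := by
  obtain ⟨C, R, -, hCR⟩ := exists_norm_le_support_subset hφ hs
  refine ((integrable_prod_powEnvelope R (e₁ := fun k => 2 * (μ k).re - 2 - b k - r)
    (e₂ := fun k => 2 * (μ k).re - 2 - b k + r) (fun k => by linarith [hμ k])
    (fun k => by linarith [hμ k])).const_mul C).mono'
    ((aestronglyMeasurable_mul_polyKernel hφ b μ).norm.mul
      (Real.continuous_exp.comp_aestronglyMeasurable
        (aestronglyMeasurable_logForm.norm.const_mul _))) ?_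
  filter_upwards [ae_forall_ne_zero] with ζ hζ
  rw [Real.norm_of_nonneg (by positivity), norm_mul, norm_polyKernel b μ hζ, mul_assoc]
  calc ‖φ ζ‖ * ((∏ k, ‖ζ k‖ ^ (2 * (μ k).re - 2 - b k)) * Real.exp (r / 2 * ‖logForm ζ‖))
      ≤ ‖φ ζ‖ * ((∏ k, ‖ζ k‖ ^ (2 * (μ k).re - 2 - b k))
          * ∏ k, Real.exp (r * |Real.log ‖ζ k‖|)) := by
        gcongr
        exact exp_mul_norm_logForm_le hr ζ
    _ = ‖φ ζ‖ * ∏ k, ‖ζ k‖ ^ (2 * (μ k).re - 2 - b k) * Real.exp (r * |Real.log ‖ζ k‖|) := by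
        rw [Finset.prod_mul_distrib]
    _ ≤ _ := norm_mul_prod_le_prod_powEnvelope (hCR ζ) (fun k => by positivity) fun k => by
        have hk := norm_pos_iff.2 (hζ k)
        rw [sub_eq_add_neg _ r, Real.rpow_add hk, Real.rpow_add hk _ r, ← mul_add]
        gcongr
        exact exp_mul_abs_log_le hk r

theorem analyticAt_polyMellin (hφ : Continuous φ) (hs : HasCompactSupport φ)
    (hμ : μ ∈ mellinDomain b) : AnalyticAt ℂ (polyMellin φ b) μ := by
  obtain ⟨r, hr, hrμ⟩ := Pi.exists_forall_pos_add_lt hμ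
  have hexp := analyticAt_integral_exp (aestronglyMeasurable_mul_polyKernel hφ b μ)
    aestronglyMeasurable_logForm (half_pos hr)
    (integrable_norm_mul_polyKernel_mul_exp hφ hs hr.le hrμ)
  have htranslate : polyMellin φ b = (fun h => ∫ ζ, φ ζ * polyKernel b μ ζ
      * Complex.exp (logForm ζ h)) ∘ fun z => z - μ := by
    ext z
    rw [Function.comp_apply, ← polyMellin_add, add_sub_cancel]
  rw [htranslate]
  exact AnalyticAt.comp_of_eq hexp (by fun_prop) (sub_self μ)

end PolyMellin

/-! ### Integration by parts in the conjugate variables -/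

section MonoKernelDeriv

theorem normSq_cpow (z : ℂ) {μ : ℂ} (hμ : μ ≠ 0) :
    (z * starRingEnd ℂ z) ^ μ = (‖z‖ : ℂ) ^ (2 * μ) := by
  rcases eq_or_ne z 0 with rfl | hz
  · simp [Complex.zero_cpow, hμ]
  · have h0 : (‖z‖ : ℂ) ≠ 0 := by simpa using hz
    rw [Complex.mul_conj, Complex.normSq_eq_norm_sq, Complex.ofReal_pow, two_mul,
      Complex.cpow_add _ _ h0, pow_two, Complex.mul_cpow_ofReal_nonneg (norm_nonneg z)
        (norm_nonneg z)]

theorem monoKernel_eq_mul_conj_cpow (b : ℤ) {μ : ℂ} (hμ : μ ≠ 1) (z : ℂ) :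
    monoKernel b μ z = (z * starRingEnd ℂ z) ^ (μ - 1) * z ^ (-b) := by
  rw [monoKernel, normSq_cpow z (sub_ne_zero.2 hμ), zpow_neg, div_eq_mul_inv]

theorem hasDerivAt_line (ζ v : ℂ) : HasDerivAt (fun t : ℝ => ζ + t * v) v 0 := by
  simpa using ((hasDerivAt_id (0 : ℝ)).ofReal_comp.mul_const v).const_add ζ

theorem hasDerivAt_mul_conj_cpow_line {ζ : ℂ} (hζ : ζ ≠ 0) (v μ : ℂ) :
    HasDerivAt (fun t : ℝ => ((ζ + t * v) * starRingEnd ℂ (ζ + t * v)) ^ μ)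
      ((v * starRingEnd ℂ ζ + ζ * starRingEnd ℂ v) * (μ * (ζ * starRingEnd ℂ ζ) ^ (μ - 1))) 0 := by
  have hnormSq : HasDerivAt (fun t : ℝ => (ζ + t * v) * starRingEnd ℂ (ζ + t * v))
      (v * starRingEnd ℂ ζ + ζ * starRingEnd ℂ v) 0 := by
    refine ((hasDerivAt_line ζ v).mul (hasDerivAt_line ζ v).star).congr_deriv ?_
    simp
  have hpow : HasDerivAt (fun z : ℂ => z ^ μ) (μ * (ζ * starRingEnd ℂ ζ) ^ (μ - 1))
      ((ζ + (0 : ℝ) * v) * starRingEnd ℂ (ζ + (0 : ℝ) * v)) := by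
    have hslit : ζ * starRingEnd ℂ ζ ∈ Complex.slitPlane := by
      rw [Complex.mul_conj]
      exact Complex.ofReal_mem_slitPlane.2 (Complex.normSq_pos.2 hζ)
    simpa using (hasDerivAt_id (ζ * starRingEnd ℂ ζ)).cpow_const hslit
  exact hpow.scomp (0 : ℝ) hnormSq

theorem hasDerivAt_zpow_line {ζ : ℂ} (hζ : ζ ≠ 0) (v : ℂ) (m : ℤ) :
    HasDerivAt (fun t : ℝ => (ζ + t * v) ^ m) (v * (m * ζ ^ (m - 1))) 0 := by
  have hpow : HasDerivAt (fun z : ℂ => z ^ m) (m * ζ ^ (m - 1)) (ζ + (0 : ℝ) * v) := by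
    simpa using hasDerivAt_zpow m ζ (Or.inl hζ)
  exact hpow.scomp (0 : ℝ) (hasDerivAt_line ζ v)

theorem hasDerivAt_monoKernel_line_of_ne (b : ℤ) {μ ζ : ℂ} (v : ℂ) (hμ : μ ≠ 0) (hμ1 : μ ≠ 1)
    (hζ : ζ ≠ 0) :
    HasDerivAt (fun t : ℝ => monoKernel (b + 1) (μ + 1) (ζ + t * v))
      ((μ - b - 1) * v * monoKernel (b + 2) (μ + 1) ζ
        + μ * starRingEnd ℂ v * monoKernel b μ ζ) 0 := by
  have hμ2 : μ + 1 ≠ 1 := by simpa using hμ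
  have hN : ζ * starRingEnd ℂ ζ ≠ 0 := mul_ne_zero hζ (by simpa using hζ)
  simp only [monoKernel_eq_mul_conj_cpow _ hμ1, monoKernel_eq_mul_conj_cpow _ hμ2,
    add_sub_cancel_right]
  refine ((hasDerivAt_mul_conj_cpow_line hζ v μ).mul
    (hasDerivAt_zpow_line hζ v (-(b + 1)))).congr_deriv ?_
  have hsplit : (ζ * starRingEnd ℂ ζ) ^ μ
      = ζ * starRingEnd ℂ ζ * (ζ * starRingEnd ℂ ζ) ^ (μ - 1) := by
    rw [Complex.cpow_sub _ _ hN, Complex.cpow_one, mul_div_cancel₀ _ hN]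
  have hpow : ∀ m : ℕ, ζ ^ (-b - (m : ℤ)) = ζ ^ (-b) / ζ ^ m := fun m => by
    rw [zpow_sub₀ hζ, zpow_natCast]
  have h1 : -(b + 1) = -b - ((1 : ℕ) : ℤ) := by push_cast; ring
  have h2 : -(b + 1) - 1 = -b - ((2 : ℕ) : ℤ) := by push_cast; ring
  have h3 : -(b + 2) = -b - ((2 : ℕ) : ℤ) := by push_cast; ring
  simp only [Complex.ofReal_zero, zero_mul, add_zero]
  rw [h2, h3, h1, hpow, hpow, hsplit]
  push_cast
  field_simp
  ring

theorem hasDerivAt_monoKernel_line_zero {b : ℤ} {μ : ℂ} (hμ : b + 2 ≤ 2 * μ.re) (hμ0 : μ ≠ 0)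
    (v : ℂ) : HasDerivAt (fun t : ℝ => monoKernel b (μ + 1) (t * v)) 0 0 := by
  have hzero : monoKernel b (μ + 1) 0 = 0 := by simp [monoKernel, Complex.zero_cpow, hμ0]
  have hsmall : ∀ᶠ t : ℝ in 𝓝 0, ‖(t : ℂ) * v‖ < 1 := by
    have hcont : Continuous fun t : ℝ => ‖(t : ℂ) * v‖ := by fun_prop
    exact hcont.continuousAt.eventually (gt_mem_nhds (by simp))
  have hO : (fun t : ℝ => monoKernel b (μ + 1) (t * v)) =O[𝓝 0] fun t : ℝ => ‖t - 0‖ ^ 2 := by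
    refine .of_bound (‖v‖ ^ 2) ?_
    filter_upwards [hsmall] with t ht
    have hnorm : ‖v‖ ^ 2 * ‖‖t - 0‖ ^ 2‖ = ‖(t : ℂ) * v‖ ^ (2 : ℝ) := by
      rw [sub_zero, norm_pow, norm_norm, norm_mul, Complex.norm_real, Real.rpow_ofNat]
      ring
    rw [hnorm]
    rcases eq_or_ne ((t : ℂ) * v) 0 with h | h
    · rw [h, hzero, norm_zero]
      positivity
    · rw [norm_monoKernel _ _ h, Complex.add_re, Complex.one_re]
      exact Real.rpow_le_rpow_of_exponent_ge (norm_pos_iff.2 h) ht.le (by linarith)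
  simpa using (hO.hasFDerivAt one_lt_two).hasDerivAt

theorem hasDerivAt_monoKernel_line {b : ℤ} {μ : ℂ} (hμ : b + 3 ≤ 2 * μ.re) (hμ1 : 1 < μ.re)
    (ζ v : ℂ) :
    HasDerivAt (fun t : ℝ => monoKernel (b + 1) (μ + 1) (ζ + t * v))
      ((μ - b - 1) * v * monoKernel (b + 2) (μ + 1) ζ
        + μ * starRingEnd ℂ v * monoKernel b μ ζ) 0 := by
  have h0 : μ ≠ 0 := by
    rintro rfl
    exact absurd hμ1 (by simp)
  have h1 : μ ≠ 1 := by
    rintro rfl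
    exact absurd hμ1 (by simp)
  rcases eq_or_ne ζ 0 with rfl | hζ
  · have hzero : monoKernel (b + 2) (μ + 1) 0 = 0 ∧ monoKernel b μ 0 = 0 := by
      simp [monoKernel, Complex.zero_cpow, h0, sub_ne_zero.2 h1]
    simpa only [zero_add, hzero.1, hzero.2, mul_zero, add_zero] using
      hasDerivAt_monoKernel_line_zero (b := b + 1) (by push_cast; linarith) h0 v
  · exact hasDerivAt_monoKernel_line_of_ne b v h0 h1 hζ

end MonoKernelDeriv

section Wirtinger

variable {n : ℕ} {φ : (Fin n → ℂ) → ℂ} {b : Fin n → ℤ} {μ : Fin n → ℂ}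

theorem analyticAt_eval (k : Fin n) (μ : Fin n → ℂ) :
    AnalyticAt ℂ (fun z : Fin n → ℂ => z k) μ :=
  (ContinuousLinearMap.proj (R := ℂ) (φ := fun _ : Fin n => ℂ) k).analyticAt μ

theorem contDiff_fderiv_apply_const (hφ : ContDiff ℝ ∞ φ) (v : Fin n → ℂ) :
    ContDiff ℝ ∞ fun ζ => fderiv ℝ φ ζ v :=
  (hφ.fderiv_right (m := ∞) (by simp)).clm_apply contDiff_const

/-- The Wirtinger derivative `∂/∂ζ̄_k`. -/
def dbar (k : Fin n) (φ : (Fin n → ℂ) → ℂ) (ζ : Fin n → ℂ) : ℂ :=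
  1 / 2 * (fderiv ℝ φ ζ (Pi.single k 1) + Complex.I * fderiv ℝ φ ζ (Pi.single k Complex.I))

theorem contDiff_dbar (hφ : ContDiff ℝ ∞ φ) (k : Fin n) : ContDiff ℝ ∞ (dbar k φ) :=
  contDiff_const.mul ((contDiff_fderiv_apply_const hφ _).add
    (contDiff_const.mul (contDiff_fderiv_apply_const hφ _)))

theorem hasCompactSupport_dbar (hs : HasCompactSupport φ) (k : Fin n) :
    HasCompactSupport (dbar k φ) :=
  HasCompactSupport.mul_left (f := fun _ => (1 / 2 : ℂ))
    ((hs.fderiv_apply (𝕜 := ℝ) _).add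
      (HasCompactSupport.mul_left (f := fun _ => Complex.I) (hs.fderiv_apply (𝕜 := ℝ) _)))

theorem polyKernel_eq_prod_erase_mul (k : Fin n) {b b' : Fin n → ℤ} {μ μ' : Fin n → ℂ}
    (hb : ∀ i, i ≠ k → b' i = b i) (hμ : ∀ i, i ≠ k → μ' i = μ i) (ζ : Fin n → ℂ) :
    polyKernel b' μ' ζ
      = (∏ i ∈ Finset.univ.erase k, monoKernel (b i) (μ i) (ζ i))
        * monoKernel (b' k) (μ' k) (ζ k) := by
  rw [polyKernel, ← Finset.prod_erase_mul _ _ (Finset.mem_univ k)]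
  congr 1
  refine Finset.prod_congr rfl fun i hi => ?_
  rw [hb i (Finset.ne_of_mem_erase hi), hμ i (Finset.ne_of_mem_erase hi)]

theorem polyKernel_add_single (b : Fin n → ℤ) (μ : Fin n → ℂ) (k : Fin n) (m : ℤ)
    (ζ : Fin n → ℂ) :
    polyKernel (b + Pi.single k m) (μ + Pi.single k 1) ζ
      = (∏ i ∈ Finset.univ.erase k, monoKernel (b i) (μ i) (ζ i))
        * monoKernel (b k + m) (μ k + 1) (ζ k) := by
  rw [polyKernel_eq_prod_erase_mul k (b := b) (μ := μ) (fun i hi => by simp [hi])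
    (fun i hi => by simp [hi]) ζ]
  simp only [Pi.add_apply, Pi.single_eq_same]

theorem hasLineDerivAt_polyKernel (k : Fin n) (hk : b k + 3 ≤ 2 * (μ k).re) (hk1 : 1 < (μ k).re)
    (c : ℂ) (ζ : Fin n → ℂ) :
    HasLineDerivAt ℝ (polyKernel (b + Pi.single k 1) (μ + Pi.single k 1))
      ((μ k - b k - 1) * c * polyKernel (b + Pi.single k 2) (μ + Pi.single k 1) ζ
        + μ k * starRingEnd ℂ c * polyKernel b μ ζ) ζ (Pi.single k c) := by
  have hconst : ∀ t : ℝ, ∏ i ∈ Finset.univ.erase k,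
      monoKernel (b i) (μ i) ((ζ + t • (Pi.single k c : Fin n → ℂ)) i)
        = ∏ i ∈ Finset.univ.erase k, monoKernel (b i) (μ i) (ζ i) := fun t =>
    Finset.prod_congr rfl fun i hi => by simp [Finset.ne_of_mem_erase hi]
  have hcoord : ∀ t : ℝ, (ζ + t • (Pi.single k c : Fin n → ℂ)) k = ζ k + t * c := by simp
  have hderiv := (hasDerivAt_monoKernel_line hk hk1 (ζ k) c).const_mul
    (∏ i ∈ Finset.univ.erase k, monoKernel (b i) (μ i) (ζ i))
  simp only [HasLineDerivAt, polyKernel_add_single, hconst, hcoord]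
  refine hderiv.congr_deriv ?_
  rw [polyKernel_eq_prod_erase_mul k (fun _ _ => rfl) (fun _ _ => rfl) ζ]
  ring

theorem add_single_mem_mellinDomain (hμ : μ ∈ mellinDomain b) (k : Fin n) {m : ℤ} (hm : m ≤ 2) :
    μ + Pi.single k 1 ∈ mellinDomain (b + Pi.single k m) := by
  intro i
  rcases eq_or_ne i k with rfl | hi
  · have : (m : ℝ) ≤ 2 := by exact_mod_cast hm
    simp only [Pi.add_apply, Pi.single_eq_same, Int.cast_add, Complex.add_re, Complex.one_re]
    linarith [hμ i]
  · simpa [hi] using hμ i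

theorem polyMellin_fderiv_single (hφ : ContDiff ℝ ∞ φ) (hs : HasCompactSupport φ)
    (hμ : μ ∈ mellinDomain b) (k : Fin n) (hk : b k + 3 ≤ 2 * (μ k).re) (hk1 : 1 < (μ k).re)
    (c : ℂ) :
    polyMellin (fun ζ => fderiv ℝ φ ζ (Pi.single k c)) (b + Pi.single k 1) (μ + Pi.single k 1)
      = -((μ k - b k - 1) * c * polyMellin φ (b + Pi.single k 2) (μ + Pi.single k 1)
        + μ k * starRingEnd ℂ c * polyMellin φ b μ) := by
  have hint₀ := integrable_mul_polyKernel hφ.continuous hs hμ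
  have hint₁ := integrable_mul_polyKernel hφ.continuous hs
    (add_single_mem_mellinDomain hμ k one_le_two)
  have hint₂ := integrable_mul_polyKernel hφ.continuous hs
    (add_single_mem_mellinDomain hμ k le_rfl)
  have hint₁' := integrable_mul_polyKernel
    (contDiff_fderiv_apply_const hφ (Pi.single k c)).continuous (hs.fderiv_apply (𝕜 := ℝ) _)
    (add_single_mem_mellinDomain hμ k one_le_two)
  have hsum := (hint₂.const_mul ((μ k - b k - 1) * c)).add
    (hint₀.const_mul (μ k * starRingEnd ℂ c))
  have hparts := integral_bilinear_hasLineDerivAt_right_eq_neg_left_of_integrable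
    (μ := (volume : Measure (Fin n → ℂ))) (B := ContinuousLinearMap.mul ℝ ℂ)
    (f := φ) (f' := fun ζ => fderiv ℝ φ ζ (Pi.single k c)) hint₁'
    (hsum.congr (.of_forall fun ζ => by
      simp only [Pi.add_apply, ContinuousLinearMap.mul_apply']
      ring)) hint₁
    (fun ζ _ => ((hφ.differentiable (by simp)).differentiableAt).hasFDerivAt.hasLineDerivAt _)
    (fun ζ _ => hasLineDerivAt_polyKernel k hk hk1 c ζ)
  simp only [ContinuousLinearMap.mul_apply'] at hparts
  rw [polyMellin, ← neg_eq_iff_eq_neg, ← hparts, polyMellin, polyMellin, ← integral_const_mul,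
    ← integral_const_mul, ← integral_add (hint₂.const_mul _) (hint₀.const_mul _)]
  refine integral_congr_ae (.of_forall fun ζ => ?_)
  ring

theorem polyMellin_dbar (hφ : ContDiff ℝ ∞ φ) (hs : HasCompactSupport φ)
    (hμ : μ ∈ mellinDomain b) (k : Fin n) :
    polyMellin (dbar k φ) b μ
      = 1 / 2 * (polyMellin (fun ζ => fderiv ℝ φ ζ (Pi.single k 1)) b μ
        + Complex.I * polyMellin (fun ζ => fderiv ℝ φ ζ (Pi.single k Complex.I)) b μ) := by
  have hint : ∀ v : Fin n → ℂ, Integrable fun ζ => fderiv ℝ φ ζ v * polyKernel b μ ζ := fun v =>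
    integrable_mul_polyKernel (contDiff_fderiv_apply_const hφ v).continuous
      (hs.fderiv_apply (𝕜 := ℝ) v) hμ
  simp only [polyMellin]
  rw [← integral_const_mul Complex.I, ← integral_add (hint _) ((hint _).const_mul _),
    ← integral_const_mul]
  refine integral_congr_ae (.of_forall fun ζ => ?_)
  simp only [dbar]
  ring

theorem mul_polyMellin_eq_of_le (hφ : ContDiff ℝ ∞ φ) (hs : HasCompactSupport φ)
    (hμ : μ ∈ mellinDomain b) (k : Fin n) (hk : b k + 3 ≤ 2 * (μ k).re) (hk1 : 1 < (μ k).re) :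
    μ k * polyMellin φ b μ
      = -polyMellin (dbar k φ) (b + Pi.single k 1) (μ + Pi.single k 1) := by
  have hone := polyMellin_fderiv_single hφ hs hμ k hk hk1 1
  have hI := polyMellin_fderiv_single hφ hs hμ k hk hk1 Complex.I
  rw [polyMellin_dbar hφ hs (add_single_mem_mellinDomain hμ k one_le_two), hone, hI, map_one,
    Complex.conj_I]
  linear_combination (1 / 2 : ℂ) * (μ k * polyMellin φ b μ
    - (μ k - b k - 1) * polyMellin φ (b + Pi.single k 2) (μ + Pi.single k 1)) * Complex.I_sq

-- Both sides are holomorphic on the convex set `mellinDomain b`, and far to the right the kernels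
-- are differentiable at the origin, so that partial integration needs no boundary term.
theorem mul_polyMellin_eq (hφ : ContDiff ℝ ∞ φ) (hs : HasCompactSupport φ)
    (hμ : μ ∈ mellinDomain b) (k : Fin n) :
    μ k * polyMellin φ b μ
      = -polyMellin (dbar k φ) (b + Pi.single k 1) (μ + Pi.single k 1) := by
  have hleft : AnalyticOnNhd ℂ (fun μ : Fin n → ℂ => μ k * polyMellin φ b μ) (mellinDomain b) :=
    fun z hz => (analyticAt_eval k z).mul (analyticAt_polyMellin hφ.continuous hs hz)
  have hright : AnalyticOnNhd ℂ (fun μ : Fin n → ℂ =>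
      -polyMellin (dbar k φ) (b + Pi.single k 1) (μ + Pi.single k 1)) (mellinDomain b) :=
    fun z hz => (AnalyticAt.comp (f := fun μ : Fin n → ℂ => μ + Pi.single k 1)
      (analyticAt_polyMellin (contDiff_dbar hφ k).continuous (hasCompactSupport_dbar hs k)
        (add_single_mem_mellinDomain hz k one_le_two)) (by fun_prop)).neg
  set z₀ : Fin n → ℂ := fun i => ((|(b i : ℝ)| + 2 : ℝ) : ℂ) with hz₀
  have hz₀b : z₀ ∈ mellinDomain b := fun i => by
    rw [hz₀, Complex.ofReal_re]
    linarith [le_abs_self (b i : ℝ), abs_nonneg (b i : ℝ)]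
  refine hleft.eqOn_of_preconnected_of_eventuallyEq hright
    (convex_mellinDomain b).isPreconnected hz₀b ?_ hμ
  have hre : Continuous fun z : Fin n → ℂ => (z k).re := by fun_prop
  filter_upwards [(isOpen_mellinDomain b).mem_nhds hz₀b,
    hre.continuousAt.eventually (lt_mem_nhds (show |(b k : ℝ)| + 3 / 2 < (z₀ k).re by
      rw [hz₀, Complex.ofReal_re]
      linarith))] with z hz hzk
  exact mul_polyMellin_eq_of_le hφ hs hz k
    (by linarith [le_abs_self (b k : ℝ), abs_nonneg (b k : ℝ)])
    (by linarith [abs_nonneg (b k : ℝ)])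

end Wirtinger

/-! ### Entire continuation of the Mellin transform divided by Gamma factors -/

section RegMellin

variable {n : ℕ} {φ : (Fin n → ℂ) → ℂ} {b : Fin n → ℤ} {μ : Fin n → ℂ}

/-- The integral `polyMellin φ b μ` divided by `∏ Γ(μ_k)`, which is holomorphic for all `μ` after
continuation. -/
def regMellin (φ : (Fin n → ℂ) → ℂ) (b : Fin n → ℤ) (μ : Fin n → ℂ) : ℂ :=
  polyMellin φ b μ * ∏ k, (Complex.Gamma (μ k))⁻¹

theorem inv_Gamma_eq_mul_inv_Gamma_add_one (z : ℂ) :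
    (Complex.Gamma z)⁻¹ = z * (Complex.Gamma (z + 1))⁻¹ := by
  simpa using Complex.one_div_Gamma_eq_self_mul_one_div_Gamma_add_one z

theorem prod_inv_Gamma_eq_mul_prod (μ : Fin n → ℂ) (k : Fin n) :
    ∏ i, (Complex.Gamma (μ i))⁻¹
      = μ k * ∏ i, (Complex.Gamma ((μ + Pi.single k 1 : Fin n → ℂ) i))⁻¹ := by
  have hμ := Finset.mul_prod_erase Finset.univ (fun i => (Complex.Gamma (μ i))⁻¹)
    (Finset.mem_univ k)
  have hshift := Finset.mul_prod_erase Finset.univ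
    (fun i => (Complex.Gamma ((μ + Pi.single k 1 : Fin n → ℂ) i))⁻¹) (Finset.mem_univ k)
  rw [← hμ, ← hshift, ← mul_assoc, inv_Gamma_eq_mul_inv_Gamma_add_one (μ k), Pi.add_apply,
    Pi.single_eq_same]
  congr 1
  exact Finset.prod_congr rfl fun i hi => by simp [Finset.ne_of_mem_erase hi]

theorem regMellin_eq_neg (hφ : ContDiff ℝ ∞ φ) (hs : HasCompactSupport φ)
    (hμ : μ ∈ mellinDomain b) (k : Fin n) :
    regMellin φ b μ = -regMellin (dbar k φ) (b + Pi.single k 1) (μ + Pi.single k 1) := by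
  rw [regMellin, prod_inv_Gamma_eq_mul_prod μ k, ← mul_assoc, mul_comm _ (μ k),
    mul_polyMellin_eq hφ hs hμ k, regMellin, neg_mul]

/-- The iterated Wirtinger derivative along a list of coordinates. -/
def dbarList (l : List (Fin n)) (φ : (Fin n → ℂ) → ℂ) : (Fin n → ℂ) → ℂ :=
  l.foldl (fun ψ k => dbar k ψ) φ

theorem contDiff_dbarList (hφ : ContDiff ℝ ∞ φ) (l : List (Fin n)) :
    ContDiff ℝ ∞ (dbarList l φ) := by
  induction l generalizing φ with
  | nil => exact hφ
  | cons k _ ih => exact ih (contDiff_dbar hφ k)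

theorem hasCompactSupport_dbarList (hs : HasCompactSupport φ) (l : List (Fin n)) :
    HasCompactSupport (dbarList l φ) := by
  induction l generalizing φ with
  | nil => exact hs
  | cons k _ ih => exact ih (hasCompactSupport_dbar hs k)

theorem regMellin_dbarList (hφ : ContDiff ℝ ∞ φ) (hs : HasCompactSupport φ)
    (hμ : μ ∈ mellinDomain b) (l : List (Fin n)) :
    regMellin φ b μ = (-1) ^ l.length * regMellin (dbarList l φ)
      (b + (l.map fun k => (Pi.single k 1 : Fin n → ℤ)).sum)
      (μ + (l.map fun k => (Pi.single k 1 : Fin n → ℂ)).sum) := by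
  induction l generalizing φ b μ with
  | nil => simp [dbarList]
  | cons k l ih =>
    rw [regMellin_eq_neg hφ hs hμ k, ih (contDiff_dbar hφ k) (hasCompactSupport_dbar hs k)
      (add_single_mem_mellinDomain hμ k one_le_two)]
    simp only [List.map_cons, List.sum_cons, List.length_cons, add_assoc, pow_succ, dbarList,
      List.foldl_cons]
    ring

/-- The derivative `∂ⁿ/∂ζ̄₁ ⋯ ∂ζ̄ₙ`. -/
def dbarAll (φ : (Fin n → ℂ) → ℂ) : (Fin n → ℂ) → ℂ := dbarList (List.finRange n) φ

theorem sum_map_finRange_single_one (R : Type*) [AddCommMonoidWithOne R] (n : ℕ) :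
    ((List.finRange n).map fun k => (Pi.single k 1 : Fin n → R)).sum = 1 := by
  rw [← Fin.sum_univ_def]
  exact Finset.univ_sum_single (1 : Fin n → R)

theorem regMellin_dbarAll (hφ : ContDiff ℝ ∞ φ) (hs : HasCompactSupport φ)
    (hμ : μ ∈ mellinDomain b) :
    regMellin φ b μ = (-1) ^ n * regMellin (dbarAll φ) (b + 1) (μ + 1) := by
  rw [regMellin_dbarList hφ hs hμ (List.finRange n), List.length_finRange,
    sum_map_finRange_single_one, sum_map_finRange_single_one, dbarAll]

theorem contDiff_dbarAll_iterate (hφ : ContDiff ℝ ∞ φ) (N : ℕ) :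
    ContDiff ℝ ∞ (dbarAll^[N] φ) := by
  induction N with
  | zero => exact hφ
  | succ N ih =>
    rw [Function.iterate_succ_apply']
    exact contDiff_dbarList ih _

theorem hasCompactSupport_dbarAll_iterate (hs : HasCompactSupport φ) (N : ℕ) :
    HasCompactSupport (dbarAll^[N] φ) := by
  induction N with
  | zero => exact hs
  | succ N ih =>
    rw [Function.iterate_succ_apply']
    exact hasCompactSupport_dbarList ih _

theorem add_natCast_mem_mellinDomain {N : ℕ} :
    μ + (N : Fin n → ℂ) ∈ mellinDomain (b + (N : Fin n → ℤ)) ↔ ∀ k, b k < 2 * (μ k).re + N := by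
  refine forall_congr' fun k => ?_
  simp only [Pi.add_apply, Pi.natCast_apply, Int.cast_add, Int.cast_natCast, Complex.add_re,
    Complex.natCast_re]
  constructor <;> intro h <;> linarith

/-- The expression for the continuation of `regMellin φ b` after `N` integrations by parts in
each variable. -/
def regMellinStep (φ : (Fin n → ℂ) → ℂ) (b : Fin n → ℤ) (N : ℕ) (μ : Fin n → ℂ) : ℂ :=
  (-1) ^ (n * N) * regMellin (dbarAll^[N] φ) (b + (N : Fin n → ℤ)) (μ + (N : Fin n → ℂ))

theorem regMellinStep_zero (φ : (Fin n → ℂ) → ℂ) (b : Fin n → ℤ) :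
    regMellinStep φ b 0 = regMellin φ b := by
  ext μ
  simp [regMellinStep]

theorem regMellinStep_succ (hφ : ContDiff ℝ ∞ φ) (hs : HasCompactSupport φ) {N : ℕ}
    (hμ : ∀ k, b k < 2 * (μ k).re + N) :
    regMellinStep φ b (N + 1) μ = regMellinStep φ b N μ := by
  rw [regMellinStep, regMellinStep, regMellin_dbarAll (contDiff_dbarAll_iterate hφ N)
    (hasCompactSupport_dbarAll_iterate hs N) (add_natCast_mem_mellinDomain.2 hμ),
    Function.iterate_succ_apply', ← mul_assoc, ← pow_add, mul_add_one, Nat.cast_add_one,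
    Nat.cast_add_one, add_assoc, add_assoc]

theorem regMellinStep_eq_of_le (hφ : ContDiff ℝ ∞ φ) (hs : HasCompactSupport φ) {N N' : ℕ}
    (hμ : ∀ k, b k < 2 * (μ k).re + N) (h : N ≤ N') :
    regMellinStep φ b N' μ = regMellinStep φ b N μ := by
  induction N', h using Nat.le_induction with
  | base => rfl
  | succ N' hN ih =>
    rw [regMellinStep_succ hφ hs fun k => (hμ k).trans_le (by gcongr), ih]

theorem regMellinStep_eq (hφ : ContDiff ℝ ∞ φ) (hs : HasCompactSupport φ) {N N' : ℕ}
    (hμ : ∀ k, b k < 2 * (μ k).re + N) (hμ' : ∀ k, b k < 2 * (μ k).re + N') :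
    regMellinStep φ b N μ = regMellinStep φ b N' μ := by
  rcases le_total N N' with h | h
  · exact (regMellinStep_eq_of_le hφ hs hμ h).symm
  · exact regMellinStep_eq_of_le hφ hs hμ' h

theorem analyticAt_inv_Gamma (z : ℂ) : AnalyticAt ℂ (fun s => (Complex.Gamma s)⁻¹) z :=
  Complex.differentiable_one_div_Gamma.analyticAt z

theorem analyticAt_regMellin (hφ : Continuous φ) (hs : HasCompactSupport φ)
    (hμ : μ ∈ mellinDomain b) : AnalyticAt ℂ (regMellin φ b) μ :=
  (analyticAt_polyMellin hφ hs hμ).mul (Finset.analyticAt_fun_prod _ fun k _ =>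
    (analyticAt_inv_Gamma (μ k)).comp (f := fun z : Fin n → ℂ => z k) (analyticAt_eval k μ))

theorem analyticAt_regMellinStep (hφ : ContDiff ℝ ∞ φ) (hs : HasCompactSupport φ) {N : ℕ}
    (hμ : ∀ k, b k < 2 * (μ k).re + N) : AnalyticAt ℂ (regMellinStep φ b N) μ :=
  analyticAt_const.mul (AnalyticAt.comp (f := fun z : Fin n → ℂ => z + (N : Fin n → ℂ))
    (analyticAt_regMellin (contDiff_dbarAll_iterate hφ N).continuous
      (hasCompactSupport_dbarAll_iterate hs N) (add_natCast_mem_mellinDomain.2 hμ))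
    (analyticAt_id.add analyticAt_const))

theorem exists_nat_forall_lt {ι : Type*} [Finite ι] (x : ι → ℝ) : ∃ N : ℕ, ∀ i, x i < N := by
  obtain ⟨M, hM⟩ := (Set.finite_range x).bddAbove
  obtain ⟨N, hN⟩ := exists_nat_gt M
  exact ⟨N, fun i => (hM ⟨i, rfl⟩).trans_lt hN⟩

theorem exists_nat_forall_lt_two_mul_re_add (b : Fin n → ℤ) (μ : Fin n → ℂ) :
    ∃ N : ℕ, ∀ k, (b k : ℝ) < 2 * (μ k).re + N := by
  obtain ⟨N, hN⟩ := exists_nat_forall_lt fun k => (b k : ℝ) - 2 * (μ k).re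
  exact ⟨N, fun k => by linarith [hN k]⟩

/-- The continuation of `regMellin φ b` to all exponents. The number of integrations by parts
depends on `μ`, but by `regMellinExt_eq` any sufficiently large number gives the same value. -/
def regMellinExt (φ : (Fin n → ℂ) → ℂ) (b : Fin n → ℤ) (μ : Fin n → ℂ) : ℂ :=
  regMellinStep φ b (exists_nat_forall_lt_two_mul_re_add b μ).choose μ

theorem regMellinExt_eq (hφ : ContDiff ℝ ∞ φ) (hs : HasCompactSupport φ) {N : ℕ}
    (hμ : ∀ k, b k < 2 * (μ k).re + N) : regMellinExt φ b μ = regMellinStep φ b N μ :=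
  regMellinStep_eq hφ hs (exists_nat_forall_lt_two_mul_re_add b μ).choose_spec hμ

theorem regMellinExt_eq_regMellin (hφ : ContDiff ℝ ∞ φ) (hs : HasCompactSupport φ)
    (hμ : μ ∈ mellinDomain b) : regMellinExt φ b μ = regMellin φ b μ := by
  rw [regMellinExt_eq hφ hs (N := 0) fun k => by simpa using hμ k, regMellinStep_zero]

theorem analyticAt_regMellinExt (hφ : ContDiff ℝ ∞ φ) (hs : HasCompactSupport φ)
    (b : Fin n → ℤ) (μ : Fin n → ℂ) : AnalyticAt ℂ (regMellinExt φ b) μ := by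
  obtain ⟨N, hN⟩ := exists_nat_forall_lt_two_mul_re_add b μ
  have hopen : IsOpen {z : Fin n → ℂ | z + (N : Fin n → ℂ) ∈ mellinDomain (b + (N : Fin n → ℤ))} :=
    (isOpen_mellinDomain _).preimage (continuous_id.add continuous_const)
  refine (analyticAt_regMellinStep hφ hs hN).congr ?_
  filter_upwards [hopen.mem_nhds (add_natCast_mem_mellinDomain.2 hN)] with z hz
  exact (regMellinExt_eq hφ hs (add_natCast_mem_mellinDomain.1 hz)).symm

theorem norm_Gamma_mul_inv_Gamma_add_le {c : ℝ} (hc : 0 < c) (N : ℕ) {z : ℂ} (hz : c ≤ z.re) :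
    ‖Complex.Gamma z * (Complex.Gamma (z + N))⁻¹‖ ≤ c⁻¹ ^ N := by
  induction N with
  | zero =>
    have : Complex.Gamma z ≠ 0 := Complex.Gamma_ne_zero_of_re_pos (hc.trans_le hz)
    simp [this]
  | succ N ih =>
    have hre : c ≤ (z + N).re := by
      rw [Complex.add_re, Complex.natCast_re]
      linarith [(Nat.cast_nonneg N : (0 : ℝ) ≤ N)]
    have hne : z + N ≠ 0 := by
      intro h
      rw [h, Complex.zero_re] at hre
      linarith
    have hstep : (Complex.Gamma (z + (N + 1 : ℕ)))⁻¹ = (z + N)⁻¹ * (Complex.Gamma (z + N))⁻¹ := by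
      rw [inv_Gamma_eq_mul_inv_Gamma_add_one (z + N), inv_mul_cancel_left₀ hne, Nat.cast_add_one,
        add_assoc]
    rw [hstep, mul_left_comm, norm_mul, pow_succ', norm_inv]
    gcongr
    exact hre.trans (Complex.re_le_norm _)

theorem norm_prod_Gamma_mul_regMellinExt (hφ : ContDiff ℝ ∞ φ) (hs : HasCompactSupport φ)
    {N : ℕ} (hμ : ∀ k, b k < 2 * (μ k).re + N) (d : Fin n → ℕ) :
    ‖(∏ k, Complex.Gamma (μ k + d k)) * regMellinExt φ b μ‖
      = ‖polyMellin (dbarAll^[N] φ) (b + (N : Fin n → ℤ)) (μ + (N : Fin n → ℂ))‖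
        * ∏ k, ‖Complex.Gamma (μ k + d k) * (Complex.Gamma (μ k + N))⁻¹‖ := by
  have hsplit : (∏ k, Complex.Gamma (μ k + d k)) * regMellinExt φ b μ
      = (-1) ^ (n * N) * (polyMellin (dbarAll^[N] φ) (b + (N : Fin n → ℤ)) (μ + (N : Fin n → ℂ))
        * ∏ k, (Complex.Gamma (μ k + d k) * (Complex.Gamma (μ k + N))⁻¹)) := by
    rw [regMellinExt_eq hφ hs hμ, regMellinStep, regMellin, Finset.prod_mul_distrib]
    simp only [Pi.add_apply, Pi.natCast_apply]
    ring
  rw [hsplit, norm_mul, norm_pow, norm_neg, norm_one, one_pow, one_mul, norm_mul, norm_prod]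

theorem exists_norm_prod_Gamma_mul_regMellinExt_le (hφ : ContDiff ℝ ∞ φ)
    (hs : HasCompactSupport φ) (b : Fin n → ℤ) (d : Fin n → ℕ) {x₁ x₂ : Fin n → ℝ}
    (hd : ∀ k, 0 < x₁ k + d k) :
    ∃ B : ℝ, 0 ≤ B ∧ ∀ μ : Fin n → ℂ, (∀ k, (μ k).re ∈ Set.Icc (x₁ k) (x₂ k)) →
      ‖(∏ k, Complex.Gamma (μ k + d k)) * regMellinExt φ b μ‖ ≤ B := by
  obtain ⟨N, hN⟩ := exists_nat_forall_lt fun k => max ((b k : ℝ) - 2 * x₁ k) (d k)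
  have hb : ∀ k, (b k : ℝ) < 2 * x₁ k + N := fun k => by
    linarith [(le_max_left _ _).trans_lt (hN k)]
  have hdN : ∀ k, d k ≤ N := fun k => by
    exact_mod_cast ((le_max_right _ _).trans_lt (hN k)).le
  obtain ⟨B, hB, hBμ⟩ := exists_norm_polyMellin_le (contDiff_dbarAll_iterate hφ N).continuous
    (hasCompactSupport_dbarAll_iterate hs N) (b := b + (N : Fin n → ℤ))
    (x₁ := fun k => x₁ k + N) (x₂ := fun k => max (x₁ k) (x₂ k) + N)
    (fun k => by
      rw [Pi.add_apply, Pi.natCast_apply, Int.cast_add, Int.cast_natCast]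
      linarith [hb k])
    (fun k => by
      rw [Pi.add_apply, Pi.natCast_apply, Int.cast_add, Int.cast_natCast]
      linarith [hb k, le_max_left (x₁ k) (x₂ k)])
  refine ⟨B * ∏ k, (x₁ k + d k)⁻¹ ^ (N - d k), mul_nonneg hB
    (Finset.prod_nonneg fun k _ => pow_nonneg (inv_nonneg.2 (hd k).le) _), fun μ hμ => ?_⟩
  rw [norm_prod_Gamma_mul_regMellinExt hφ hs fun k => by linarith [hb k, (hμ k).1]]
  refine mul_le_mul (hBμ _ fun k => ?_) (Finset.prod_le_prod
    (fun _ _ => norm_nonneg _) fun k _ => ?_) (Finset.prod_nonneg fun _ _ => norm_nonneg _) hB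
  · simpa using ⟨(hμ k).1, Or.inr (hμ k).2⟩
  · have hshift : μ k + N = μ k + d k + ((N - d k : ℕ) : ℂ) := by
      rw [Nat.cast_sub (hdN k)]
      ring
    rw [hshift]
    exact norm_Gamma_mul_inv_Gamma_add_le (hd k) _ (by simpa using (hμ k).1)

end RegMellin

/-! ### The meromorphic continuation of the Mellin transform -/

section MellinTransform

variable {p n : ℕ} (A : Matrix (Fin p) (Fin n) ℕ) (I : Fin p ↪o Fin n)

open Classical in
/-- The exponents `μ_k` for which the Mellin density is the product of the kernels
`|ζ_k|^{2(μ_k-1)} ζ_k^{-b_k}`, where `b` is `mellinOrder A I`. -/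
def mellinExp (s : Fin p → ℂ) (k : Fin n) : ℂ :=
  col ℂ A k s + if k ∈ Set.range I then 0 else 1

open Classical in
/-- The exponents `b_k` for which the Mellin density is the product of the kernels
`|ζ_k|^{2(μ_k-1)} ζ_k^{-b_k}`, where `μ` is `mellinExp A I s`. -/
def mellinOrder (k : Fin n) : ℤ :=
  if k ∈ Set.range I then (colSum A k : ℤ) - 1 else colSum A k

open Classical in
/-- The indicator function of the members of `I` at the positions in the list `J`: raising the
argument of `Γ` by one there cancels the pole along `⟨αʲ, s⟩ = 0`. -/
def listShift (J : List (Fin p)) (k : Fin n) : ℕ :=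
  if ∃ j ∈ J, I j = k then 1 else 0

theorem mellinExp_apply (s : Fin p → ℂ) (j : Fin p) :
    mellinExp A I s (I j) = col ℂ A (I j) s := by
  simp [mellinExp]

theorem mellinOrder_apply (j : Fin p) : mellinOrder A I (I j) = (colSum A (I j) : ℤ) - 1 :=
  if_pos ⟨j, rfl⟩

theorem listShift_apply (J : List (Fin p)) (j : Fin p) :
    listShift I J (I j) = if j ∈ J then 1 else 0 := by
  simp [listShift]

theorem listShift_nil : listShift I [] = 0 := by
  ext k
  simp [listShift]

variable {I} in
theorem mellinExp_of_notMem (s : Fin p → ℂ) {k : Fin n} (hk : k ∉ Set.range I) :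
    mellinExp A I s k = col ℂ A k s + 1 := by
  rw [mellinExp, if_neg hk]

variable {I} in
theorem mellinOrder_of_notMem {k : Fin n} (hk : k ∉ Set.range I) :
    mellinOrder A I k = colSum A k :=
  if_neg hk

variable {I} in
theorem listShift_of_notMem (J : List (Fin p)) {k : Fin n} (hk : k ∉ Set.range I) :
    listShift I J k = 0 := by
  rw [listShift, if_neg]
  rintro ⟨j, -, rfl⟩
  exact hk ⟨j, rfl⟩

theorem prod_eq_prod_mul_prod_filter {α : Type*} [CommMonoid α] (f : Fin n → α)
    [DecidablePred fun k : Fin n => k ∉ Set.range I] :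
    ∏ k, f k = (∏ j, f (I j)) * ∏ k ∈ Finset.univ.filter (fun k => k ∉ Set.range I), f k := by
  classical
  rw [← Finset.prod_filter_not_mul_prod_filter Finset.univ (fun k => k ∉ Set.range I)]
  congr 1
  refine (Finset.prod_congr ?_ fun _ _ => rfl).trans
    (Finset.prod_map Finset.univ I.toEmbedding f)
  ext k
  simp

theorem mellinDensity_eq (φ : TestForm p n) (s : Fin p → ℂ) :
    mellinDensity A I φ s = fun ζ =>
      φ.coeff I ζ * polyKernel (mellinOrder A I) (mellinExp A I s) ζ := by
  ext ζ
  rw [polyKernel, prod_eq_prod_mul_prod_filter I, mellinDensity, mul_assoc]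
  congr 2
  · refine Finset.prod_congr rfl fun j _ => ?_
    rw [monoKernel, mellinExp_apply, mellinOrder_apply]
  · refine Finset.prod_congr rfl fun k hk => ?_
    have hk' : k ∉ Set.range I := (Finset.mem_filter.1 hk).2
    rw [monoKernel, mellinExp_of_notMem A s hk', mellinOrder_of_notMem A hk', add_sub_cancel_right,
      zpow_natCast]

/-- The constant factor of the Mellin transform with respect to Lebesgue measure. -/
def mellinConst : ℂ :=
  cSign I * (minor A I : ℂ) / (2 * Real.pi * Complex.I) ^ p * (2 * Complex.I) ^ n

/-- The continuation of the Mellin transform, multiplied by the linear forms `⟨αʲ, s⟩` for the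
members of `I` at the positions in `J`; the factors are absorbed into the Gamma functions. -/
def mellinReg (φ : TestForm p n) (J : List (Fin p)) (s : Fin p → ℂ) : ℂ :=
  mellinConst A I * ((∏ k, Complex.Gamma (mellinExp A I s k + listShift I J k))
    * regMellinExt (φ.coeff I) (mellinOrder A I) (mellinExp A I s))

theorem mem_polarSet_iff (J : List (Fin p)) (s : Fin p → ℂ) :
    s ∈ polarSet A I J ↔ ∃ k, Complex.Gamma (mellinExp A I s k + listShift I J k) = 0 := by
  simp only [Complex.Gamma_eq_zero_iff]
  constructor
  · rintro (⟨j, ν, hj, h⟩ | ⟨k, ν, hk, hν, h⟩)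
    · refine ⟨I j, ?_⟩
      rw [mellinExp_apply, listShift_apply, h]
      split_ifs with hJ
      · obtain ⟨ν, rfl⟩ := Nat.exists_eq_add_of_le' (hj hJ)
        exact ⟨ν, by push_cast; ring⟩
      · exact ⟨ν, by simp⟩
    · obtain ⟨ν, rfl⟩ := Nat.exists_eq_add_of_le' hν
      refine ⟨k, ν, ?_⟩
      rw [mellinExp_of_notMem A s hk, listShift_of_notMem J hk, h]
      push_cast
      ring
  · rintro ⟨k, ν, h⟩
    by_cases hk : k ∈ Set.range I
    · obtain ⟨j, rfl⟩ := hk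
      rw [mellinExp_apply, listShift_apply] at h
      left
      split_ifs at h with hJ
      · exact ⟨j, ν + 1, fun _ => by simp, by push_cast at h ⊢; linear_combination h⟩
      · exact ⟨j, ν, fun h => absurd h hJ, by simpa using h⟩
    · rw [mellinExp_of_notMem A s hk, listShift_of_notMem J hk] at h
      exact Or.inr ⟨k, ν + 1, hk, by simp, by push_cast at h ⊢; linear_combination h⟩

theorem analyticAt_linearMap {V : Type*} [NormedAddCommGroup V] [NormedSpace ℂ V]
    [FiniteDimensional ℂ V] (l : V →ₗ[ℂ] ℂ) (a : V) : AnalyticAt ℂ (fun z => l z) a :=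
  (LinearMap.toContinuousLinearMap l).analyticAt a

theorem analyticAt_mellinExp (k : Fin n) (s : Fin p → ℂ) :
    AnalyticAt ℂ (fun s => mellinExp A I s k) s :=
  (analyticAt_linearMap (col ℂ A k) s).add analyticAt_const

theorem isClosed_polarSet (J : List (Fin p)) : IsClosed (polarSet A I J) := by
  have hunion : polarSet A I J = ⋃ k, {s : Fin p → ℂ |
      (Complex.Gamma (mellinExp A I s k + listShift I J k))⁻¹ = 0} := by
    ext s
    simp [mem_polarSet_iff]
  have hΓ : Continuous fun z : ℂ => (Complex.Gamma z)⁻¹ :=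
    Complex.differentiable_one_div_Gamma.continuous
  have hexp : ∀ k, Continuous fun s => mellinExp A I s k := fun k =>
    continuous_iff_continuousAt.2 fun s => (analyticAt_mellinExp A I k s).continuousAt
  rw [hunion]
  exact isClosed_iUnion_of_finite fun k =>
    isClosed_eq (hΓ.comp ((hexp k).add continuous_const)) continuous_const

theorem analyticAt_Gamma_of_ne_zero {z : ℂ} (hz : Complex.Gamma z ≠ 0) :
    AnalyticAt ℂ Complex.Gamma z :=
  ((analyticAt_inv_Gamma z).inv (inv_ne_zero hz)).congr (.of_forall fun _ => inv_inv _)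

theorem analyticAt_mellinReg (φ : TestForm p n) (J : List (Fin p)) {s : Fin p → ℂ}
    (hs : s ∉ polarSet A I J) : AnalyticAt ℂ (mellinReg A I φ J) s := by
  rw [mem_polarSet_iff, not_exists] at hs
  refine analyticAt_const.mul (AnalyticAt.mul ?_ ?_)
  · refine Finset.analyticAt_fun_prod _ fun k _ => ?_
    exact AnalyticAt.comp (f := fun s => mellinExp A I s k + listShift I J k)
      (analyticAt_Gamma_of_ne_zero (hs k)) ((analyticAt_mellinExp A I k s).add analyticAt_const)
  · exact AnalyticAt.comp (f := fun s => mellinExp A I s)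
      (analyticAt_regMellinExt (φ.smooth I) (φ.compactSupport I) _ _)
      (analyticAt_pi_iff.2 fun k => analyticAt_mellinExp A I k s)

theorem mellinReg_cons (φ : TestForm p n) {J : List (Fin p)} {j : Fin p} (hj : j ∉ J)
    {s : Fin p → ℂ} (hs : col ℂ A (I j) s ≠ 0) :
    mellinReg A I φ (j :: J) s = col ℂ A (I j) s * mellinReg A I φ J s := by
  have hfactor : ∀ k, Complex.Gamma (mellinExp A I s k + listShift I (j :: J) k)
      = (if k = I j then col ℂ A (I j) s else 1)
        * Complex.Gamma (mellinExp A I s k + listShift I J k) := by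
    intro k
    split_ifs with hk
    · subst hk
      rw [mellinExp_apply, listShift_apply, listShift_apply, if_pos List.mem_cons_self, if_neg hj]
      simpa only [Nat.cast_one, Nat.cast_zero, add_zero] using Complex.Gamma_add_one _ hs
    · have hshift : listShift I (j :: J) k = listShift I J k := by
        simp [listShift, Ne.symm hk]
      rw [hshift, one_mul]
  rw [mellinReg, mellinReg, Finset.prod_congr rfl fun k _ => hfactor k, Finset.prod_mul_distrib,
    Finset.prod_ite_eq' Finset.univ (I j), if_pos (Finset.mem_univ _)]
  ring

theorem mellinReg_nil_eq (φ : TestForm p n) {J : List (Fin p)} (hJ : J.Nodup) {s : Fin p → ℂ}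
    (hs : ∀ j ∈ J, col ℂ A (I j) s ≠ 0) :
    mellinReg A I φ [] s
      = mellinReg A I φ J s * (J.map fun j => (col ℂ A (I j) s)⁻¹).prod := by
  induction J with
  | nil => simp
  | cons j J ih =>
    rw [List.nodup_cons] at hJ
    rw [List.forall_mem_cons] at hs
    rw [ih hJ.2 hs.2, mellinReg_cons A I φ hJ.1 hs.1, List.map_cons, List.prod_cons,
      mul_comm (col _ _ _ _), mul_assoc (mellinReg A I φ J s), mul_inv_cancel_left₀ hs.1]

variable {A I} in
theorem notMem_polarSet_nil {J : List (Fin p)} {s : Fin p → ℂ} (h : s ∉ polarSet A I J)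
    (hs : ∀ j ∈ J, col ℂ A (I j) s ≠ 0) : s ∉ polarSet A I [] := by
  rintro (⟨j, ν, -, hν⟩ | h')
  · refine h (Or.inl ⟨j, ν, fun hj => Nat.one_le_iff_ne_zero.2 ?_, hν⟩)
    rintro rfl
    exact hs j hj (by simpa using hν)
  · exact h (Or.inr h')

theorem re_col (k : Fin n) (s : Fin p → ℂ) :
    (col ℂ A k s).re = col ℝ A k fun i => (s i).re := by
  simp [col]

theorem colSum_le_col (k : Fin n) {x : Fin p → ℝ} (hx : ∀ i, 1 ≤ x i) :
    (colSum A k : ℝ) ≤ col ℝ A k x := by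
  simp only [colSum, col, LinearMap.sum_apply, LinearMap.smul_apply, LinearMap.proj_apply,
    smul_eq_mul, Nat.cast_sum]
  exact Finset.sum_le_sum fun i _ => le_mul_of_one_le_right (Nat.cast_nonneg _) (hx i)

variable {A I}

theorem colSum_pos (hΔ : minor A I ≠ 0) (j : Fin p) : 0 < colSum A (I j) := by
  rw [Nat.pos_iff_ne_zero]
  intro h
  refine hΔ (Matrix.det_eq_zero_of_column_eq_zero j fun i => ?_)
  simp [Finset.sum_eq_zero_iff.1 h i (Finset.mem_univ i)]

theorem mellinOrder_lt_re_mellinExp {s : Fin p → ℂ} (hs : ∀ k, 1 ≤ (s k).re) (k : Fin n) :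
    mellinOrder A I k < (mellinExp A I s k).re := by
  have h := colSum_le_col A k (x := fun i => (s i).re) hs
  rw [← re_col] at h
  by_cases hk : k ∈ Set.range I
  · obtain ⟨j, rfl⟩ := hk
    rw [mellinExp_apply, mellinOrder_apply]
    push_cast
    linarith
  · rw [mellinExp_of_notMem A s hk, mellinOrder_of_notMem A hk, Complex.add_re, Complex.one_re]
    push_cast
    linarith

theorem mellinExp_re_pos (hΔ : minor A I ≠ 0) {s : Fin p → ℂ} (hs : ∀ k, 1 ≤ (s k).re)
    (k : Fin n) : 0 < (mellinExp A I s k).re := by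
  have hb : 0 ≤ mellinOrder A I k := by
    by_cases hk : k ∈ Set.range I
    · obtain ⟨j, rfl⟩ := hk
      have := colSum_pos hΔ j
      rw [mellinOrder_apply]
      omega
    · rw [mellinOrder_of_notMem A hk]
      positivity
  exact lt_of_le_of_lt (by exact_mod_cast hb) (mellinOrder_lt_re_mellinExp hs k)

theorem mellinExp_mem_mellinDomain (hΔ : minor A I ≠ 0) {s : Fin p → ℂ}
    (hs : ∀ k, 1 ≤ (s k).re) : mellinExp A I s ∈ mellinDomain (mellinOrder A I) := fun k => by
  linarith [mellinOrder_lt_re_mellinExp (A := A) (I := I) hs k, mellinExp_re_pos hΔ hs k]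

theorem mellinReg_nil_eq_mellinIntegral (hΔ : minor A I ≠ 0) (φ : TestForm p n) {s : Fin p → ℂ}
    (hs : ∀ k, 1 ≤ (s k).re) : mellinReg A I φ [] s = mellinIntegral A I φ s := by
  have hΓ : (∏ k, Complex.Gamma (mellinExp A I s k))
      * ∏ k, (Complex.Gamma (mellinExp A I s k))⁻¹ = 1 := by
    rw [← Finset.prod_mul_distrib]
    exact Finset.prod_eq_one fun k _ =>
      mul_inv_cancel₀ (Complex.Gamma_ne_zero_of_re_pos (mellinExp_re_pos hΔ hs k))
  simp only [mellinReg, listShift_nil, Pi.zero_apply, Nat.cast_zero, add_zero]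
  rw [regMellinExt_eq_regMellin (φ.smooth I) (φ.compactSupport I)
      (mellinExp_mem_mellinDomain hΔ hs), regMellin,
    mul_left_comm (∏ k, Complex.Gamma (mellinExp A I s k)), hΓ, mul_one, mellinConst,
    mul_assoc, mellinIntegral, mellinDensity_eq, polyMellin]

theorem isMellinContinuation_mellinReg (hΔ : minor A I ≠ 0) (φ : TestForm p n) :
    IsMellinContinuation A I φ (mellinReg A I φ []) := by
  refine ⟨fun s hs => analyticAt_mellinReg A I φ [] hs, fun s hs => ?_⟩
  have hs' : ∀ k, 1 ≤ (s k).re := fun k => (hs k).le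
  refine ⟨?_, mellinReg_nil_eq_mellinIntegral hΔ φ hs'⟩
  rw [mellinDensity_eq]
  exact integrable_mul_polyKernel (φ.smooth I).continuous (φ.compactSupport I)
    (mellinExp_mem_mellinDomain hΔ hs')

theorem isMellinContinuation_mellinGamma (hΔ : minor A I ≠ 0) (φ : TestForm p n) :
    IsMellinContinuation A I φ (mellinGamma A I φ) :=
  Classical.epsilon_spec ⟨_, isMellinContinuation_mellinReg hΔ φ⟩

theorem isPreconnected_compl_of_countable_lineMap_preimage {V : Type*} [NormedAddCommGroup V]
    [NormedSpace ℂ V] {B : Set V}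
    (hB : ∀ s ∉ B, ∀ t, (AffineMap.lineMap (k := ℂ) s t ⁻¹' B).Countable) :
    IsPreconnected Bᶜ := by
  refine isPreconnected_of_forall_pair fun s hs t ht => ?_
  have hconn : IsPreconnected (AffineMap.lineMap (k := ℂ) s t ⁻¹' B)ᶜ :=
    ((hB s hs t).isPathConnected_compl_of_one_lt_rank
      (by rw [Complex.rank_real_complex]; norm_num)).isConnected.isPreconnected
  refine ⟨AffineMap.lineMap (k := ℂ) s t '' (AffineMap.lineMap (k := ℂ) s t ⁻¹' B)ᶜ,
    Set.image_subset_iff.2 subset_rfl, ⟨0, ?_, AffineMap.lineMap_apply_zero s t⟩,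
    ⟨1, ?_, AffineMap.lineMap_apply_one s t⟩,
    hconn.image _ AffineMap.lineMap_continuous.continuousOn⟩
  · simpa using hs
  · simpa using ht

theorem mellinExp_lineMap (s t : Fin p → ℂ) (z : ℂ) (k : Fin n) :
    mellinExp A I (AffineMap.lineMap s t z) k
      = mellinExp A I s k + z * col ℂ A k (t - s) := by
  simp only [mellinExp, AffineMap.lineMap_apply, vsub_eq_sub, vadd_eq_add, map_add, map_smul,
    smul_eq_mul]
  ring

theorem countable_lineMap_preimage_polarSet (J : List (Fin p)) {s : Fin p → ℂ}
    (hs : s ∉ polarSet A I J) (t : Fin p → ℂ) :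
    (AffineMap.lineMap (k := ℂ) s t ⁻¹' polarSet A I J).Countable := by
  have hunion : AffineMap.lineMap (k := ℂ) s t ⁻¹' polarSet A I J = ⋃ k : Fin n, ⋃ ν : ℕ,
      {z | mellinExp A I s k + z * col ℂ A k (t - s) + listShift I J k = -(ν : ℂ)} := by
    ext z
    simp [mem_polarSet_iff, Complex.Gamma_eq_zero_iff, mellinExp_lineMap]
  rw [hunion]
  refine Set.countable_iUnion fun k => Set.countable_iUnion fun ν => ?_
  refine Set.Subsingleton.countable fun z hz z' hz' => ?_
  rw [Set.mem_ofPred_eq] at hz hz'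
  have hdir : col ℂ A k (t - s) ≠ 0 := by
    intro h
    rw [h, mul_zero, add_zero] at hz
    exact hs ((mem_polarSet_iff A I J s).2 ⟨k, (Complex.Gamma_eq_zero_iff _).2 ⟨ν, hz⟩⟩)
  exact mul_right_cancel₀ hdir (by linear_combination hz - hz')

theorem mellinGamma_eq (hΔ : minor A I ≠ 0) (φ : TestForm p n) {s : Fin p → ℂ}
    (hs : s ∉ polarSet A I []) : mellinGamma A I φ s = mellinReg A I φ [] s := by
  obtain ⟨hGan, hGeq⟩ := isMellinContinuation_mellinGamma hΔ φ
  obtain ⟨hRan, hReq⟩ := isMellinContinuation_mellinReg hΔ φ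
  have hconn : IsPreconnected (polarSet A I [])ᶜ :=
    isPreconnected_compl_of_countable_lineMap_preimage fun _ hs t =>
      countable_lineMap_preimage_polarSet [] hs t
  have hbase : (fun _ => 2 : Fin p → ℂ) ∈ (polarSet A I [])ᶜ := by
    rw [Set.mem_compl_iff, mem_polarSet_iff]
    rintro ⟨k, hk⟩
    refine Complex.Gamma_ne_zero_of_re_pos ?_ hk
    simpa [listShift_nil] using mellinExp_re_pos hΔ (s := fun _ => 2) (fun _ => by simp) k
  have hnear : ∀ᶠ z : Fin p → ℂ in 𝓝 (fun _ => 2), ∀ k, 1 < (z k).re :=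
    eventually_all.2 fun k => (Complex.continuous_re.comp (continuous_apply k)).continuousAt
      |>.eventually (lt_mem_nhds (by simp))
  refine hGan.eqOn_of_preconnected_of_eventuallyEq hRan hconn hbase ?_ hs
  filter_upwards [hnear] with z hz
  rw [(hGeq z hz).2, (hReq z hz).2]

end MellinTransform

/-! ### Residues of forms with simple poles -/

section Wedge

variable {E : Type} [AddCommGroup E] [Module ℂ E] {k : ℕ} {l : E →ₗ[ℂ] ℂ}

theorem wedgeOne_apply (l : E →ₗ[ℂ] ℂ) (χ : E [⋀^Fin k]→ₗ[ℂ] ℂ) (v : Fin (k + 1) → E) :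
    wedgeOne l χ v = ∑ i : Fin (k + 1), (-1) ^ (i : ℕ) * (l (v i) * χ (i.removeNth v)) := by
  simp [wedgeOne, AlternatingMap.alternatizeUncurryFin_apply, LinearMap.smulRight_apply]

theorem wedgeOne_smul (l : E →ₗ[ℂ] ℂ) (c : ℂ) (χ : E [⋀^Fin k]→ₗ[ℂ] ℂ) :
    wedgeOne l (c • χ) = c • wedgeOne l χ := by
  ext v
  simp only [wedgeOne_apply, AlternatingMap.smul_apply, smul_eq_mul, Finset.mul_sum]
  exact Finset.sum_congr rfl fun i _ => by ring

theorem wedgeOne_cons_of_forall_eq_zero (χ : E [⋀^Fin k]→ₗ[ℂ] ℂ) {w : E} (hw : l w = 1)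
    {u : Fin k → E} (hu : ∀ i, l (u i) = 0) : wedgeOne l χ (Fin.cons w u) = χ u := by
  rw [wedgeOne_apply, Fin.sum_univ_succ, Finset.sum_eq_zero fun i _ => by
    rw [Fin.cons_succ, hu, zero_mul, mul_zero]]
  simp [hw]

/- Evaluate at `(w, u)` the form `l ∧ ξ`, which vanishes for reasons of degree. -/
theorem wedgeOne_curryLeft (hk : Module.finrank ℂ E = k + 1) (ξ : E [⋀^Fin (k + 1)]→ₗ[ℂ] ℂ)
    {w : E} (hw : l w = 1) : wedgeOne l (ξ.curryLeft w) = ξ := by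
  have := Module.finite_of_finrank_eq_succ hk
  ext u
  have hzero : wedgeOne l ξ (Fin.cons w u : Fin (k + 1 + 1) → E) = 0 := by
    refine AlternatingMap.map_linearDependent _ _ fun h => ?_
    have := h.fintype_card_le_finrank
    rw [hk, Fintype.card_fin] at this
    omega
  have hterm : ∀ i : Fin (k + 1), (-1 : ℂ) ^ ((i.succ : Fin (k + 1 + 1)) : ℕ)
      * (l ((Fin.cons w u : Fin (k + 1 + 1) → E) i.succ)
        * ξ (i.succ.removeNth (Fin.cons w u : Fin (k + 1 + 1) → E)))
      = -((-1) ^ (i : ℕ) * (l (u i) * (ξ.curryLeft w) (i.removeNth u))) := by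
    intro i
    have hremove : i.succ.removeNth (Fin.cons w u : Fin (k + 1 + 1) → E)
        = Matrix.vecCons w (i.removeNth u) := Fin.cons_comp_succ_succAbove w u i
    rw [Fin.cons_succ, hremove, Fin.val_succ, pow_succ, AlternatingMap.curryLeft_apply_apply]
    ring
  rw [wedgeOne_apply, Fin.sum_univ_succ] at hzero
  simp only [hterm, Finset.sum_neg_distrib, Fin.cons_zero, hw, Fin.removeNth_zero, Fin.tail_cons,
    Fin.val_zero, pow_zero, one_mul] at hzero
  rw [wedgeOne_apply]
  linear_combination -hzero

end Wedge

theorem finrank_inf_ker_add_one {K V : Type*} [Field K] [AddCommGroup V] [Module K V]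
    {W : Submodule K V} [FiniteDimensional K W] {l : V →ₗ[K] K} {w : V} (hw : w ∈ W)
    (hl : l w ≠ 0) :
    Module.finrank K (W ⊓ LinearMap.ker l : Submodule K V) + 1 = Module.finrank K W := by
  have hne : l ∘ₗ W.subtype ≠ 0 := fun h => hl (by simpa using LinearMap.congr_fun h ⟨w, hw⟩)
  have hker := Module.Dual.finrank_ker_add_one_of_ne_zero (f := l ∘ₗ W.subtype) hne
  rwa [LinearMap.ker_comp, ← Submodule.finrank_map_subtype_eq, Submodule.map_comap_subtype]
    at hker

section LerayResidue

variable {V : Type} [NormedAddCommGroup V] [NormedSpace ℂ V]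

theorem eq_of_eventually_of_apply_ne_zero {X : Type*} [TopologicalSpace X] [T2Space X]
    {l : V →ₗ[ℂ] ℂ} (hl : l ≠ 0) {f g : V → X} {b : V} (hf : ContinuousAt f b)
    (hg : ContinuousAt g b) (hfg : ∀ᶠ z in 𝓝 b, l z ≠ 0 → f z = g z) : f b = g b := by
  have hdense : Dense ((LinearMap.ker l : Set V)ᶜ) := by
    rw [← interior_eq_empty_iff_dense_compl, ← Set.not_nonempty_iff_eq_empty]
    exact fun h => hl (LinearMap.ker_eq_top.1 ((LinearMap.ker l).eq_top_of_nonempty_interior' h))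
  refine tendsto_nhds_unique_of_frequently_eq hf hg ?_
  exact ((mem_closure_iff_frequently.1 (hdense b)).and_eventually hfg).mono
    fun z hz => hz.2 hz.1

variable {W : Submodule ℂ V} {l : V →ₗ[ℂ] ℂ} {k : ℕ} {ψ : Form W (k + 1)} {w : W} {g : W → ℂ}
  {ξ : W [⋀^Fin (k + 1)]→ₗ[ℂ] ℂ} {a : (W ⊓ LinearMap.ker l : Submodule ℂ V)}

theorem isLerayResidueAt_of_simple_pole (hrank : Module.finrank ℂ W = k + 1) (hlw : l w = 1)
    (hg : AnalyticAt ℂ g (sliceIncl W l a))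
    (hψ : ∀ᶠ z : W in 𝓝 (sliceIncl W l a), l (z : V) ≠ 0 → ψ z = (g z * (l (z : V))⁻¹) • ξ) :
    IsLerayResidueAt W l ψ
      (fun z => g (sliceIncl W l z) • (ξ.curryLeft w).compLinearMap (sliceIncl W l)) a := by
  refine ⟨fun z => g z • ξ.curryLeft w, fun _ => 0, fun _ => hg.mul analyticAt_const,
    fun _ => analyticAt_const, ?_, .of_forall fun _ => rfl⟩
  filter_upwards [hψ] with z hz hlz
  rw [hz hlz, wedgeOne_smul, wedgeOne_curryLeft (l := l ∘ₗ W.subtype) hrank ξ hlw, add_zero,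
    smul_smul, mul_comm]

/- Write `g ξ / l = (dl / l) ∧ χ + θ`, evaluate at `(w, u)` with `u` tangent to the hyperplane, and
clear the denominator. -/
theorem IsLerayResidueAt.eq_smul_curryLeft [FiniteDimensional ℂ V]
    {ρ : Form (W ⊓ LinearMap.ker l) k}
    (h : IsLerayResidueAt W l ψ ρ a) (hlw : l w = 1) (hg : ContinuousAt g (sliceIncl W l a))
    (hψ : ∀ᶠ z : W in 𝓝 (sliceIncl W l a), l (z : V) ≠ 0 → ψ z = (g z * (l (z : V))⁻¹) • ξ) :
    ρ a = g (sliceIncl W l a) • (ξ.curryLeft w).compLinearMap (sliceIncl W l) := by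
  obtain ⟨χ, θ, hχ, hθ, hev, hρ⟩ := h
  have hlw' : (l ∘ₗ W.subtype) w = 1 := hlw
  have hne : l ∘ₗ W.subtype ≠ 0 := fun h => by simp [h] at hlw'
  have hla : l (a : V) = 0 := a.2.2
  have hl := (analyticAt_linearMap (l ∘ₗ W.subtype) (sliceIncl W l a)).continuousAt
  rw [hρ.self_of_nhds]
  ext u
  set u' : Fin k → W := fun i => sliceIncl W l (u i)
  have hlu : ∀ i, (l ∘ₗ W.subtype) (u' i) = 0 := fun i => (u i).2.2
  have hcleared : ∀ᶠ z : W in 𝓝 (sliceIncl W l a), (l ∘ₗ W.subtype) z ≠ 0 →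
      g z * ξ (Fin.cons w u') = χ z u' + (l ∘ₗ W.subtype) z * θ z (Fin.cons w u') := by
    filter_upwards [hev, hψ] with z hz hz' hlz
    have heval := DFunLike.congr_fun ((hz' hlz).symm.trans (hz hlz))
      (Fin.cons w u' : Fin (k + 1) → W)
    simp only [AlternatingMap.smul_apply, AlternatingMap.add_apply, smul_eq_mul,
      wedgeOne_cons_of_forall_eq_zero _ hlw' hlu] at heval
    replace hlz : l (z : V) ≠ 0 := hlz
    rw [LinearMap.comp_apply, Submodule.subtype_apply]
    field_simp at heval
    linear_combination heval
  have hlimit := eq_of_eventually_of_apply_ne_zero hne (hg.mul continuousAt_const)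
    ((hχ u').continuousAt.add (hl.mul (hθ (Fin.cons w u')).continuousAt)) hcleared
  have hres : χ (sliceIncl W l a) u' = g (sliceIncl W l a) * ξ (Fin.cons w u') := by
    simpa [hla] using hlimit.symm
  exact hres

end LerayResidue

section CompositeResidue

variable {V : Type} [NormedAddCommGroup V] [NormedSpace ℂ V]

/-- The contraction of a form with the vectors `w j`, `j` running through the list. -/
def contract {ι : Type} (w : ι → V) :
    ∀ (J : List ι) (m : ℕ), V [⋀^Fin (m + J.length)]→ₗ[ℂ] ℂ → V [⋀^Fin m]→ₗ[ℂ] ℂ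
  | [], _, ξ => ξ
  | j :: J, m, ξ => contract w J m (AlternatingMap.curryLeft (n := m + J.length) ξ (w j))

theorem analyticAt_list_prod_inv {ι : Type*} {F : Type*} [NormedAddCommGroup F] [NormedSpace ℂ F]
    {f : ι → F → ℂ} {J : List ι} {a : F} (hf : ∀ j ∈ J, AnalyticAt ℂ (f j) a)
    (h0 : ∀ j ∈ J, f j a ≠ 0) : AnalyticAt ℂ (fun z => (J.map fun j => (f j z)⁻¹).prod) a := by
  induction J with
  | nil => exact analyticAt_const
  | cons j J ih =>
    rw [List.forall_mem_cons] at hf h0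
    simp only [List.map_cons, List.prod_cons]
    exact (hf.1.inv h0.1).mul (ih hf.2 h0.2)

theorem analyticAt_comp_subtype {W : Submodule ℂ V} {g : V → ℂ} {a : W}
    (hg : AnalyticAt ℂ g (a : V)) : AnalyticAt ℂ (fun z : W => g z) a :=
  AnalyticAt.comp (f := fun z : W => (z : V)) hg (W.subtypeL.analyticAt a)

/-- The linear forms `f j` and the vectors `w j` of `W`, with `j` in the list, are dual to each
other. -/
structure IsDualFamily {ι : Type} [DecidableEq ι] (W : Submodule ℂ V) (f : ι → V →ₗ[ℂ] ℂ)
    (w : ι → V) (J : List ι) : Prop where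
  nodup : J.Nodup
  mem : ∀ j ∈ J, w j ∈ W
  apply : ∀ i ∈ J, ∀ j ∈ J, f i (w j) = if i = j then 1 else 0

/-- The form `ψ` on `W` equals `g ξ / ∏ f j` on `D`, the product being over the list. -/
def HasSimplePoles {ι : Type} {W : Submodule ℂ V} {k : ℕ} (f : ι → V →ₗ[ℂ] ℂ) (D : Set V)
    (J : List ι) (ψ : Form W k) (g : V → ℂ) (ξ : V [⋀^Fin k]→ₗ[ℂ] ℂ) : Prop :=
  ∀ z : W, (z : V) ∈ D → (∀ j ∈ J, f j (z : V) ≠ 0) →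
    ψ z = (g z * (J.map fun j => (f j (z : V))⁻¹).prod) • ξ.compLinearMap W.subtype

variable {ι : Type} {f : ι → V →ₗ[ℂ] ℂ} {w : ι → V} {D : Set V} {g : V → ℂ}
  {J : List ι} {j : ι} {W : Submodule ℂ V} {m : ℕ}

section

variable [DecidableEq ι]

theorem IsDualFamily.apply_head (h : IsDualFamily W f w (j :: J)) : f j (w j) = 1 :=
  (h.apply j List.mem_cons_self j List.mem_cons_self).trans (if_pos rfl)

theorem IsDualFamily.tail (h : IsDualFamily W f w (j :: J)) :
    IsDualFamily (W ⊓ LinearMap.ker (f j)) f w J where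
  nodup := h.nodup.of_cons
  mem i hi := by
    refine ⟨h.mem i (List.mem_cons_of_mem j hi), ?_⟩
    rw [SetLike.mem_coe, LinearMap.mem_ker,
      h.apply j List.mem_cons_self i (List.mem_cons_of_mem j hi), if_neg]
    rintro rfl
    exact (List.nodup_cons.1 h.nodup).1 hi
  apply i hi k hk := h.apply i (List.mem_cons_of_mem j hi) k (List.mem_cons_of_mem j hk)

end

variable [FiniteDimensional ℂ V]

theorem eventually_forall_ne_zero {E : Type*} [TopologicalSpace E] {f : ι → E → ℂ} {a : E}
    (hf : ∀ j ∈ J, ContinuousAt (f j) a) (h0 : ∀ j ∈ J, f j a ≠ 0) :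
    ∀ᶠ z in 𝓝 a, ∀ j ∈ J, f j z ≠ 0 :=
  (eventually_all_finite J.finite_toSet).2 fun j hj => (hf j hj).eventually_ne (h0 j hj)

theorem analyticAt_mul_list_prod_inv (hg : ∀ z ∈ D, AnalyticAt ℂ g z) {a : W} (ha : (a : V) ∈ D)
    (h0 : ∀ j ∈ J, f j (a : V) ≠ 0) :
    AnalyticAt ℂ (fun z : W => g z * (J.map fun j => (f j (z : V))⁻¹).prod) a :=
  (analyticAt_comp_subtype (hg _ ha)).mul (analyticAt_comp_subtype
    (analyticAt_list_prod_inv (fun j _ => analyticAt_linearMap (f j) _) h0))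

theorem HasSimplePoles.eventually_eq {ψ : Form W (m + J.length + 1)}
    {ξ : V [⋀^Fin (m + J.length + 1)]→ₗ[ℂ] ℂ} (hψ : HasSimplePoles f D (j :: J) ψ g ξ)
    (hD : IsOpen D) {a : W} (ha : (a : V) ∈ D) (h0 : ∀ i ∈ J, f i (a : V) ≠ 0) :
    ∀ᶠ z : W in 𝓝 a, f j (z : V) ≠ 0 →
      ψ z = (g z * (J.map fun i => (f i (z : V))⁻¹).prod * (f j (z : V))⁻¹) •
        ξ.compLinearMap W.subtype := by
  have hmem : ∀ᶠ z : W in 𝓝 a, (z : V) ∈ D :=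
    continuous_subtype_val.continuousAt.eventually (hD.mem_nhds ha)
  have hne : ∀ᶠ z : W in 𝓝 a, ∀ i ∈ J, f i (z : V) ≠ 0 :=
    eventually_forall_ne_zero (fun i _ =>
      (analyticAt_comp_subtype (analyticAt_linearMap (f i) (a : V))).continuousAt) h0
  filter_upwards [hmem, hne] with z hz hz' hjz
  rw [hψ z hz (List.forall_mem_cons.2 ⟨hjz, hz'⟩), List.map_cons, List.prod_cons,
    mul_left_comm, mul_comm]

variable [DecidableEq ι]

theorem isCompositeResidue_smul_contract (hD : IsOpen D) (hg : ∀ z ∈ D, AnalyticAt ℂ g z)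
    {ψ : Form W (m + J.length)} (hw : IsDualFamily W f w J)
    (hrank : Module.finrank ℂ W = m + J.length) {ξ : V [⋀^Fin (m + J.length)]→ₗ[ℂ] ℂ}
    (hψ : HasSimplePoles f D J ψ g ξ) :
    IsCompositeResidue f D J W m ψ
      (fun z => g z • (contract w J m ξ).compLinearMap (interKer f J W).subtype) := by
  induction J generalizing W with
  | nil =>
    intro a ha
    rw [hψ a ha (by simp), List.map_nil, List.prod_nil, mul_one]
    rfl
  | cons j J ih =>
    refine ⟨fun z => (g z * (J.map fun i => (f i (z : V))⁻¹).prod) •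
      (AlternatingMap.curryLeft (n := m + J.length) ξ (w j)).compLinearMap (Submodule.subtype _),
      fun a ha h0 => ?_, ih hw.tail ?_ fun z _ _ => rfl⟩
    · have hres := isLerayResidueAt_of_simple_pole (w := ⟨w j, hw.mem j List.mem_cons_self⟩) hrank
        hw.apply_head
        (analyticAt_mul_list_prod_inv (a := sliceIncl W (f j) a) hg ha h0)
        (hψ.eventually_eq hD ha h0)
      rwa [AlternatingMap.curryLeft_compLinearMap] at hres
    · have := finrank_inf_ker_add_one (hw.mem j List.mem_cons_self)
        (hw.apply_head.trans_ne one_ne_zero)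
      rw [hrank, List.length_cons] at this
      omega

theorem IsCompositeResidue.eq_smul_contract (hD : IsOpen D) (hg : ∀ z ∈ D, AnalyticAt ℂ g z)
    {ψ : Form W (m + J.length)} {ρ : Form (interKer f J W) m} (hw : IsDualFamily W f w J)
    {ξ : V [⋀^Fin (m + J.length)]→ₗ[ℂ] ℂ} (hψ : HasSimplePoles f D J ψ g ξ)
    (h : IsCompositeResidue f D J W m ψ ρ) (a : interKer f J W) (ha : (a : V) ∈ D) :
    ρ a = g a • (contract w J m ξ).compLinearMap (interKer f J W).subtype := by
  induction J generalizing W with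
  | nil =>
    have hρ : ρ a = ψ a := h a ha
    rw [hρ, hψ a ha (by simp), List.map_nil, List.prod_nil, mul_one]
    rfl
  | cons j J ih =>
    obtain ⟨σ, hσ, hrest⟩ := h
    refine ih hw.tail (fun z hz h0 => ?_) hrest a ha
    have hres := (hσ z hz h0).eq_smul_curryLeft (w := ⟨w j, hw.mem j List.mem_cons_self⟩)
      hw.apply_head
      (analyticAt_mul_list_prod_inv (a := sliceIncl W (f j) z) hg hz h0).continuousAt
      (hψ.eventually_eq hD hz h0)
    rwa [AlternatingMap.curryLeft_compLinearMap] at hres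

end CompositeResidue

/-! ### The cone and its distinguished face -/

section Cone

variable {p n : ℕ} {A : Matrix (Fin p) (Fin n) ℕ} {I : Fin p ↪o Fin n} {J : List (Fin p)}
  {x : Fin p → ℝ}

/-- The matrix of the linear forms `⟨αʲ, x⟩`, `j ∈ I`. -/
def colMatrix (A : Matrix (Fin p) (Fin n) ℕ) (I : Fin p ↪o Fin n) : Matrix (Fin p) (Fin p) ℝ :=
  Matrix.of fun j l => (A l (I j) : ℝ)

/-- The basis of `ℝᵖ` dual to the linear forms `⟨αʲ, x⟩`, `j ∈ I`; it spans the edges of the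
cone. -/
def dualVec (A : Matrix (Fin p) (Fin n) ℕ) (I : Fin p ↪o Fin n) (j : Fin p) : Fin p → ℝ :=
  fun l => (colMatrix A I)⁻¹ l j

/-- The coefficients of `x₁ + ⋯ + x_p` as a combination of the forms `⟨αʲ, x⟩`, `j ∈ I`. -/
def sumCoeff (A : Matrix (Fin p) (Fin n) ℕ) (I : Fin p ↪o Fin n) (j : Fin p) : ℝ :=
  ∑ l, dualVec A I j l

theorem col_apply {R : Type} [CommRing R] (A : Matrix (Fin p) (Fin n) ℕ) (k : Fin n)
    (x : Fin p → R) : col R A k x = ∑ i, (A i k : R) * x i := by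
  simp [col]

theorem continuous_col (A : Matrix (Fin p) (Fin n) ℕ) (k : Fin n) : Continuous (col ℝ A k) :=
  LinearMap.continuous_of_finiteDimensional _

theorem isUnit_det_colMatrix (hΔ : minor A I ≠ 0) : IsUnit (colMatrix A I).det := by
  have hdet : (colMatrix A I).det = ((minor A I : ℤ) : ℝ) := by
    rw [minor, ← Matrix.det_transpose, Int.cast_det]
    rfl
  rw [isUnit_iff_ne_zero, hdet]
  exact_mod_cast hΔ

theorem col_dualVec (hΔ : minor A I ≠ 0) (i j : Fin p) :
    col ℝ A (I i) (dualVec A I j) = if i = j then 1 else 0 := by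
  rw [col_apply, ← Matrix.one_apply, ← Matrix.mul_nonsing_inv _ (isUnit_det_colMatrix hΔ),
    Matrix.mul_apply]
  rfl

theorem sum_col_smul_dualVec (hΔ : minor A I ≠ 0) (x : Fin p → ℝ) :
    ∑ j, col ℝ A (I j) x • dualVec A I j = x := by
  have hinv : (colMatrix A I)⁻¹.mulVec ((colMatrix A I).mulVec x) = x := by
    rw [Matrix.mulVec_mulVec, Matrix.nonsing_inv_mul _ (isUnit_det_colMatrix hΔ),
      Matrix.one_mulVec]
  conv_rhs => rw [← hinv]
  ext l
  simp only [Finset.sum_apply, Pi.smul_apply, smul_eq_mul, Matrix.mulVec, dotProduct, dualVec,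
    col_apply]
  exact Finset.sum_congr rfl fun j _ => mul_comm _ _

theorem linearIndependent_dualVec (hΔ : minor A I ≠ 0) : LinearIndependent ℝ (dualVec A I) := by
  rw [Fintype.linearIndependent_iff]
  intro c hc i
  have hi := congrArg (col ℝ A (I i)) hc
  simpa [map_sum, col_dualVec hΔ] using hi

theorem sum_eq_sum_sumCoeff (hΔ : minor A I ≠ 0) (x : Fin p → ℝ) :
    ∑ l, x l = ∑ j, sumCoeff A I j * col ℝ A (I j) x := by
  conv_lhs => rw [← sum_col_smul_dualVec hΔ x]
  simp only [Finset.sum_apply, Pi.smul_apply, smul_eq_mul, sumCoeff, Finset.sum_mul]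
  rw [Finset.sum_comm]
  simp only [mul_comm]

theorem zero_mem_cone : (0 : Fin p → ℝ) ∈ cone A I := fun j => (map_zero (col ℝ A (I j))).ge

theorem dualVec_mem_cone (hΔ : minor A I ≠ 0) (j : Fin p) : dualVec A I j ∈ cone A I := fun i => by
  rw [col_dualVec hΔ]
  split_ifs <;> norm_num

theorem add_smul_mem_cone {y : Fin p → ℝ} (hx : x ∈ cone A I) (hy : y ∈ cone A I) {t : ℝ}
    (ht : 0 ≤ t) : x + t • y ∈ cone A I := fun j => by
  rw [map_add, map_smul, smul_eq_mul]
  exact add_nonneg (hx j) (mul_nonneg ht (hy j))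

theorem dualVec_mem_coneZero_iff (hΔ : minor A I ≠ 0) (j : Fin p) :
    dualVec A I j ∈ coneZero A I ↔ sumCoeff A I j ≤ 0 :=
  and_iff_right (dualVec_mem_cone hΔ j)

theorem exists_add_smul_mem_coneZero (hΔ : minor A I ≠ 0) {j : Fin p} (hj : sumCoeff A I j < 0)
    (i : Fin p) : ∃ t : ℝ, dualVec A I i + t • dualVec A I j ∈ coneZero A I := by
  refine ⟨|sumCoeff A I i| / -sumCoeff A I j, add_smul_mem_cone (dualVec_mem_cone hΔ i)
    (dualVec_mem_cone hΔ j) (div_nonneg (abs_nonneg _) (neg_nonneg.2 hj.le)), ?_⟩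
  have hsum : ∀ t : ℝ, ∑ k, (dualVec A I i + t • dualVec A I j) k
      = sumCoeff A I i + t * sumCoeff A I j := fun t => by
    simp [sumCoeff, Finset.sum_add_distrib, Finset.mul_sum]
  rw [Set.mem_ofPred_eq, hsum, div_neg, neg_mul, div_mul_cancel₀ _ hj.ne, ← sub_eq_add_neg,
    sub_nonpos]
  exact le_abs_self _

theorem span_coneZero_eq_top (hΔ : minor A I ≠ 0) {j : Fin p} (hj : sumCoeff A I j < 0) :
    Submodule.span ℝ (coneZero A I) = ⊤ := by
  have hmem : ∀ i, dualVec A I i ∈ Submodule.span ℝ (coneZero A I) := fun i => by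
    obtain ⟨t, ht⟩ := exists_add_smul_mem_coneZero hΔ hj i
    exact (Submodule.add_mem_iff_left _ (Submodule.smul_mem _ t
      (Submodule.subset_span ((dualVec_mem_coneZero_iff hΔ j).2 hj.le)))).1
      (Submodule.subset_span ht)
  refine (Submodule.eq_top_iff').2 fun x => ?_
  rw [← sum_col_smul_dualVec hΔ x]
  exact Submodule.sum_mem _ fun i _ => Submodule.smul_mem _ _ (hmem i)

theorem sumCoeff_nonneg (hΔ : minor A I ≠ 0) (hq : 1 ≤ codimZero A I) (j : Fin p) :
    0 ≤ sumCoeff A I j := by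
  by_contra! hj
  rw [codimZero, span_coneZero_eq_top hΔ hj, finrank_top, Module.finrank_fin_fun,
    Nat.sub_self] at hq
  exact Nat.not_succ_le_zero 0 hq

-- On the cone `x₁ + ⋯ + x_p` is a sum of nonnegative terms, so it is `≤ 0` only if all of them
-- vanish.
theorem coneZero_eq (hΔ : minor A I ≠ 0) (hc : ∀ j, 0 ≤ sumCoeff A I j) :
    coneZero A I = {x | (∀ j, 0 < sumCoeff A I j → col ℝ A (I j) x = 0) ∧ x ∈ cone A I} := by
  ext x
  constructor
  · rintro ⟨hx, hsum : ∑ k, x k ≤ 0⟩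
    refine ⟨fun j hj => ?_, hx⟩
    rw [sum_eq_sum_sumCoeff hΔ] at hsum
    have hterm : ∀ i ∈ Finset.univ, 0 ≤ sumCoeff A I i * col ℝ A (I i) x :=
      fun i _ => mul_nonneg (hc i) (hx i)
    have hzero := (Finset.sum_eq_zero_iff_of_nonneg hterm).1
      (hsum.antisymm (Finset.sum_nonneg hterm)) j (Finset.mem_univ j)
    exact (mul_eq_zero.1 hzero).resolve_left hj.ne'
  · rintro ⟨hzero, hx⟩
    refine ⟨hx, ?_⟩
    rw [Set.mem_ofPred_eq, sum_eq_sum_sumCoeff hΔ]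
    refine (Finset.sum_eq_zero fun j _ => ?_).le
    rcases (hc j).eq_or_lt with hj | hj
    · rw [← hj, zero_mul]
    · rw [hzero j hj, mul_zero]

theorem span_coneZero (hΔ : minor A I ≠ 0) (hc : ∀ j, 0 ≤ sumCoeff A I j) :
    Submodule.span ℝ (coneZero A I)
      = Submodule.span ℝ (Set.range fun j : {j // ¬0 < sumCoeff A I j} => dualVec A I j) := by
  refine le_antisymm (Submodule.span_le.2 fun x hx => ?_) (Submodule.span_le.2 ?_)
  · rw [coneZero_eq hΔ hc] at hx
    rw [SetLike.mem_coe, ← sum_col_smul_dualVec hΔ x]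
    refine Submodule.sum_mem _ fun j _ => ?_
    by_cases hj : 0 < sumCoeff A I j
    · rw [hx.1 j hj, zero_smul]
      exact Submodule.zero_mem _
    · exact Submodule.smul_mem _ _ (Submodule.subset_span ⟨⟨j, hj⟩, rfl⟩)
  · rintro _ ⟨⟨j, hj⟩, rfl⟩
    exact Submodule.subset_span ((dualVec_mem_coneZero_iff hΔ j).2 (not_lt.1 hj))

theorem codimZero_eq_card (hΔ : minor A I ≠ 0) (hc : ∀ j, 0 ≤ sumCoeff A I j) :
    codimZero A I = (Finset.univ.filter fun j => 0 < sumCoeff A I j).card := by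
  have hli : LinearIndependent ℝ fun j : {j // ¬0 < sumCoeff A I j} => dualVec A I j :=
    (linearIndependent_dualVec hΔ).comp _ Subtype.val_injective
  rw [codimZero, span_coneZero hΔ hc, finrank_span_eq_card hli, Fintype.card_subtype_compl,
    Fintype.card_fin, Fintype.card_subtype]
  exact Nat.sub_sub_self ((Finset.card_le_univ _).trans_eq (Fintype.card_fin p))

theorem exists_isFaceIndexing (hΔ : minor A I ≠ 0) (hq : 1 ≤ codimZero A I) :
    ∃ J : List (Fin p), IsFaceIndexing A I J := by
  have hc := sumCoeff_nonneg hΔ hq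
  refine ⟨(Finset.univ.filter fun j => 0 < sumCoeff A I j).toList, Finset.nodup_toList _,
    by rw [Finset.length_toList, codimZero_eq_card hΔ hc], ?_⟩
  simp only [coneZero_eq hΔ hc, Finset.mem_toList, Finset.mem_filter, Finset.mem_univ, true_and]
  ext x
  refine and_congr_right fun hzero => ⟨fun hx k _ => hx k, fun hx k => ?_⟩
  by_cases hk : 0 < sumCoeff A I k
  · exact (hzero k hk).ge
  · exact hx k hk

theorem IsFaceIndexing.mem_iff (hΔ : minor A I ≠ 0) (hJ : IsFaceIndexing A I J) (j : Fin p) :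
    j ∈ J ↔ 0 < sumCoeff A I j := by
  rw [← not_iff_not, not_lt, ← dualVec_mem_coneZero_iff hΔ, hJ.2.2]
  refine ⟨fun hj => ⟨fun i hi => ?_, fun i _ => dualVec_mem_cone hΔ j i⟩, fun hmem hj => ?_⟩
  · rw [col_dualVec hΔ, if_neg (ne_of_mem_of_not_mem hi hj)]
  · simpa [col_dualVec hΔ] using hmem.1 j hj

theorem IsFaceIndexing.sum_eq (hΔ : minor A I ≠ 0) (hq : 1 ≤ codimZero A I)
    (hJ : IsFaceIndexing A I J) (x : Fin p → ℝ) :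
    ∑ l, x l = ∑ a : Fin J.length, sumCoeff A I (J.get a) * col ℝ A (I (J.get a)) x := by
  have hlist := Fin.sum_univ_fun_getElem J fun j => sumCoeff A I j * col ℝ A (I j) x
  rw [← List.sum_toFinset _ hJ.1] at hlist
  rw [sum_eq_sum_sumCoeff hΔ]
  refine (Finset.sum_subset (Finset.subset_univ _) fun j _ hj => ?_).symm.trans hlist.symm
  rw [List.mem_toFinset, hJ.mem_iff hΔ, not_lt] at hj
  rw [le_antisymm hj (sumCoeff_nonneg hΔ hq j), zero_mul]

theorem IsFaceIndexing.sum_eq_zero_of_mem_realLeaf (hΔ : minor A I ≠ 0) (hq : 1 ≤ codimZero A I)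
    (hJ : IsFaceIndexing A I J) (hx : x ∈ realLeaf A I J) : ∑ k, x k = 0 := by
  rw [hJ.sum_eq hΔ hq]
  refine Finset.sum_eq_zero fun a _ => ?_
  rw [hx _ (J.get_mem a), mul_zero]

end Cone

section Interior

variable {V : Type*} [NormedAddCommGroup V] [NormedSpace ℝ V] {S : Set V} {x y : V}

theorem tendsto_add_smul_nhdsGT_zero (x d : V) :
    Tendsto (fun t : ℝ => x + t • d) (𝓝[>] 0) (𝓝 x) := by
  have hcont : Continuous fun t : ℝ => x + t • d := by fun_prop
  simpa using (hcont.tendsto 0).mono_left nhdsWithin_le_nhds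

theorem exists_pos_add_smul_mem (hS : S ∈ 𝓝 x) (d : V) : ∃ t : ℝ, 0 < t ∧ x + t • d ∈ S :=
  (eventually_mem_nhdsWithin.and ((tendsto_add_smul_nhdsGT_zero x d).eventually hS)).exists

theorem exists_pos_add_smul_sub_mem_of_mem_intrinsicInterior (hx : x ∈ intrinsicInterior ℝ S)
    (hy : y ∈ S) : ∃ t : ℝ, 0 < t ∧ x + t • (x - y) ∈ S := by
  obtain ⟨x, hx, rfl⟩ := hx
  let f : ℝ → affineSpan ℝ S := fun t =>
    ⟨AffineMap.lineMap (x : V) y (-t), AffineMap.lineMap_mem _ x.2 (subset_affineSpan ℝ S hy)⟩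
  have hval : ∀ t, (f t : V) = x + t • ((x : V) - y) := fun t => by
    simp only [f, AffineMap.lineMap_apply, vsub_eq_sub, vadd_eq_add]
    module
  have hf : Continuous f := by
    refine continuous_induced_rng.2 ?_
    simp only [Function.comp_def, hval]
    fun_prop
  have hf0 : f 0 = x := Subtype.ext (by simp [f])
  have hnhds : ∀ᶠ t in 𝓝[>] 0, (f t : V) ∈ S :=
    ((hf.tendsto' 0 x hf0).mono_left nhdsWithin_le_nhds).eventually
      (mem_interior_iff_mem_nhds.1 hx)
  obtain ⟨t, ht, hmem⟩ := (eventually_mem_nhdsWithin.and hnhds).exists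
  exact ⟨t, ht, hval t ▸ hmem⟩

end Interior

section Admissible

variable {p n : ℕ} {A : Matrix (Fin p) (Fin n) ℕ} {I : Fin p ↪o Fin n} {J : List (Fin p)}
  {x : Fin p → ℝ}

theorem col_pos_of_mem_interior (hΔ : minor A I ≠ 0) (hx : x ∈ interior (cone A I)) (j : Fin p) :
    0 < col ℝ A (I j) x := by
  obtain ⟨t, ht, hmem⟩ :=
    exists_pos_add_smul_mem (mem_interior_iff_mem_nhds.1 hx) (-dualVec A I j)
  have hj := hmem j
  rw [map_add, map_smul, map_neg, col_dualVec hΔ, if_pos rfl, smul_eq_mul] at hj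
  linarith

theorem mem_interior_cone (hx : ∀ j, 0 < col ℝ A (I j) x) : x ∈ interior (cone A I) := by
  have hopen : IsOpen {y : Fin p → ℝ | ∀ j, 0 < col ℝ A (I j) y} := by
    rw [Set.ofPred_forall]
    exact isOpen_iInter_of_finite fun j => isOpen_lt continuous_const (continuous_col A (I j))
  exact interior_maximal (fun y hy j => (hy j).le) hopen hx

theorem eventually_forall_lt_one (hx : ∀ k, x k < 1) : ∀ᶠ y : Fin p → ℝ in 𝓝 x, ∀ k, y k < 1 :=
  eventually_all.2 fun k => (continuous_apply k).continuousAt.eventually (gt_mem_nhds (hx k))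

theorem mem_closure_admissible (hΔ : minor A I ≠ 0) (hx : x ∈ cone A I) (hx1 : ∀ k, x k < 1) :
    x ∈ closure (admissible A I) := by
  have hlim := tendsto_add_smul_nhdsGT_zero x (∑ j, dualVec A I j)
  refine mem_closure_of_tendsto hlim ?_
  filter_upwards [hlim.eventually (eventually_forall_lt_one hx1), eventually_mem_nhdsWithin]
    with t ht1 ht
  refine ⟨mem_interior_cone fun j => ?_, ht1⟩
  simpa [col_dualVec hΔ] using add_pos_of_nonneg_of_pos (hx j) ht

theorem le_one_of_mem_closure_admissible (hx : x ∈ closure (admissible A I)) (k : Fin p) :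
    x k ≤ 1 :=
  closure_minimal (fun _ hz => (hz.2 k).le)
    (isClosed_le (continuous_apply k) continuous_const) hx

theorem lt_one_of_mem_admissibleFace (hΔ : minor A I ≠ 0) (hx : x ∈ admissibleFace A I)
    (k : Fin p) : x k < 1 := by
  have hzero : (0 : Fin p → ℝ) ∈ coneZero A I ∩ closure (admissible A I) :=
    ⟨⟨zero_mem_cone, by simp⟩, mem_closure_admissible hΔ zero_mem_cone fun _ => one_pos⟩
  obtain ⟨t, ht, hmem⟩ := exists_pos_add_smul_sub_mem_of_mem_intrinsicInterior hx hzero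
  have hle := le_one_of_mem_closure_admissible hmem.2 k
  simp only [sub_zero, Pi.add_apply, Pi.smul_apply, smul_eq_mul] at hle
  by_contra! hk
  nlinarith

theorem exists_smul_dualVec_mem (hΔ : minor A I ≠ 0) {j : Fin p} (hj : sumCoeff A I j ≤ 0) :
    ∃ t : ℝ, 0 < t ∧ t • dualVec A I j ∈ coneZero A I ∩ closure (admissible A I) := by
  obtain ⟨t, ht, ht1⟩ := exists_pos_add_smul_mem
    (eventually_forall_lt_one (x := (0 : Fin p → ℝ)) fun _ => one_pos) (dualVec A I j)
  rw [zero_add] at ht1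
  have hcone : t • dualVec A I j ∈ cone A I := by
    simpa using add_smul_mem_cone zero_mem_cone (dualVec_mem_cone hΔ j) ht.le
  refine ⟨t, ht, ⟨hcone, ?_⟩, mem_closure_admissible hΔ hcone ht1⟩
  simpa [sumCoeff, ← Finset.mul_sum] using mul_nonpos_of_nonneg_of_nonpos ht.le hj

theorem IsFaceIndexing.col_pos_of_mem_admissibleFace (hΔ : minor A I ≠ 0)
    (hJ : IsFaceIndexing A I J) (hx : x ∈ admissibleFace A I) {j : Fin p} (hj : j ∉ J) :
    0 < col ℝ A (I j) x := by
  obtain ⟨t, ht, hmem⟩ := exists_smul_dualVec_mem hΔ (not_lt.1 (mt (hJ.mem_iff hΔ j).2 hj))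
  obtain ⟨e, he, hmem'⟩ := exists_pos_add_smul_sub_mem_of_mem_intrinsicInterior hx hmem
  have hcol := hmem'.1.1 j
  simp only [map_add, map_smul, map_sub, smul_eq_mul, col_dualVec hΔ, if_true, mul_one] at hcol
  by_contra! hneg
  nlinarith [mul_pos he ht]

end Admissible

/-! ### Frames and orientation -/

theorem contract_apply {V ι : Type} [NormedAddCommGroup V] [NormedSpace ℂ V] (w : ι → V)
    (J : List ι) (m : ℕ) (ξ : V [⋀^Fin (m + J.length)]→ₗ[ℂ] ℂ) (v : Fin m → V) :
    contract w J m ξ v = ξ fun i =>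
      Fin.append (fun a : Fin J.length => w (J.get a)) v (Fin.cast (Nat.add_comm _ _) i) := by
  induction J with
  | nil =>
    rw [contract]
    congr 1
    ext i
    simp [Fin.append, Fin.addCases]
  | cons j J ih =>
    rw [contract, ih, AlternatingMap.curryLeft_apply_apply]
    congr 1
    ext i
    cases i using Fin.cases with
    | zero => simp [Fin.append, Fin.addCases]
    | succ i =>
      by_cases hi : (i : ℕ) < J.length
      · simp [Fin.append, Fin.addCases, hi]
      · simp [Fin.append, Fin.addCases, hi, Fin.subNat]

section FrameMatrix

variable {p q m : ℕ} (hp : q + m = p)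

theorem frameMatrix_mul_transpose {α w : Fin q → Fin (q + m) → ℝ} {v : Fin m → Fin (q + m) → ℝ}
    (hαw : ∀ a b, α a ⬝ᵥ w b = if a = b then 1 else 0) (hαv : ∀ a b, α a ⬝ᵥ v b = 0) :
    (frameMatrix rfl α v * (frameMatrix rfl w v).transpose).submatrix
      finSumFinEquiv finSumFinEquiv = Matrix.fromBlocks (1 : Matrix (Fin q) (Fin q) ℝ) 0
        (Matrix.of fun b a => v b ⬝ᵥ w a) (Matrix.of v * (Matrix.of v).transpose) := by
  replace hαv : ∀ a b, ∑ l, α a l * v b l = 0 := hαv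
  ext i j
  rcases i with i | i <;> rcases j with j | j <;>
    simp [frameMatrix, Matrix.mul_apply, Matrix.one_apply, ← hαw, hαv, dotProduct]

theorem det_mul_transpose_self_pos {ι κ : Type*} [Fintype ι] [DecidableEq ι] [Fintype κ]
    {v : ι → κ → ℝ} (hv : LinearIndependent ℝ v) :
    0 < (Matrix.of v * (Matrix.of v).transpose).det := by
  have hpos := Matrix.PosDef.mul_conjTranspose_self (Matrix.of v) (Matrix.vecMul_injective_iff.2 hv)
  rw [Matrix.conjTranspose_eq_transpose_of_trivial] at hpos
  exact hpos.det_pos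

/- The product of the two determinants is the Gram determinant of `v`. -/
theorem frameMatrix_det_mul_pos {α w : Fin q → Fin p → ℝ} {v : Fin m → Fin p → ℝ}
    (hαw : ∀ a b, α a ⬝ᵥ w b = if a = b then 1 else 0) (hαv : ∀ a b, α a ⬝ᵥ v b = 0)
    (hv : LinearIndependent ℝ v) :
    0 < (frameMatrix hp α v).det * (frameMatrix hp w v).det := by
  subst hp
  have hdet := congrArg Matrix.det (frameMatrix_mul_transpose hαw hαv)
  rw [Matrix.det_submatrix_equiv_self, Matrix.det_mul, Matrix.det_transpose,
    Matrix.det_fromBlocks_zero₁₂, Matrix.det_one, one_mul] at hdet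
  rw [hdet]
  exact det_mul_transpose_self_pos hv

theorem frameMatrix_det_ofReal (w : Fin q → Fin p → ℝ) (v : Fin m → Fin p → ℝ) :
    (frameMatrix hp (fun a l => (w a l : ℂ)) fun b l => Complex.I * (v b l : ℂ)).det
      = Complex.I ^ m * ((frameMatrix hp w v).det : ℂ) := by
  subst hp
  have hrows : frameMatrix rfl (fun a l => (w a l : ℂ)) (fun b l => Complex.I * (v b l : ℂ))
      = Matrix.of fun i j => Fin.append (fun _ : Fin q => (1 : ℂ)) (fun _ : Fin m => Complex.I) i
        * ((frameMatrix rfl w v).map Complex.ofReal) i j := by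
    ext i j
    refine Fin.addCases (fun i => ?_) (fun i => ?_) i <;> simp [frameMatrix]
  rw [hrows, Matrix.det_mul_column, Fin.prod_univ_add]
  simp only [Fin.append_left, Fin.append_right, Finset.prod_const_one, one_mul,
    Finset.prod_const, Finset.card_univ, Fintype.card_fin]
  congr 1
  exact (Complex.ofRealHom.map_det _).symm

end FrameMatrix

section LeafOrientation

variable {p n : ℕ} {A : Matrix (Fin p) (Fin n) ℕ} {I : Fin p ↪o Fin n} {J : List (Fin p)} {m : ℕ}
  {v : Fin m → Fin p → ℝ}

/-- The matrix of the frame that consists of the dual vectors `dualVec A I j`, `j ∈ J`, followed by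
the vectors `v`. -/
def dualFrame (A : Matrix (Fin p) (Fin n) ℕ) (I : Fin p ↪o Fin n) (J : List (Fin p))
    (hm : m + J.length = p) (v : Fin m → Fin p → ℝ) : Matrix (Fin p) (Fin p) ℝ :=
  frameMatrix ((Nat.add_comm J.length m).trans hm) (fun a => dualVec A I (J.get a)) v

theorem orientSign_eq (hm : m + J.length = p) (v : Fin m → Fin p → ℝ) :
    orientSign A I J hm v = Real.sign (frameMatrix ((Nat.add_comm J.length m).trans hm)
      (fun (a : Fin J.length) l => (A l (I (J.get a)) : ℝ)) v).det := rfl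

theorem det_mul_det_dualFrame_pos (hΔ : minor A I ≠ 0) (hJ : J.Nodup) (hm : m + J.length = p)
    (hvL : ∀ b, v b ∈ realLeaf A I J) (hv : LinearIndependent ℝ v) :
    0 < (frameMatrix ((Nat.add_comm J.length m).trans hm)
        (fun (a : Fin J.length) l => (A l (I (J.get a)) : ℝ)) v).det
      * (dualFrame A I J hm v).det := by
  have hcol : ∀ j (x : Fin p → ℝ), (fun l => (A l (I j) : ℝ)) ⬝ᵥ x = col ℝ A (I j) x :=
    fun j x => (col_apply A (I j) x).symm
  exact frameMatrix_det_mul_pos _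
    (fun a b => by simp only [hcol, col_dualVec hΔ, hJ.get_inj_iff])
    (fun a b => by simp only [hcol, hvL b _ (J.get_mem a)]) hv

theorem isAdaptedFrame_dualVec (hΔ : minor A I ≠ 0) (hJ : J.Nodup) (hm : m + J.length = p)
    (hvL : ∀ b, v b ∈ realLeaf A I J) (hv : LinearIndependent ℝ v) :
    IsAdaptedFrame ((Nat.add_comm J.length m).trans hm) (fun a => col ℝ A (I (J.get a)))
      (fun a => dualVec A I (J.get a)) v where
  det_ne_zero := right_ne_zero_of_mul (det_mul_det_dualFrame_pos hΔ hJ hm hvL hv).ne'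
  apply_left a b := by simp only [col_dualVec hΔ, hJ.get_inj_iff]
  apply_right a b := hvL b _ (J.get_mem a)

theorem orientSign_mul_det_dualFrame (hΔ : minor A I ≠ 0) (hJ : J.Nodup) (hm : m + J.length = p)
    (hvL : ∀ b, v b ∈ realLeaf A I J) (hv : LinearIndependent ℝ v) :
    orientSign A I J hm v * (dualFrame A I J hm v).det = |(dualFrame A I J hm v).det| := by
  rw [orientSign_eq]
  rcases mul_pos_iff.1 (det_mul_det_dualFrame_pos hΔ hJ hm hvL hv) with
    ⟨hcol, hdual⟩ | ⟨hcol, hdual⟩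
  · rw [Real.sign_of_pos hcol, abs_of_pos hdual, one_mul]
  · rw [Real.sign_of_neg hcol, abs_of_neg hdual, neg_one_mul]

end LeafOrientation

/-! ### Bounds for the Barnes integrand -/

section GammaBounds

theorem norm_Gamma_le {z : ℂ} (hz : 0 < z.re) : ‖Complex.Gamma z‖ ≤ Real.Gamma z.re := by
  rw [Complex.Gamma_eq_integral hz, Complex.GammaIntegral, Real.Gamma_eq_integral hz]
  refine (norm_integral_le_integral_norm _).trans (le_of_eq ?_)
  refine setIntegral_congr_fun measurableSet_Ioi fun x hx => ?_
  rw [norm_mul, Complex.norm_real, Real.norm_eq_abs, abs_of_pos (Real.exp_pos _),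
    Complex.norm_cpow_eq_rpow_re_of_pos hx, Complex.sub_re, Complex.one_re]

theorem continuousOn_Gamma_Icc {c₁ c₂ : ℝ} (hc : 0 < c₁) :
    ContinuousOn Real.Gamma (Set.Icc c₁ c₂) := fun _ hx =>
  (Real.differentiableOn_Gamma_Ioi.differentiableAt
    (Ioi_mem_nhds (hc.trans_le hx.1))).continuousAt.continuousWithinAt

theorem exists_norm_Gamma_le {c₁ c₂ : ℝ} (hc : 0 < c₁) :
    ∃ C : ℝ, 0 ≤ C ∧ ∀ z : ℂ, z.re ∈ Set.Icc c₁ c₂ → ‖Complex.Gamma z‖ ≤ C := by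
  obtain ⟨C, hC⟩ := isCompact_Icc.exists_bound_of_continuousOn (continuousOn_Gamma_Icc hc)
  exact ⟨|C|, abs_nonneg C, fun z hz => (norm_Gamma_le (hc.trans_le hz.1)).trans
    ((le_abs_self _).trans ((hC _ hz).trans (le_abs_self C)))⟩

theorem one_add_abs_im_le {c : ℝ} (hc : 0 < c) {z : ℂ} (hz : c ≤ z.re) :
    1 + |z.im| ≤ (c⁻¹ + 1) * ‖z‖ := by
  have hone : 1 ≤ c⁻¹ * ‖z‖ := by
    rw [inv_mul_eq_div, one_le_div hc]
    exact hz.trans (Complex.re_le_norm z)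
  linarith [Complex.abs_im_le_norm z]

/- Each application of `Γ(z) = Γ(z + 1) / z` gains a factor `|z|⁻¹`. -/
theorem exists_norm_Gamma_mul_pow_le {c₁ c₂ : ℝ} (hc : 0 < c₁) (N : ℕ) :
    ∃ C : ℝ, 0 ≤ C ∧ ∀ z : ℂ, z.re ∈ Set.Icc c₁ c₂ →
      ‖Complex.Gamma z‖ * (1 + |z.im|) ^ N ≤ C := by
  induction N generalizing c₁ c₂ with
  | zero => simpa using exists_norm_Gamma_le hc
  | succ N ih =>
    obtain ⟨C, hC0, hC⟩ := ih (c₁ := c₁ + 1) (c₂ := c₂ + 1) (by linarith)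
    refine ⟨(c₁⁻¹ + 1) * C, by positivity, fun z hz => ?_⟩
    have hz0 : z ≠ 0 := by
      rintro rfl
      exact hc.not_ge hz.1
    have hshift : ‖z‖ * ‖Complex.Gamma z‖ * (1 + |z.im|) ^ N ≤ C := by
      rw [← norm_mul, ← Complex.Gamma_add_one z hz0]
      simpa using hC (z + 1) (by simpa using hz)
    calc ‖Complex.Gamma z‖ * (1 + |z.im|) ^ (N + 1)
        = ‖Complex.Gamma z‖ * ((1 + |z.im|) ^ N * (1 + |z.im|)) := by rw [pow_succ]
      _ ≤ ‖Complex.Gamma z‖ * ((1 + |z.im|) ^ N * ((c₁⁻¹ + 1) * ‖z‖)) := by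
        gcongr
        exact one_add_abs_im_le hc hz.1
      _ = (c₁⁻¹ + 1) * (‖z‖ * ‖Complex.Gamma z‖ * (1 + |z.im|) ^ N) := by ring
      _ ≤ (c₁⁻¹ + 1) * C := by gcongr

theorem one_add_norm_le_prod {ι : Type*} [Fintype ι] (y : ι → ℝ) :
    1 + ‖y‖ ≤ ∏ k, (1 + ‖y k‖) := by
  classical
  have hone : ∀ k, 1 ≤ 1 + ‖y k‖ := fun k => le_add_of_nonneg_right (norm_nonneg (y k))
  have hle : ∀ k, 1 + ‖y k‖ ≤ ∏ i, (1 + ‖y i‖) := fun k => by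
    calc 1 + ‖y k‖ = ∏ i, if i = k then 1 + ‖y i‖ else 1 := by simp
      _ ≤ ∏ i, (1 + ‖y i‖) := Finset.prod_le_prod (fun i _ => by positivity) fun i _ => by
        split_ifs
        exacts [le_rfl, hone i]
  have hprod : 1 ≤ ∏ k, (1 + ‖y k‖) := Finset.one_le_prod fun k _ => hone k
  linarith [(pi_norm_le_iff_of_nonneg (sub_nonneg.2 hprod)).2 fun k => le_sub_iff_add_le'.2 (hle k)]

variable {p : ℕ}

theorem mul_pow_le_iff_le_mul_decay (a C : ℝ) (y : Fin p → ℝ) :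
    a * (1 + ‖y‖) ^ (p + 1) ≤ C ↔ a ≤ C * decay y := by
  have hpos : 0 < 1 + ‖y‖ := by positivity
  have hdecay : decay y = ((1 + ‖y‖) ^ (p + 1))⁻¹ := by
    rw [decay, Real.rpow_neg hpos.le]
    norm_cast
  rw [hdecay, ← div_eq_mul_inv, le_div_iff₀ (by positivity)]

theorem exists_norm_prod_Gamma_le {c₁ c₂ : Fin p → ℝ} (hc : ∀ k, 0 < c₁ k) :
    ∃ C : ℝ, 0 ≤ C ∧ ∀ x y : Fin p → ℝ, (∀ k, 1 - x k ∈ Set.Icc (c₁ k) (c₂ k)) →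
      ‖∏ k, Complex.Gamma (1 - cpoint x y k)‖ ≤ C * decay y := by
  choose C hC0 hC using fun k => exists_norm_Gamma_mul_pow_le (c₂ := c₂ k) (hc k) (p + 1)
  refine ⟨∏ k, C k, Finset.prod_nonneg fun k _ => hC0 k, fun x y hx => ?_⟩
  rw [← mul_pow_le_iff_le_mul_decay, norm_prod]
  calc (∏ k, ‖Complex.Gamma (1 - cpoint x y k)‖) * (1 + ‖y‖) ^ (p + 1)
      ≤ (∏ k, ‖Complex.Gamma (1 - cpoint x y k)‖) * (∏ k, (1 + |y k|)) ^ (p + 1) := by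
        gcongr
        exact one_add_norm_le_prod y
    _ = ∏ k, ‖Complex.Gamma (1 - cpoint x y k)‖ * (1 + |y k|) ^ (p + 1) := by
        rw [← Finset.prod_pow, Finset.prod_mul_distrib]
    _ ≤ ∏ k, C k := Finset.prod_le_prod (fun k _ => by positivity) fun k _ => by
        simpa [cpoint] using hC k (1 - cpoint x y k) (by simpa [cpoint] using hx k)

end GammaBounds

section Compact

theorem exists_forall_mem_Icc_of_isCompact {E : Type*} [TopologicalSpace E] {K : Set E}
    (hK : IsCompact K) {f : E → ℝ} (hf : Continuous f) {d : ℝ} (hd : ∀ x ∈ K, d < f x) :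
    ∃ c₁ c₂ : ℝ, d < c₁ ∧ ∀ x ∈ K, f x ∈ Set.Icc c₁ c₂ := by
  rcases K.eq_empty_or_nonempty with rfl | hne
  · exact ⟨d + 1, 0, lt_add_one d, by simp⟩
  · obtain ⟨a, ha, hmin⟩ := hK.exists_isMinOn hne hf.continuousOn
    obtain ⟨b, _, hmax⟩ := hK.exists_isMaxOn hne hf.continuousOn
    exact ⟨f a, f b, hd a ha, fun x hx => ⟨hmin hx, hmax hx⟩⟩

/- A closed thickening of the segment from `x` to `y` is a convex neighbourhood of it. -/
theorem exists_isCompact_convex_subset {E : Type*} [NormedAddCommGroup E] [NormedSpace ℝ E]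
    [ProperSpace E] {S : Set E} (hS : IsOpen S) (hSc : Convex ℝ S) {x y : E} (hx : x ∈ S)
    (hy : y ∈ S) :
    ∃ K : Set E, IsCompact K ∧ Convex ℝ K ∧ K ⊆ S ∧ K ∈ 𝓝 x ∧ K ∈ 𝓝 y := by
  have hseg : IsCompact (segment ℝ x y) := by
    rw [segment_eq_image_lineMap]
    exact isCompact_Icc.image AffineMap.lineMap_continuous
  obtain ⟨δ, hδ, hsub⟩ := hseg.exists_cthickening_subset_open hS (hSc.segment_subset hx hy)
  have hmem : ∀ z ∈ segment ℝ x y, Metric.cthickening δ (segment ℝ x y) ∈ 𝓝 z := fun z hz =>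
    mem_of_superset (Metric.closedBall_mem_nhds z hδ) (Metric.closedBall_subset_cthickening hz δ)
  exact ⟨_, hseg.cthickening, (convex_segment x y).cthickening δ, hsub,
    hmem x (left_mem_segment ℝ x y), hmem y (right_mem_segment ℝ x y)⟩

end Compact

/-! ### The regular part of the Barnes integrand -/

section RegularBase

variable {p n : ℕ}

open Classical in
/-- The least integer `ν` for which `⟨αᵏ, s⟩ = -ν` is one of the hyperplanes in
`polarSet A I J`. -/
def firstPole (I : Fin p ↪o Fin n) (J : List (Fin p)) (k : Fin n) : ℕ :=
  (if k ∈ Set.range I then 0 else 1) + listShift I J k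

theorem firstPole_apply (I : Fin p ↪o Fin n) (J : List (Fin p)) (j : Fin p) :
    firstPole I J (I j) = if j ∈ J then 1 else 0 := by
  rw [firstPole, if_pos ⟨j, rfl⟩, listShift_apply, zero_add]

theorem firstPole_of_notMem {I : Fin p ↪o Fin n} (J : List (Fin p)) {k : Fin n}
    (hk : k ∉ Set.range I) : firstPole I J k = 1 := by
  rw [firstPole, if_neg hk, listShift_of_notMem J hk]

/-- The real parts `x` of the tube around the origin, cut out by the poles of the Barnes integrand,
on which its product with the linear forms `⟨αʲ, s⟩`, `j ∈ J`, is regular. -/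
def regularBase (A : Matrix (Fin p) (Fin n) ℕ) (I : Fin p ↪o Fin n) (J : List (Fin p)) :
    Set (Fin p → ℝ) :=
  {x | (∀ k, x k < 1) ∧ -1 < ∑ k, x k ∧ ∀ k, -(firstPole I J k : ℝ) < col ℝ A k x}

/-- The Barnes integrand without the factor `τ^{-|s|}`, multiplied by the linear forms
`⟨αʲ, s⟩` for `j` in `J`. -/
def barnesReg (A : Matrix (Fin p) (Fin n) ℕ) (I : Fin p ↪o Fin n) (φ : TestForm p n)
    (J : List (Fin p)) (s : Fin p → ℂ) : ℂ :=
  Complex.Gamma ((∑ k, s k) + 1) * (∏ k, Complex.Gamma (1 - s k)) * mellinReg A I φ J s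

variable {A : Matrix (Fin p) (Fin n) ℕ} {I : Fin p ↪o Fin n} {J : List (Fin p)}
  {K : Set (Fin p → ℝ)} {x : Fin p → ℝ}

theorem isOpen_regularBase : IsOpen (regularBase A I J) := by
  simp only [regularBase, Set.ofPred_and, Set.ofPred_forall]
  refine IsOpen.inter ?_ (IsOpen.inter ?_ ?_)
  · exact isOpen_iInter_of_finite fun k => isOpen_lt (continuous_apply k) continuous_const
  · exact isOpen_lt continuous_const (by fun_prop)
  · exact isOpen_iInter_of_finite fun k => isOpen_lt continuous_const (continuous_col A k)

theorem convex_regularBase : Convex ℝ (regularBase A I J) := by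
  simp only [regularBase, Set.ofPred_and, Set.ofPred_forall]
  refine Convex.inter ?_ (Convex.inter ?_ ?_)
  · exact convex_iInter fun k => convex_halfSpace_lt (LinearMap.proj k).isLinear 1
  · have hsum : IsLinearMap ℝ fun x : Fin p → ℝ => ∑ k, x k :=
      ⟨fun x y => Finset.sum_add_distrib, fun c x => (Finset.mul_sum _ _ _).symm⟩
    exact convex_halfSpace_gt hsum (-1)
  · exact convex_iInter fun k => convex_halfSpace_gt (col ℝ A k).isLinear _

theorem re_mellinExp_cpoint (J : List (Fin p)) (x y : Fin p → ℝ) (k : Fin n) :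
    (mellinExp A I (cpoint x y) k).re
      = col ℝ A k x + ((firstPole I J k : ℝ) - listShift I J k) := by
  rw [mellinExp, col_cpoint, firstPole]
  split_ifs <;> simp

theorem sum_cpoint (x y : Fin p → ℝ) :
    ∑ k, cpoint x y k = (∑ k, x k : ℝ) + Complex.I * (∑ k, y k : ℝ) := by
  simp [cpoint, Finset.sum_add_distrib, Finset.mul_sum]

theorem re_sum_cpoint_add_one (x y : Fin p → ℝ) : (∑ k, cpoint x y k + 1).re = ∑ k, x k + 1 := by
  simp [sum_cpoint]

theorem re_one_sub_cpoint (x y : Fin p → ℝ) (k : Fin p) : (1 - cpoint x y k).re = 1 - x k := by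
  simp [cpoint]

theorem notMem_polarSet_of_mem_regularBase (hx : x ∈ regularBase A I J) (y : Fin p → ℝ) :
    cpoint x y ∉ polarSet A I J := by
  rw [mem_polarSet_iff]
  rintro ⟨k, hk⟩
  refine Complex.Gamma_ne_zero_of_re_pos ?_ hk
  rw [Complex.add_re, re_mellinExp_cpoint J, Complex.natCast_re]
  linarith [hx.2.2 k]

theorem analyticAt_barnesReg (φ : TestForm p n) (hx : x ∈ regularBase A I J)
    (y : Fin p → ℝ) : AnalyticAt ℂ (barnesReg A I φ J) (cpoint x y) := by
  have hΓ : ∀ {f : (Fin p → ℂ) → ℂ}, AnalyticAt ℂ f (cpoint x y) →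
      0 < (f (cpoint x y)).re → AnalyticAt ℂ (fun s => Complex.Gamma (f s)) (cpoint x y) :=
    fun hf hre => AnalyticAt.fun_comp (analyticAt_Gamma_of_ne_zero
      (Complex.Gamma_ne_zero_of_re_pos hre)) hf
  have hcoord : ∀ k, AnalyticAt ℂ (fun s : Fin p → ℂ => s k) (cpoint x y) :=
    fun k => analyticAt_linearMap (LinearMap.proj (φ := fun _ : Fin p => ℂ) k) _
  refine ((hΓ ((Finset.analyticAt_fun_sum _ fun k _ => hcoord k).add analyticAt_const) ?_).mul
    (Finset.analyticAt_fun_prod _ fun k _ => hΓ (analyticAt_const.sub (hcoord k)) ?_)).mul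
    (analyticAt_mellinReg A I φ J (notMem_polarSet_of_mem_regularBase hx y))
  · change 0 < (∑ k, cpoint x y k + 1).re
    rw [re_sum_cpoint_add_one]
    linarith [hx.2.1]
  · change 0 < (1 - cpoint x y k).re
    rw [re_one_sub_cpoint]
    linarith [hx.1 k]

theorem exists_norm_mellinReg_le (φ : TestForm p n) (hK : IsCompact K)
    (hKS : K ⊆ regularBase A I J) :
    ∃ C : ℝ, 0 ≤ C ∧ ∀ x ∈ K, ∀ y, ‖mellinReg A I φ J (cpoint x y)‖ ≤ C := by
  choose x₁ x₂ hx₁ hIcc using fun k => exists_forall_mem_Icc_of_isCompact hK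
    (f := fun x : Fin p → ℝ => col ℝ A k x + ((firstPole I J k : ℝ) - listShift I J k))
    (d := -(listShift I J k : ℝ)) ((continuous_col A k).add continuous_const)
    (fun x hx => by linarith [(hKS hx).2.2 k])
  obtain ⟨B, hB, hle⟩ := exists_norm_prod_Gamma_mul_regMellinExt_le (φ.smooth I)
    (φ.compactSupport I) (mellinOrder A I) (listShift I J) (x₁ := x₁) (x₂ := x₂)
    (fun k => by linarith [hx₁ k])
  refine ⟨‖mellinConst A I‖ * B, by positivity, fun x hx y => ?_⟩
  rw [mellinReg, norm_mul]
  gcongr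
  refine hle _ fun k => ?_
  rw [re_mellinExp_cpoint J]
  exact hIcc k x hx

theorem exists_isTubeDominated_barnesReg (φ : TestForm p n) (hK : IsCompact K)
    (hKS : K ⊆ regularBase A I J) :
    ∃ C : ℝ, 0 ≤ C ∧ IsTubeDominated (barnesReg A I φ J) K fun y => C * decay y := by
  choose a₁ a₂ ha₁ ha using fun k => exists_forall_mem_Icc_of_isCompact hK
    (f := fun x : Fin p → ℝ => 1 - x k) (d := 0) (by fun_prop)
    (fun x hx => by linarith [(hKS hx).1 k])
  obtain ⟨b₁, b₂, hb₁, hb⟩ := exists_forall_mem_Icc_of_isCompact hK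
    (f := fun x : Fin p → ℝ => ∑ k, x k + 1) (d := 0) (by fun_prop)
    (fun x hx => by linarith [(hKS hx).2.1])
  obtain ⟨C₁, hC₁, hle₁⟩ := exists_norm_prod_Gamma_le (c₂ := a₂) ha₁
  obtain ⟨C₂, hC₂, hle₂⟩ := exists_norm_Gamma_le (c₂ := b₂) hb₁
  obtain ⟨C₃, hC₃, hle₃⟩ := exists_norm_mellinReg_le φ hK hKS
  refine ⟨C₂ * C₁ * C₃, by positivity,
    fun x hx y => (analyticAt_barnesReg φ (hKS hx) y).differentiableAt, fun x hx y => ?_⟩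
  rw [barnesReg, norm_mul, norm_mul]
  calc _ ≤ C₂ * (C₁ * decay y) * C₃ := by
        have hdecay := decay_nonneg y
        gcongr
        · exact hle₂ _ (by rw [re_sum_cpoint_add_one]; exact hb x hx)
        · exact hle₁ x y fun k => ha k x hx
        · exact hle₃ x hx y
    _ = C₂ * C₁ * C₃ * decay y := by ring

end RegularBase

section BarnesIntegrand

variable {p n : ℕ} {A : Matrix (Fin p) (Fin n) ℕ} {I : Fin p ↪o Fin n} {J : List (Fin p)}
  {x γ : Fin p → ℝ}

theorem mem_regularBase (hlt : ∀ k, x k < 1) (hsum : 0 ≤ ∑ k, x k)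
    (hnonneg : ∀ j ∈ J, 0 ≤ col ℝ A (I j) x) (hpos : ∀ j, j ∉ J → 0 < col ℝ A (I j) x)
    (hfree : PoleFree A I x) : x ∈ regularBase A I J := by
  refine ⟨hlt, by linarith, fun k => ?_⟩
  by_cases hk : k ∈ Set.range I
  · obtain ⟨j, rfl⟩ := hk
    rw [firstPole_apply]
    split_ifs with hj
    · push_cast
      linarith [hnonneg j hj]
    · simpa using hpos j hj
  · simpa [firstPole_of_notMem J hk] using hfree k hk

theorem mem_regularBase_of_mem_admissible (hΔ : minor A I ≠ 0) (hq : 1 ≤ codimZero A I)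
    (hγ : γ ∈ admissible A I) (hfree : PoleFree A I γ) : γ ∈ regularBase A I J := by
  have hpos := col_pos_of_mem_interior hΔ hγ.1
  refine mem_regularBase hγ.2 ?_ (fun j _ => (hpos j).le) (fun j _ => hpos j) hfree
  rw [sum_eq_sum_sumCoeff hΔ]
  exact Finset.sum_nonneg fun j _ => mul_nonneg (sumCoeff_nonneg hΔ hq j) (hpos j).le

theorem IsFaceIndexing.mem_regularBase_of_mem_admissibleFace (hΔ : minor A I ≠ 0)
    (hq : 1 ≤ codimZero A I) (hJ : IsFaceIndexing A I J) (hxL : x ∈ realLeaf A I J)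
    (hx : x ∈ admissibleFace A I) (hfree : PoleFree A I x) : x ∈ regularBase A I J :=
  mem_regularBase (lt_one_of_mem_admissibleFace hΔ hx)
    (hJ.sum_eq_zero_of_mem_realLeaf hΔ hq hxL).ge (fun j hj => (hxL j hj).ge)
    (fun _ hj => hJ.col_pos_of_mem_admissibleFace hΔ hx hj) hfree

theorem complexify_col (k : Fin n) : complexify (col ℝ A k) = col ℂ A k := by
  simp [complexify, col, Pi.single_apply]

theorem IsFaceIndexing.sum_cpoint_eq (hΔ : minor A I ≠ 0) (hq : 1 ≤ codimZero A I)
    (hJ : IsFaceIndexing A I J) (x y : Fin p → ℝ) : ∑ l, cpoint x y l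
      = ∑ a : Fin J.length, (sumCoeff A I (J.get a) : ℂ) * col ℂ A (I (J.get a)) (cpoint x y) := by
  rw [sum_cpoint, hJ.sum_eq hΔ hq x, hJ.sum_eq hΔ hq y]
  simp only [col_cpoint, Complex.ofReal_sum, Complex.ofReal_mul, Finset.mul_sum,
    ← Finset.sum_add_distrib]
  exact Finset.sum_congr rfl fun a _ => by ring

theorem cpow_neg_eq_exp {τ : ℝ} (hτ : 0 < τ) (z : ℂ) :
    (τ : ℂ) ^ (-z) = Complex.exp ((-Real.log τ : ℝ) * z) := by
  rw [Complex.cpow_def_of_ne_zero (by exact_mod_cast hτ.ne'), ← Complex.ofReal_log hτ.le]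
  push_cast
  rw [mul_neg, neg_mul]

/- With `T = -log τ`, the power `τ^{-|s|}` is `exp (T ∑ c_a λ_a)`, because `|s|` is a combination
of the forms `λ_a = ⟨α^{j_a}, s⟩`; these are also the only polar factors. -/
theorem IsFaceIndexing.barnesIntegrand_eq (hΔ : minor A I ≠ 0) (hq : 1 ≤ codimZero A I)
    (hJ : IsFaceIndexing A I J) (φ : TestForm p n) (hγ : γ ∈ admissible A I)
    (hfree : PoleFree A I γ) {τ : ℝ} (hτ : 0 < τ) (y : Fin p → ℝ) :
    barnesIntegrand A I φ τ (cpoint γ y)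
      = barnesKernel (fun a => col ℝ A (I (J.get a))) (fun a => sumCoeff A I (J.get a))
          (barnesReg A I φ J) (-Real.log τ) (cpoint γ y) := by
  have hne : ∀ j ∈ J, col ℂ A (I j) (cpoint γ y) ≠ 0 := fun j _ h => by
    have hre := congrArg Complex.re h
    rw [← complexify_col, re_complexify_cpoint, Complex.zero_re] at hre
    exact (col_pos_of_mem_interior hΔ hγ.1 j).ne' hre
  have hreg := notMem_polarSet_of_mem_regularBase
    (mem_regularBase_of_mem_admissible hΔ hq (J := J) hγ hfree) y
  simp only [barnesKernel, complexify_col]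
  rw [barnesIntegrand, mellinGamma_eq hΔ φ (notMem_polarSet_nil hreg hne),
    mellinReg_nil_eq A I φ hJ.1 hne,
    ← Fin.prod_univ_fun_getElem J fun j => (col ℂ A (I j) (cpoint γ y))⁻¹,
    ← hJ.sum_cpoint_eq hΔ hq, cpow_neg_eq_exp hτ, barnesReg]
  simp only [List.get_eq_getElem]
  ring

end BarnesIntegrand

/-! ### The residue form of the Mellin transform -/

section MellinResidue

variable {p n : ℕ} {A : Matrix (Fin p) (Fin n) ℕ} {I : Fin p ↪o Fin n} {J : List (Fin p)} {m : ℕ}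
  {hm : m + J.length = p} {φ : TestForm p n}

theorem hasSimplePoles_mellinForm (φ : TestForm p n) (hΔ : minor A I ≠ 0) (hJ : J.Nodup)
    (hm : m + J.length = p) :
    HasSimplePoles (fun j => col ℂ A (I j)) (polarSet A I J)ᶜ J (mellinForm A I φ hm)
      (mellinReg A I φ J) (Matrix.detRowAlternating.domDomCongr (finCongr hm.symm)) := by
  intro z hz h0
  rw [mellinForm, mellinGamma_eq hΔ φ (notMem_polarSet_nil hz h0), mellinReg_nil_eq A I φ hJ h0]
  rfl

theorem isDualFamily_dualVec (hΔ : minor A I ≠ 0) (hJ : J.Nodup) :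
    IsDualFamily ⊤ (fun j => col ℂ A (I j)) (fun j => cpoint (dualVec A I j) 0) J where
  nodup := hJ
  mem _ _ := Submodule.mem_top
  apply i _ j _ := by
    rw [col_cpoint, col_dualVec hΔ]
    split_ifs <;> simp

theorem exists_isMellinResidue (φ : TestForm p n) (hΔ : minor A I ≠ 0) (hJ : J.Nodup)
    (hm : m + J.length = p) : ∃ ρ : Form (leaf A I J) m, IsMellinResidue A I φ J hm ρ :=
  ⟨_, isCompositeResidue_smul_contract (isClosed_polarSet A I J).isOpen_compl
    (fun _ hz => analyticAt_mellinReg A I φ J hz) (isDualFamily_dualVec hΔ hJ)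
    (by rw [finrank_top, Module.finrank_fin_fun, hm]) (hasSimplePoles_mellinForm φ hΔ hJ hm)⟩

theorem IsMellinResidue.apply_eq (hΔ : minor A I ≠ 0) (hJ : J.Nodup)
    {ρ : Form (leaf A I J) m} (hρ : IsMellinResidue A I φ J hm ρ)
    {s : leaf A I J} (hs : (s : Fin p → ℂ) ∉ polarSet A I J) (v : Fin m → realLeaf A I J) :
    ρ s (fun b => leafPoint A I J 0 (v b)) = mellinReg A I φ J s
      * (Complex.I ^ m * ((dualFrame A I J hm fun b => (v b : Fin p → ℝ)).det : ℂ)) := by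
  have hw : ∀ j, cpoint (dualVec A I j) 0 = fun l => (dualVec A I j l : ℂ) := fun j => by
    ext l
    simp [cpoint]
  have hv : ∀ b, (leafPoint A I J 0 (v b) : Fin p → ℂ)
      = fun l => Complex.I * ((v b : Fin p → ℝ) l : ℂ) := fun b => by
    ext l
    simp [leafPoint, cpoint]
  rw [IsCompositeResidue.eq_smul_contract (isClosed_polarSet A I J).isOpen_compl
    (fun _ hz => analyticAt_mellinReg A I φ J hz) (isDualFamily_dualVec hΔ hJ)
    (hasSimplePoles_mellinForm φ hΔ hJ hm) hρ s hs, AlternatingMap.smul_apply,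
    AlternatingMap.compLinearMap_apply, contract_apply, smul_eq_mul, dualFrame,
    ← frameMatrix_det_ofReal]
  simp only [AlternatingMap.domDomCongr_apply, Submodule.subtype_apply, hw, hv]
  rfl

theorem leafIntegrand_eq (hΔ : minor A I ≠ 0) (hq : 1 ≤ codimZero A I)
    (hJ : IsFaceIndexing A I J) {ρ : Form (leaf A I J) m} (hρ : IsMellinResidue A I φ J hm ρ)
    {γ : realLeaf A I J} (hγ : (γ : Fin p → ℝ) ∈ regularBase A I J)
    (v : Fin m → realLeaf A I J) (t : Fin m → ℝ) :
    leafIntegrand A I J ρ γ v t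
      = Complex.I ^ m * ((dualFrame A I J hm fun b => (v b : Fin p → ℝ)).det : ℂ)
        * barnesReg A I φ J (cpoint γ (∑ b, t b • (v b : Fin p → ℝ))) := by
  have hv : ((∑ b, t b • v b : realLeaf A I J) : Fin p → ℝ) = ∑ b, t b • (v b : Fin p → ℝ) := by
    simp
  have hpt : (leafPoint A I J γ (∑ b, t b • v b) : Fin p → ℂ)
      = cpoint γ (∑ b, t b • (v b : Fin p → ℝ)) := congrArg (cpoint _) hv
  have hsum : ∑ k, cpoint (γ : Fin p → ℝ) (∑ b, t b • (v b : Fin p → ℝ)) k = 0 := by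
    rw [sum_cpoint, hJ.sum_eq_zero_of_mem_realLeaf hΔ hq γ.2, ← hv,
      hJ.sum_eq_zero_of_mem_realLeaf hΔ hq (∑ b, t b • v b : realLeaf A I J).2]
    simp
  rw [leafIntegrand, hρ.apply_eq hΔ hJ.1
    (by rw [hpt]; exact notMem_polarSet_of_mem_regularBase hγ _), hpt, barnesReg, hsum, zero_add,
    Complex.Gamma_one]
  ring

theorem leafIntegral_eq (hΔ : minor A I ≠ 0) (hq : 1 ≤ codimZero A I)
    (hJ : IsFaceIndexing A I J) {ρ : Form (leaf A I J) m} (hρ : IsMellinResidue A I φ J hm ρ)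
    {γ : realLeaf A I J} (hγ : (γ : Fin p → ℝ) ∈ regularBase A I J) {v : Fin m → realLeaf A I J}
    (hv : LinearIndependent ℝ fun b => (v b : Fin p → ℝ)) :
    leafIntegral A I J hm ρ γ v
      = Complex.I ^ m * (|(dualFrame A I J hm fun b => (v b : Fin p → ℝ)).det|
        * ∫ t : Fin m → ℝ, barnesReg A I φ J (cpoint γ (∑ b, t b • (v b : Fin p → ℝ)))) := by
  simp only [leafIntegral, leafIntegrand_eq hΔ hq hJ hρ hγ, integral_const_mul]
  rw [← orientSign_mul_det_dualFrame hΔ hJ.1 hm (fun b => (v b).2) hv]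
  push_cast
  ring

end MellinResidue

/-! ### The limit of the Barnes integral -/

section BarnesLimit

variable {p n : ℕ} {A : Matrix (Fin p) (Fin n) ℕ} {I : Fin p ↪o Fin n} {φ : TestForm p n}
  {J : List (Fin p)} {m : ℕ} {hm : m + J.length = p} {γ : Fin p → ℝ}

theorem integrable_barnesIntegrand (hΔ : minor A I ≠ 0) (hq : 1 ≤ codimZero A I)
    (φ : TestForm p n) (hγ : γ ∈ admissible A I) (hfree : PoleFree A I γ) {τ : ℝ} (hτ : 0 < τ) :
    Integrable fun y : Fin p → ℝ => barnesIntegrand A I φ τ (cpoint γ y) := by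
  obtain ⟨J, hJ⟩ := exists_isFaceIndexing hΔ hq
  obtain ⟨C, -, hdom⟩ := exists_isTubeDominated_barnesReg (J := J) φ isCompact_singleton
    (Set.singleton_subset_iff.2 (mem_regularBase_of_mem_admissible hΔ hq hγ hfree))
  simp only [hJ.barnesIntegrand_eq hΔ hq φ hγ hfree hτ]
  exact integrable_barnesKernel hdom (integrable_decay.const_mul C) (Set.mem_singleton γ)
    (fun a => col_pos_of_mem_interior hΔ hγ.1 _) _

theorem exists_integrable_const_mul_decay_frameMap_le {q : ℕ} {hp : q + m = p}
    {w : Fin q → Fin p → ℝ} {v : Fin m → Fin p → ℝ} (hdet : (frameMatrix hp w v).det ≠ 0) {C : ℝ}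
    (hC : 0 ≤ C) :
    ∃ B : (Fin m → ℝ) → ℝ, Integrable B ∧ ∀ z, C * decay (frameMap w v z) ≤ B z.2 := by
  obtain ⟨B, hB, hle⟩ := exists_integrable_decay_frameMap_le hdet
  exact ⟨fun t => C * B t, hB.const_mul C, fun z => mul_le_mul_of_nonneg_left (hle z) hC⟩

theorem integrable_leafIntegrand (hΔ : minor A I ≠ 0) (hq : 1 ≤ codimZero A I)
    (hJ : IsFaceIndexing A I J) {ρ : Form (leaf A I J) m} (hρ : IsMellinResidue A I φ J hm ρ)
    {γ : realLeaf A I J} (hγ : (γ : Fin p → ℝ) ∈ regularBase A I J) {v : Fin m → realLeaf A I J}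
    (hv : LinearIndependent ℝ fun b => (v b : Fin p → ℝ)) :
    Integrable (leafIntegrand A I J ρ γ v) := by
  obtain ⟨C, hC, hdom⟩ := exists_isTubeDominated_barnesReg φ isCompact_singleton
    (Set.singleton_subset_iff.2 hγ)
  obtain ⟨B, hB, hle⟩ := exists_integrable_const_mul_decay_frameMap_le
    (isAdaptedFrame_dualVec hΔ hJ.1 hm (fun b => (v b).2) hv).det_ne_zero hC
  simp only [funext (leafIntegrand_eq hΔ hq hJ hρ hγ v)]
  exact (hdom.integrable_slice hB hle (Set.mem_singleton _)).const_mul _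

theorem tendsto_integral_barnesIntegrand (hΔ : minor A I ≠ 0) (hq : 1 ≤ codimZero A I)
    (hJ : IsFaceIndexing A I J) (φ : TestForm p n) (hm : m + J.length = p)
    (hγ : γ ∈ admissible A I) (hfree : PoleFree A I γ) {x : realLeaf A I J}
    (hx : (x : Fin p → ℝ) ∈ regularBase A I J) {v : Fin m → Fin p → ℝ}
    (hvL : ∀ b, v b ∈ realLeaf A I J) (hv : LinearIndependent ℝ v) :
    Tendsto (fun τ => ∫ y : Fin p → ℝ, barnesIntegrand A I φ τ (cpoint γ y)) (𝓝[>] 0)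
      (𝓝 ((2 * Real.pi) ^ J.length * (|(dualFrame A I J hm v).det|
        * ∫ t : Fin m → ℝ, barnesReg A I φ J (cpoint x (∑ b, t b • v b))))) := by
  obtain ⟨K, hKcomp, hKconv, hKS, hγK, hxK⟩ := exists_isCompact_convex_subset isOpen_regularBase
    convex_regularBase (mem_regularBase_of_mem_admissible hΔ hq hγ hfree) hx
  obtain ⟨C, hC, hdom⟩ := exists_isTubeDominated_barnesReg φ hKcomp hKS
  have hframe := isAdaptedFrame_dualVec hΔ hJ.1 hm hvL hv
  obtain ⟨B, hB, hle⟩ := exists_integrable_const_mul_decay_frameMap_le hframe.det_ne_zero hC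
  have hkernel := tendsto_integral_barnesKernel hdom (integrable_decay.const_mul C) hKconv hframe
    hB hle (c := fun a => sumCoeff A I (J.get a)) (fun a => (hJ.mem_iff hΔ _).1 (J.get_mem a))
    (mem_of_mem_nhds hγK) (fun a => col_pos_of_mem_interior hΔ hγ.1 _)
    (fun a => x.2 _ (J.get_mem a)) hxK
  have hlog : Tendsto (fun τ : ℝ => -Real.log τ) (𝓝[>] 0) atTop :=
    tendsto_neg_atBot_atTop.comp Real.tendsto_log_nhdsGT_zero
  refine (hkernel.comp hlog).congr' ?_
  filter_upwards [self_mem_nhdsWithin] with τ hτ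
  simp only [Function.comp, hJ.barnesIntegrand_eq hΔ hq φ hγ hfree hτ]

theorem inv_two_pi_I_pow_mul {q : ℕ} (hp : m + q = p) (z : ℂ) :
    1 / (2 * Real.pi * Complex.I) ^ p * (Complex.I ^ p * ((2 * Real.pi) ^ q * z))
      = 1 / (2 * Real.pi * Complex.I) ^ m * (Complex.I ^ m * z) := by
  have hpi : (Real.pi : ℂ) ≠ 0 := by exact_mod_cast Real.pi_ne_zero
  subst hp
  simp only [pow_add, mul_pow]
  field_simp [Complex.I_ne_zero]

theorem tendsto_barnesIntegral (hΔ : minor A I ≠ 0) (hq : 1 ≤ codimZero A I)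
    (hJ : IsFaceIndexing A I J) {ρ : Form (leaf A I J) m} (hρ : IsMellinResidue A I φ J hm ρ)
    (hγ : γ ∈ admissible A I) (hfree : PoleFree A I γ) {x : realLeaf A I J}
    (hx : (x : Fin p → ℝ) ∈ regularBase A I J) {v : Fin m → realLeaf A I J}
    (hv : LinearIndependent ℝ fun b => (v b : Fin p → ℝ)) :
    Tendsto (barnesIntegral A I φ γ) (𝓝[>] 0)
      (𝓝 (1 / (2 * Real.pi * Complex.I) ^ m * leafIntegral A I J hm ρ x v)) := by
  have hlim := tendsto_integral_barnesIntegrand hΔ hq hJ φ hm hγ hfree hx (fun b => (v b).2) hv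
  rw [leafIntegral_eq hΔ hq hJ hρ hx hv, ← inv_two_pi_I_pow_mul hm]
  exact (hlim.const_mul (Complex.I ^ p)).const_mul _

end BarnesLimit

end BochnerMartinelli

end

open BochnerMartinelli in
theorem lemma2 {p n : ℕ} (A : Matrix (Fin p) (Fin n) ℕ) (I : Fin p ↪o Fin n)
    (φ : TestForm p n) (hΔ : minor A I ≠ 0) (hq : 1 ≤ codimZero A I) :
    IsMellinContinuation A I φ (mellinGamma A I φ) ∧
    (∃ J : List (Fin p), IsFaceIndexing A I J) ∧
    ∀ (J : List (Fin p)), IsFaceIndexing A I J → ∀ (m : ℕ) (hm : m + J.length = p),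
      (∃ ρ : Form (leaf A I J) m, IsMellinResidue A I φ J hm ρ) ∧
      ∀ ρ : Form (leaf A I J) m, IsMellinResidue A I φ J hm ρ →
        ∀ γ ∈ admissible A I, PoleFree A I γ →
        ∀ γq : realLeaf A I J, (γq : Fin p → ℝ) ∈ admissibleFace A I →
          PoleFree A I (γq : Fin p → ℝ) →
        ∀ v : Module.Basis (Fin m) ℝ (realLeaf A I J),
          (∀ τ : ℝ, 0 < τ →
            MeasureTheory.Integrable fun y : Fin p → ℝ =>
              barnesIntegrand A I φ τ (cpoint γ y)) ∧
          MeasureTheory.Integrable (leafIntegrand A I J ρ γq v) ∧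
          Filter.Tendsto (barnesIntegral A I φ γ) (nhdsWithin 0 (Set.Ioi 0))
            (nhds (1 / (2 * Real.pi * Complex.I) ^ m * leafIntegral A I J hm ρ γq v)) := by
  refine ⟨isMellinContinuation_mellinGamma hΔ φ, exists_isFaceIndexing hΔ hq, fun J hJ m hm =>
    ⟨exists_isMellinResidue φ hΔ hJ.1 hm, fun ρ hρ γ hγ hγfree γq hγq hγqfree v => ?_⟩⟩
  have hγqreg := hJ.mem_regularBase_of_mem_admissibleFace hΔ hq γq.2 hγq hγqfree
  have hv : LinearIndependent ℝ fun b => (v b : Fin p → ℝ) :=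
    v.linearIndependent.map' (Submodule.subtype _) (Submodule.ker_subtype _)
  exact ⟨fun τ hτ => integrable_barnesIntegrand hΔ hq φ hγ hγfree hτ,
    integrable_leafIntegrand hΔ hq hJ hρ hγqreg hv,
    tendsto_barnesIntegral hΔ hq hJ hρ hγ hγfree hγqreg hv⟩
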